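/- Let $n\in\mathbb N$, $\mathcal X=L^2(\mathbb R^n;\mathbb C^{n+2})$, and let $D$ be a (possibly unbounded) self-adjoint operator in $\mathcal X$, with domain $\mathsf D(D)$ and range $\mathsf R(D)$; put $\mathcal H=\overline{\mathsf R(D)}$. Let $U\subseteq\mathbb C$ be open and let $z\mapsto B_z$, $U\to L^\infty(\mathbb R^n;\mathcal L(\mathbb C^{n+2}))$, be holomorphic with $\sup_{z\in U}\|B_z\|_\infty<\infty$. Write $B_z$ also for the operator of multiplication by $B_z$ on $\mathcal X$, and suppose that there is $\kappa>0$ with $$\operatorname{Re}\langle B_zu,u\rangle\ge\kappa\|u\|_2^2\qquad\text{for all }u\in\mathcal H,\ z\in U.$$ Let $DB_z$ have its natural domain $\{u\in\mathcal X: B_zu\in\mathsf D(D)\}$, let $\mathsf N(DB_z)$ be its null space, and let $T_z$ be its part in $\mathcal H$, i.e. the restriction of $DB_z$ to $\{u\in\mathcal H: B_zu\in\mathsf D(D)\}$ regarded as an operator in $\mathcal H$. Notation. For $0<\mu<\frac{\pi}{2}$ let $S_\mu^o=\{\zeta\ne0:|\arg\zeta|<\mu\}\cup\{\zeta\neq 0:|\arg(-\zeta)|<\mu\}$,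 and for $0\le\omega<\frac\pi2$ let $S_\omega=\{0\}\cup\{\zeta\neq 0:|\arg\zeta|\le\omega\text{ or }|\arg(-\zeta)|\le\omega\}$. A closed operator $T$ is bisectorial of type $\omega$ if $\sigma(T)\subseteq S_\omega$ and for each $\mu\in(\omega,\frac\pi2)$ there is $C_\mu$ with $\|(T-\lambda I)^{-1}\|\le C_\mu|\lambda|^{-1}$ for all $\lambda\notin S_\mu$. $H^\infty(S_\mu^o)$ is the set of bounded holomorphic functions on $S_\mu^o$, with the supremum norm $\|\cdot\|_\infty$, and $\Psi(S_\mu^o)$ is the set of $\psi\in H^\infty(S_\mu^o)$ with $|\psi(\zeta)|\le C|\zeta|^s(1+|\zeta|^{2s})^{-1}$ on $S_\mu^o$ for some $s,C>0$. For $T$ bisectorial of type $\omega$, $\omega<\theta<\mu$ and $\psi\in\Psi(S^o_\mu)$, put $\psi(T)=\frac1{2\pi i}\int_\gamma\psi(\zeta)(T-\zeta I)^{-1}\,d\zeta$, where $\gamma$ is the boundary of $S_\theta$ with each of the two sectors traversed clockwise. If in addition $T$ is injective and $f\in H^\infty(S_\mu^o)$, put $f(T)=\psi_0(T)^{-1}(f\psi_0)(T)$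 with its natural domain, where $\psi_0(\zeta)=\zeta/(1+\zeta^2)$. "Holomorphic" for operator-valued maps means holomorphic in operator norm. Theorem. (0) If $0\le\omega<\frac\pi2$ and $|\arg\langle B_zu,u\rangle|\le\omega$ for all $z\in U$ and all $u\in\mathcal H$ with $u\ne0$, then $DB_z$ is bisectorial of type $\omega$ for every $z\in U$. In particular there is $\omega\in[0,\frac\pi2)$ such that $DB_z$ is bisectorial of type $\omega$ for every $z\in U$. Now let $0\le\omega<\mu<\frac\pi2$, where $\omega$ is any number such that $DB_z$ is bisectorial of type $\omega$ for every $z\in U$. Then: (1) for every $t\in\mathbb C\setminus S_\mu^o$ the operator $I+tDB_z$ has a bounded inverse on $\mathcal X$ for each $z\in U$ (understood as the identity if $t=0$), and $z\mapsto(I+tDB_z)^{-1}\in\mathcal L(\mathcal X)$ is holomorphic in $U$; (2) for each $z\in U$ there is a bounded projection $\mathbb P_{\mathsf N(DB_z)}$ of $\mathcal X$ onto $\mathsf N(DB_z)$ with null space $\overline{\mathsf R(DB_z)}$, and $z\mapsto\mathbb P_{\mathsf N(DB_z)}\in\mathcal L(\mathcal X)$ is holomorphic in $U$; (3) for every $\psi\in\Psi(S_\mu^o)$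 the integrals defining $\psi(DB_z)\in\mathcal L(\mathcal X)$ and $\psi(T_z)\in\mathcal L(\mathcal H)$ converge absolutely, and $z\mapsto\psi(DB_z)$ and $z\mapsto\psi(T_z)$ are holomorphic in $U$. Moreover, suppose that there is a constant $C_\mu$ such that for all $z\in U$ and all $f\in H^\infty(S_\mu^o)$ the operator $f(T_z)$ is everywhere defined and bounded on $\mathcal H$ with $\|f(T_z)u\|_2\le C_\mu\|f\|_\infty\|u\|_2$ for all $u\in\mathcal H$. Then, for every $f\in H^\infty(S_\mu^o)$, $z\mapsto f(T_z)\in\mathcal L(\mathcal H)$ is holomorphic in $U$; and for each $c\in\mathbb C$ so is its extension to $\mathcal X$, the $\mathcal L(\mathcal X)$-valued map which equals $f(T_z)$ on $\mathcal H=\overline{\mathsf R(DB_z)}$ and $c$ times the identity on $\mathsf N(DB_z)$. (The assertions on $\psi$ and $f$ hold with any choice of $\theta\in(\omega,\mu)$, the same in the hypothesis and the conclusion.) -/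

import Mathlib

open MeasureTheory Set
open scoped ENNReal

noncomputable section

namespace AnalyticDependence

section Abstract

variable {X : Type*} [NormedAddCommGroup X] [NormedSpace ℂ X]

/-- The unbounded operator `a I + t T`, with the domain of `T`. -/
def affine (a t : ℂ) (T : X →ₗ.[ℂ] X) : X →ₗ.[ℂ] X where
  domain := T.domain
  toFun := a • T.domain.subtype + t • T.toFun

/-- `R` is a bounded, everywhere defined, two-sided inverse of the unbounded operator `S`. -/
def HasBoundedInverse (S : X →ₗ.[ℂ] X) (R : X →L[ℂ] X) : Prop :=
  (∀ u : X, ∃ h : R u ∈ S.domain, S ⟨R u, h⟩ = u) ∧ ∀ v : S.domain, R (S v) = (v : X)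

open Classical in
/-- The bounded inverse of `S` (with the value `0` if there is none). -/
def boundedInverse (S : X →ₗ.[ℂ] X) : X →L[ℂ] X :=
  if h : ∃ R, HasBoundedInverse S R then h.choose else 0

/-- The resolvent `(T - l I)⁻¹`. -/
def resolventAt (T : X →ₗ.[ℂ] X) (l : ℂ) : X →L[ℂ] X :=
  boundedInverse (affine (-l) 1 T)

/-- The spectrum of an unbounded operator. -/
def spectrumOf (T : X →ₗ.[ℂ] X) : Set ℂ :=
  {l | ¬ ∃ R, HasBoundedInverse (affine (-l) 1 T) R}

open Classical in
/-- `(I + t T)⁻¹`. For `t = 0` this is the identity of the whole space (and not only of the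
domain of `T`). -/
def resolventFamily (T : X →ₗ.[ℂ] X) (t : ℂ) : X →L[ℂ] X :=
  if t = 0 then ContinuousLinearMap.id ℂ X else boundedInverse (affine 1 t T)

/-- The composition `T B` of an unbounded operator with a bounded one, with its natural domain
`{u | B u ∈ D(T)}`. -/
def precomp (T : X →ₗ.[ℂ] X) (B : X →L[ℂ] X) : X →ₗ.[ℂ] X where
  domain := T.domain.comap (B : X →ₗ[ℂ] X)
  toFun := T.toFun ∘ₗ (B : X →ₗ[ℂ] X).submoduleComap T.domain

/-- The null space of `T`. -/
def nullSpace (T : X →ₗ.[ℂ] X) : Submodule ℂ X :=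
  (LinearMap.ker T.toFun).map T.domain.subtype

/-- The closure of the range of `T`. -/
def rangeClosure (T : X →ₗ.[ℂ] X) : Submodule ℂ X :=
  (LinearMap.range T.toFun).topologicalClosure

/-- `P` is the bounded projection onto the null space of `T` along the closure of the range of `T`
(its existence says that `X` is the topological direct sum of these two subspaces). -/
def IsNullProjection (T : X →ₗ.[ℂ] X) (P : X →L[ℂ] X) : Prop :=
  P ∘L P = P ∧ LinearMap.range (P : X →ₗ[ℂ] X) = nullSpace T ∧
    LinearMap.ker (P : X →ₗ[ℂ] X) = rangeClosure T

/-- The restriction (part) of `T` in the subspace `K`: its domain is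
`{u ∈ K | u ∈ D(T), T u ∈ K}`. -/
def part (T : X →ₗ.[ℂ] X) (K : Submodule ℂ X) : K →ₗ.[ℂ] K where
  domain :=
    { carrier := {u | ∃ h : (u : X) ∈ T.domain, T ⟨u, h⟩ ∈ K}
      add_mem' := by
        rintro u v ⟨hu, hu'⟩ ⟨hv, hv'⟩
        refine ⟨T.domain.add_mem hu hv, ?_⟩
        have h := T.map_add ⟨u, hu⟩ ⟨v, hv⟩
        exact h ▸ K.add_mem hu' hv'
      zero_mem' := by
        refine ⟨T.domain.zero_mem, ?_⟩
        have h := T.map_zero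
        exact h ▸ K.zero_mem
      smul_mem' := by
        rintro c u ⟨hu, hu'⟩
        refine ⟨T.domain.smul_mem c hu, ?_⟩
        have h := T.map_smul c ⟨u, hu⟩
        exact h ▸ K.smul_mem c hu' }
  toFun :=
    { toFun := fun u => ⟨T ⟨((u : K) : X), u.2.choose⟩, u.2.choose_spec⟩
      map_add' := by
        intro u v
        exact Subtype.ext (T.map_add ⟨((u : K) : X), u.2.choose⟩ ⟨((v : K) : X), v.2.choose⟩)
      map_smul' := by
        intro c u
        exact Subtype.ext (T.map_smul c ⟨((u : K) : X), u.2.choose⟩) }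

/-- The open sector of half-angle `μ` around the positive half-line. -/
def openSector (μ : ℝ) : Set ℂ := {z | z ≠ 0 ∧ |z.arg| < μ}

/-- The closed sector of half-angle `ω` around the positive half-line. -/
def closedSector (ω : ℝ) : Set ℂ := {z | |z.arg| ≤ ω} ∪ {0}

/-- The open bisector of half-angle `μ`. -/
def openBisector (μ : ℝ) : Set ℂ := openSector μ ∪ {z | -z ∈ openSector μ}

/-- The closed bisector of half-angle `ω`. -/
def closedBisector (ω : ℝ) : Set ℂ := closedSector ω ∪ {z | -z ∈ closedSector ω}

/-- `T` is bisectorial of type `ω` (for `0 ≤ ω < π / 2`). -/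
def IsBisectorial (T : X →ₗ.[ℂ] X) (ω : ℝ) : Prop :=
  T.IsClosed ∧ spectrumOf T ⊆ closedBisector ω ∧
    ∀ μ : ℝ, ω < μ → μ < Real.pi / 2 → ∃ C : ℝ, 0 < C ∧
      ∀ l : ℂ, l ∉ closedBisector μ → ‖resolventAt T l‖ ≤ C * ‖l‖⁻¹

/-- Bounded holomorphic functions on the open bisector. -/
def HInfty (μ : ℝ) : Set (ℂ → ℂ) :=
  {f | DifferentiableOn ℂ f (openBisector μ) ∧ ∃ M : ℝ, ∀ z ∈ openBisector μ, ‖f z‖ ≤ M}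

/-- The supremum norm on the open bisector. -/
def supNorm (μ : ℝ) (f : ℂ → ℂ) : ℝ := ⨆ z : openBisector μ, ‖f z‖

/-- The functions in `HInfty μ` which decay polynomially at `0` and at `∞`. -/
def Psi (μ : ℝ) : Set (ℂ → ℂ) :=
  {ψ | ψ ∈ HInfty μ ∧ ∃ s C : ℝ, 0 < s ∧ 0 < C ∧
    ∀ z ∈ openBisector μ, ‖ψ z‖ ≤ C * ‖z‖ ^ s * (1 + ‖z‖ ^ (2 * s))⁻¹}

/-- The integrand on the ray `{r e | r > 0}`, run through from `0` to `∞`: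
`ψ(z) (T - z I)⁻¹ dz` with `z = r e`, `dz = e dr`. -/
def rayIntegrand (T : X →ₗ.[ℂ] X) (ψ : ℂ → ℂ) (e : ℂ) (r : ℝ) : X →L[ℂ] X :=
  (ψ (r * e) * e) • resolventAt T (r * e)

/-- The integrand on the boundary of the bisector of half-angle `θ`, both halves of it being run
through clockwise: outwards on the rays through `± exp (i θ)` and inwards on the rays through
`± exp (- i θ)`. -/
def contourIntegrand (T : X →ₗ.[ℂ] X) (θ : ℝ) (ψ : ℂ → ℂ) (r : ℝ) : X →L[ℂ] X :=
  rayIntegrand T ψ (Complex.exp (θ * Complex.I)) r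
    - rayIntegrand T ψ (Complex.exp (-(θ * Complex.I))) r
    + rayIntegrand T ψ (-Complex.exp (θ * Complex.I)) r
    - rayIntegrand T ψ (-Complex.exp (-(θ * Complex.I))) r

/-- `ψ(T) = (2 π i)⁻¹ ∫_γ ψ(z) (T - z I)⁻¹ dz`, where `γ` is the boundary of the bisector of
half-angle `θ`. -/
def psiCalculus (T : X →ₗ.[ℂ] X) (θ : ℝ) (ψ : ℂ → ℂ) : X →L[ℂ] X :=
  (2 * (Real.pi : ℂ) * Complex.I)⁻¹ • ∫ r in Ioi (0 : ℝ), contourIntegrand T θ ψ r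

/-- The regulariser `z / (1 + z ^ 2)`. -/
def regulariser (z : ℂ) : ℂ := z / (1 + z ^ 2)

/-- `f(T) = ψ(T)⁻¹ (f ψ)(T)` with `ψ(z) = z / (1 + z ^ 2)`, an unbounded operator with its natural
domain, for an injective bisectorial operator `T` and a function `f` in `HInfty μ`. -/
def hInftyCalculus (T : X →ₗ.[ℂ] X) (θ : ℝ) (f : ℂ → ℂ) : X →ₗ.[ℂ] X :=
  precomp ((psiCalculus T θ regulariser : X →ₗ[ℂ] X).toPMap ⊤).inverse
    (psiCalculus T θ (fun z => f z * regulariser z))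

/-- The unbounded operator `S` is everywhere defined and equal to the bounded operator `F`. -/
def EqBounded (S : X →ₗ.[ℂ] X) (F : X →L[ℂ] X) : Prop := S = (F : X →ₗ[ℂ] X).toPMap ⊤

/-- `f(T)` is bounded with `‖f(T)‖ ≤ C ‖f‖_∞` for all bounded holomorphic `f` on the open bisector
of half-angle `μ`. -/
def HasBoundedCalculus (T : X →ₗ.[ℂ] X) (θ μ C : ℝ) : Prop :=
  ∀ f ∈ HInfty μ, ∃ F : X →L[ℂ] X, EqBounded (hInftyCalculus T θ f) F ∧
    ∀ u : X, ‖F u‖ ≤ C * supNorm μ f * ‖u‖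

end Abstract

/-- The space `L²(ℝⁿ; ℂⁿ⁺²)`. -/
abbrev L2 (n : ℕ) : Type :=
  Lp (EuclideanSpace ℂ (Fin (n + 2))) 2 (volume : Measure (EuclideanSpace ℝ (Fin n)))

/-- The space `L^∞(ℝⁿ; 𝓛(ℂⁿ⁺²))`, with the operator norm on `𝓛(ℂⁿ⁺²)`. -/
abbrev LInf (n : ℕ) : Type :=
  Lp (EuclideanSpace ℂ (Fin (n + 2)) →L[ℂ] EuclideanSpace ℂ (Fin (n + 2))) ∞
    (volume : Measure (EuclideanSpace ℝ (Fin n)))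

/-- The bounded operator of pointwise multiplication by `B` on `L²`. -/
def mulOp {n : ℕ} (B : LInf n) : L2 n →L[ℂ] L2 n :=
  (ContinuousLinearMap.id ℂ
    (EuclideanSpace ℂ (Fin (n + 2)) →L[ℂ] EuclideanSpace ℂ (Fin (n + 2)))).holderL
      (volume : Measure (EuclideanSpace ℝ (Fin n))) ∞ 2 2 B

/-- The unbounded operator `D B`. -/
def opDB {n : ℕ} (D : L2 n →ₗ.[ℂ] L2 n) (B : LInf n) : L2 n →ₗ.[ℂ] L2 n :=
  precomp D (mulOp B)

end AnalyticDependence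

end

noncomputable section

namespace AnalyticDependence

/-! ### Bisectors described by real and imaginary parts. -/

section Sectors

/-! Put `K = rangeClosure D`. Self-adjointness gives `N(D) = Kᗮ`, and by Lax–Milgram accretivity
makes the compression `P B|_K` invertible, so `A = (P B|_K)⁻¹ P` (`accInv`) is available. Since `B A
w - w ∈ N(D)` and `A B u = u` on `K`, one has `D B A = D` on the domain of `D`; hence `R(DB) =
R(D)`, and `A B` is the projection onto `K` along `N(DB)`. As `A` depends on `B` through an inverse
in a Banach algebra, it is holomorphic in `z`, and so are these projections.

Bisectoriality rests on `⟪B u, D B u⟫` being real: `Im ⟪B u, (DB - l) u⟫ = -Im (l ⟪B u, u⟫)` bounds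
`DB - l` from below on `K` when `l` lies off the sector, on `N(DB)` it is `-l`, and a dual argument
gives dense range.

The domain of `DB_z` varies with `z`, so resolvents are compared through the bounded operators: `R'
- R = (1 + l R') S` with `S = A' (B - B') R` (`resolvent_sub_eq`). Solving, `R' = (R + S)(1 - l
S)⁻¹`, which gives holomorphy; and as `‖l S‖` is small uniformly in `l`, resolvent bounds persist
locally uniformly in `z`. Dominated integration along the contour then handles every `ψ` in `Psi`.

For `f` in `HInfty` the definition of `f(T)` involves an unbounded inverse. Residues give `ψ₀(T) =
(R(i) + R(-i)) / 2` for the regulariser `ψ₀` (`psiCalculus_regulariser`), that is `T (1 + T²)⁻¹`. It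
follows that `f(T) E_b = (f ψ₀)(T) Q_b` with `E_b` the `approxId` and `Q_b` the `approxQuotient`
(`mul_approxId_eq`). The right side is holomorphic in `z`, the left side is locally bounded by the
assumed bound on `f(T_z)`, and `E_b → 1` strongly as `b → 0`. Cauchy's formula shows that such
strong limits are holomorphic in norm (`differentiableOn_of_tendsto_strong`). -/

theorem abs_arg_lt_iff {α : ℝ} (hα : 0 < α) (hα' : α < Real.pi / 2) (z : ℂ) :
    z ≠ 0 ∧ |z.arg| < α ↔ |z.im| < Real.tan α * z.re := by
  have hmem : α ∈ Ioo (-(Real.pi / 2)) (Real.pi / 2) := ⟨by linarith [Real.pi_pos], hα'⟩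
  have hmem' : -α ∈ Ioo (-(Real.pi / 2)) (Real.pi / 2) := ⟨by linarith, by linarith [Real.pi_pos]⟩
  have htan : 0 < Real.tan α := Real.tan_pos_of_pos_of_lt_pi_div_two hα hα'
  have key : 0 < z.re → (|z.arg| < α ↔ |z.im| < Real.tan α * z.re) := fun hre => by
    have harg := abs_lt.1 (Complex.abs_arg_lt_pi_div_two_iff.2 (Or.inl hre))
    rw [abs_lt, abs_lt, ← Real.strictMonoOn_tan.lt_iff_lt harg hmem,
      ← Real.strictMonoOn_tan.lt_iff_lt hmem' harg, Complex.tan_arg, Real.tan_neg, div_lt_iff₀ hre,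
      lt_div_iff₀ hre, neg_mul]
  constructor
  · rintro ⟨h0, h⟩
    have hre := (Complex.abs_arg_lt_pi_div_two_iff.1 (h.trans hα')).resolve_right h0
    exact (key hre).1 h
  · intro h
    have hre : 0 < z.re := pos_of_mul_pos_right ((abs_nonneg _).trans_lt h) htan.le
    exact ⟨fun h0 => by simp [h0] at hre, (key hre).2 h⟩

theorem abs_arg_le_iff {α : ℝ} (hα : 0 ≤ α) (hα' : α < Real.pi / 2) (z : ℂ) :
    |z.arg| ≤ α ↔ 0 ≤ z.re ∧ |z.im| ≤ Real.tan α * z.re := by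
  have hmem : α ∈ Ioo (-(Real.pi / 2)) (Real.pi / 2) := ⟨by linarith [Real.pi_pos], hα'⟩
  have hmem' : -α ∈ Ioo (-(Real.pi / 2)) (Real.pi / 2) := ⟨by linarith, by linarith [Real.pi_pos]⟩
  by_cases h0 : z = 0
  · simp [h0, hα]
  have key : 0 < z.re → (|z.arg| ≤ α ↔ |z.im| ≤ Real.tan α * z.re) := fun hre => by
    have harg := abs_lt.1 (Complex.abs_arg_lt_pi_div_two_iff.2 (Or.inl hre))
    rw [abs_le, abs_le, ← Real.strictMonoOn_tan.le_iff_le harg hmem,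
      ← Real.strictMonoOn_tan.le_iff_le hmem' harg, Complex.tan_arg, Real.tan_neg, div_le_iff₀ hre,
      le_div_iff₀ hre, neg_mul]
  constructor
  · intro h
    have hre := (Complex.abs_arg_lt_pi_div_two_iff.1 (h.trans_lt hα')).resolve_right h0
    exact ⟨hre.le, (key hre).1 h⟩
  · rintro ⟨h1, h2⟩
    rcases h1.lt_or_eq with hre | hre
    · exact (key hre).2 h2
    · rw [← hre, mul_zero] at h2
      exact absurd (Complex.ext hre.symm (by simpa using h2)) h0

/-- Both sectors merge into one inequality between `|im|` and `|re|`; from here on `arg` is hardly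
needed. -/
theorem mem_openBisector_iff {μ : ℝ} (hμ : 0 < μ) (hμ' : μ < Real.pi / 2) (z : ℂ) :
    z ∈ openBisector μ ↔ |z.im| < Real.tan μ * |z.re| := by
  have htan : 0 < Real.tan μ := Real.tan_pos_of_pos_of_lt_pi_div_two hμ hμ'
  simp only [openBisector, openSector, mem_union, mem_ofPred_eq, abs_arg_lt_iff hμ hμ',
    Complex.neg_im, Complex.neg_re, abs_neg]
  rcases le_total 0 z.re with h | h
  · rw [abs_of_nonneg h, or_iff_left_iff_imp]
    intro h'
    nlinarith [abs_nonneg z.im]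
  · rw [abs_of_nonpos h, or_iff_right_iff_imp]
    intro h'
    nlinarith [abs_nonneg z.im]

theorem mem_closedBisector_iff {ω : ℝ} (hω : 0 ≤ ω) (hω' : ω < Real.pi / 2) (z : ℂ) :
    z ∈ closedBisector ω ↔ |z.im| ≤ Real.tan ω * |z.re| := by
  have hz : ∀ z : ℂ, z ∈ closedSector ω ↔ 0 ≤ z.re ∧ |z.im| ≤ Real.tan ω * z.re := fun z => by
    rw [← abs_arg_le_iff hω hω', closedSector, mem_union, mem_ofPred_eq, mem_singleton_iff,
      or_iff_left_iff_imp]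
    rintro rfl
    simpa using hω
  simp only [closedBisector, mem_union, mem_ofPred_eq, hz, Complex.neg_im, Complex.neg_re, abs_neg]
  rcases le_total 0 z.re with h | h
  · rw [abs_of_nonneg h]
    refine ⟨?_, fun h' => Or.inl ⟨h, h'⟩⟩
    rintro (h' | h')
    · exact h'.2
    · have : z.re = 0 := by linarith [h'.1]
      simpa [this] using h'.2
  · rw [abs_of_nonpos h]
    refine ⟨?_, fun h' => Or.inr ⟨by linarith, h'⟩⟩
    rintro (h' | h')
    · have : z.re = 0 := by linarith [h'.1]
      simpa [this] using h'.2
    · exact h'.2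

theorem ne_zero_of_notMem_closedBisector {ω : ℝ} {z : ℂ} (h : z ∉ closedBisector ω) : z ≠ 0 := by
  rintro rfl
  exact h (Or.inl (Or.inr rfl))

theorem tan_mono {α β : ℝ} (hα : 0 ≤ α) (hαβ : α < β) (hβ : β < Real.pi / 2) :
    Real.tan α < Real.tan β :=
  Real.tan_lt_tan_of_nonneg_of_lt_pi_div_two hα hβ hαβ

theorem closedBisector_subset {α β : ℝ} (hα : 0 ≤ α) (hαβ : α < β) (hβ : β < Real.pi / 2) :
    closedBisector α ⊆ closedBisector β := fun z hz => by
  rw [mem_closedBisector_iff hα (hαβ.trans hβ)] at hz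
  rw [mem_closedBisector_iff (hα.trans hαβ.le) hβ]
  exact hz.trans (mul_le_mul_of_nonneg_right (tan_mono hα hαβ hβ).le (abs_nonneg _))

/-- `I + t T = t (T - l)` with `l = -t⁻¹`, and `z ↦ -z⁻¹` preserves the ratio of `|im|` to `|re|`.
-/
theorem neg_inv_notMem_closedBisector {ω μ : ℝ} (hω : 0 ≤ ω) (hωμ : ω < μ) (hμ : μ < Real.pi / 2)
    {t : ℂ} (ht : t ≠ 0) (htμ : t ∉ openBisector μ) : -t⁻¹ ∉ closedBisector ω := by
  have hμ0 := hω.trans_lt hωμ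
  rw [mem_openBisector_iff hμ0 hμ, not_lt] at htμ
  rw [mem_closedBisector_iff hω (hωμ.trans hμ), not_le, Complex.neg_re, Complex.neg_im,
    Complex.inv_re, Complex.inv_im, abs_neg, abs_neg, abs_div, abs_div, abs_neg,
    abs_of_nonneg (Complex.normSq_nonneg t), mul_div_assoc']
  have hn := Complex.normSq_pos.2 ht
  rw [div_lt_div_iff_of_pos_right hn]
  -- On the imaginary axis the strict inequality of tangents is lost on multiplying by `|re| = 0`;
  -- there `im ≠ 0` does the work.
  rcases eq_or_ne t.re 0 with h0 | h0
  · have : t.im ≠ 0 := fun h => ht (Complex.ext h0 h)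
    simpa [h0] using this
  · exact (mul_lt_mul_of_pos_right (tan_mono hω hωμ hμ) (abs_pos.2 h0)).trans_le htμ

theorem notMem_closedBisector_of_sin_cos {ω θ : ℝ} (hω : 0 ≤ ω) (hωθ : ω < θ)
    (hθ : θ < Real.pi / 2) {z : ℂ} (hz : z ≠ 0)
    (h : Real.sin θ * |z.re| ≤ Real.cos θ * |z.im|) : z ∉ closedBisector ω := by
  rw [mem_closedBisector_iff hω (hωθ.trans hθ), not_le]
  have hc : 0 < Real.cos θ := Real.cos_pos_of_mem_Ioo ⟨by linarith [Real.pi_pos], hθ⟩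
  have h' : Real.tan θ * |z.re| ≤ |z.im| := by
    rw [Real.tan_eq_sin_div_cos, div_mul_eq_mul_div, div_le_iff₀ hc]
    linarith
  rcases eq_or_ne z.re 0 with h0 | h0
  · have : z.im ≠ 0 := fun h => hz (Complex.ext h0 h)
    simpa [h0] using this
  · exact (mul_lt_mul_of_pos_right (tan_mono hω hωθ hθ) (abs_pos.2 h0)).trans_le h'

/-- The four rays which bound the bisector of half-angle `θ`. -/
def boundaryDirections (θ : ℝ) : Set ℂ := {e | |e.re| = Real.cos θ ∧ |e.im| = Real.sin θ}

theorem boundaryDirections_neg {θ : ℝ} {e : ℂ} (h : e ∈ boundaryDirections θ) :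
    -e ∈ boundaryDirections θ := by
  simpa [boundaryDirections] using h

theorem exp_mem_boundaryDirections {θ : ℝ} (h0 : 0 ≤ θ) (hθ : θ < Real.pi / 2) :
    Complex.exp (θ * Complex.I) ∈ boundaryDirections θ := by
  have hc : 0 ≤ Real.cos θ := (Real.cos_pos_of_mem_Ioo ⟨by linarith [Real.pi_pos], hθ⟩).le
  have hs : 0 ≤ Real.sin θ := Real.sin_nonneg_of_nonneg_of_le_pi h0 (by linarith [Real.pi_pos])
  simp [boundaryDirections, Complex.exp_ofReal_mul_I_re, Complex.exp_ofReal_mul_I_im,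
    abs_of_nonneg hc, abs_of_nonneg hs]

theorem exp_neg_mem_boundaryDirections {θ : ℝ} (h0 : 0 ≤ θ) (hθ : θ < Real.pi / 2) :
    Complex.exp (-(θ * Complex.I)) ∈ boundaryDirections θ := by
  have h := exp_mem_boundaryDirections h0 hθ
  have : Complex.exp (-(θ * Complex.I)) = (starRingEnd ℂ) (Complex.exp (θ * Complex.I)) := by
    rw [← Complex.exp_conj]; simp
  rw [this]
  simpa [boundaryDirections] using h

theorem norm_boundaryDirection {θ : ℝ} {e : ℂ} (h : e ∈ boundaryDirections θ) : ‖e‖ = 1 := by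
  have h2 : ‖e‖ ^ 2 = 1 := by
    rw [Complex.sq_norm, Complex.normSq_apply, ← abs_mul_abs_self e.re, ← abs_mul_abs_self e.im,
      h.1, h.2]
    nlinarith [Real.sin_sq_add_cos_sq θ]
  nlinarith [norm_nonneg e]

theorem ray_notMem_closedBisector {ω θ : ℝ} (hω : 0 ≤ ω) (hωθ : ω < θ) (hθ : θ < Real.pi / 2)
    {e : ℂ} (h : e ∈ boundaryDirections θ) {r : ℝ} (hr : 0 < r) :
    (r * e : ℂ) ∉ closedBisector ω := by
  refine notMem_closedBisector_of_sin_cos hω hωθ hθ (mul_ne_zero (by exact_mod_cast hr.ne') ?_) ?_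
  · rw [← norm_ne_zero_iff, norm_boundaryDirection h]; exact one_ne_zero
  · rw [Complex.re_ofReal_mul, Complex.im_ofReal_mul, abs_mul, abs_mul, h.1, h.2]
    exact (by ring : _ = _).le

theorem ray_mem_openBisector {θ μ : ℝ} (h0 : 0 < θ) (hθμ : θ < μ) (hμ : μ < Real.pi / 2)
    {e : ℂ} (h : e ∈ boundaryDirections θ) {r : ℝ} (hr : 0 < r) :
    (r * e : ℂ) ∈ openBisector μ := by
  have hc : 0 < Real.cos θ := Real.cos_pos_of_mem_Ioo ⟨by linarith [Real.pi_pos], hθμ.trans hμ⟩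
  rw [mem_openBisector_iff (h0.trans hθμ) hμ, Complex.re_ofReal_mul, Complex.im_ofReal_mul, abs_mul,
    abs_mul, h.1, h.2, abs_of_pos hr]
  have := tan_mono h0.le hθμ hμ
  rw [Real.tan_eq_sin_div_cos, div_lt_iff₀ hc] at this
  nlinarith

end Sectors

/-! ### Resolvents in terms of graphs. -/

section Resolvents

variable {X : Type*} [NormedAddCommGroup X] [NormedSpace ℂ X]

theorem mem_graph_of_mem {T : X →ₗ.[ℂ] X} {u : X} (h : u ∈ T.domain) : (u, T ⟨u, h⟩) ∈ T.graph :=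
  T.mem_graph ⟨u, h⟩

theorem mem_affine_graph_iff {a t : ℂ} (T : X →ₗ.[ℂ] X) {u v : X} :
    (u, v) ∈ (affine a t T).graph ↔ ∃ w, (u, w) ∈ T.graph ∧ v = a • u + t • w := by
  constructor
  · intro h
    obtain ⟨y, rfl, h2⟩ := (LinearPMap.mem_graph_iff _).1 h
    exact ⟨T y, T.mem_graph y, h2.symm⟩
  · rintro ⟨w, hw, rfl⟩
    obtain ⟨y, h1, h2⟩ := (LinearPMap.mem_graph_iff _).1 hw
    simp only at h1 h2
    subst h1 h2
    exact (affine a t T).mem_graph y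

/-- With graphs, the algebra of unbounded operators becomes linear algebra of pairs, free of domain
membership proofs. -/
theorem hasBoundedInverse_iff {S : X →ₗ.[ℂ] X} {R : X →L[ℂ] X} :
    HasBoundedInverse S R ↔ (∀ u, (R u, u) ∈ S.graph) ∧ ∀ v w, (v, w) ∈ S.graph → R w = v := by
  constructor
  · rintro ⟨h1, h2⟩
    refine ⟨fun u => ?_, fun v w h => ?_⟩
    · obtain ⟨h, h'⟩ := h1 u
      exact (LinearPMap.mem_graph_iff _).2 ⟨⟨R u, h⟩, rfl, h'⟩
    · obtain ⟨y, hy, hy'⟩ := (LinearPMap.mem_graph_iff _).1 h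
      simp only at hy hy'
      rw [← hy, ← hy', h2]
  · rintro ⟨h1, h2⟩
    refine ⟨fun u => ?_, fun v => h2 _ _ (S.mem_graph v)⟩
    obtain ⟨y, hy, hy'⟩ := (LinearPMap.mem_graph_iff _).1 (h1 u)
    simp only at hy hy'
    exact ⟨hy ▸ y.2, (congrArg S (Subtype.ext hy.symm)).trans hy'⟩

theorem HasBoundedInverse.unique {S : X →ₗ.[ℂ] X} {R R' : X →L[ℂ] X} (h : HasBoundedInverse S R)
    (h' : HasBoundedInverse S R') : R = R' := by
  rw [hasBoundedInverse_iff] at h h'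
  ext u
  exact (h'.2 _ _ (h.1 u)).symm

theorem HasBoundedInverse.boundedInverse_eq {S : X →ₗ.[ℂ] X} {R : X →L[ℂ] X}
    (h : HasBoundedInverse S R) : boundedInverse S = R := by
  have hex : ∃ R, HasBoundedInverse S R := ⟨R, h⟩
  rw [boundedInverse, dif_pos hex]
  exact hex.choose_spec.unique h

/-- `R` is the resolvent of `T` at `l`, in terms of the graph of `T`. -/
structure IsResolventAt (T : X →ₗ.[ℂ] X) (l : ℂ) (R : X →L[ℂ] X) : Prop where
  mem_graph : ∀ u, (R u, u + l • R u) ∈ T.graph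
  apply_graph : ∀ v w, (v, w) ∈ T.graph → R w = v + l • R v

theorem hasBoundedInverse_affine_iff {T : X →ₗ.[ℂ] X} {l : ℂ} {R : X →L[ℂ] X} :
    HasBoundedInverse (affine (-l) 1 T) R ↔ IsResolventAt T l R := by
  simp only [hasBoundedInverse_iff, mem_affine_graph_iff, one_smul]
  constructor
  · rintro ⟨h1, h2⟩
    refine ⟨fun u => ?_, fun v w h => ?_⟩
    · obtain ⟨w, hw, hu⟩ := h1 u
      have : u + l • R u = w := by rw [neg_smul] at hu; linear_combination (norm := module) hu
      rwa [this]
    · have := h2 v _ ⟨w, h, rfl⟩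
      rw [map_add, map_smul, neg_smul] at this
      linear_combination (norm := module) this
  · rintro ⟨h1, h2⟩
    refine ⟨fun u => ⟨_, h1 u, by module⟩, ?_⟩
    rintro v _ ⟨w, h, rfl⟩
    rw [map_add, map_smul, h2 v w h]
    module

theorem IsResolventAt.resolventAt_eq {T : X →ₗ.[ℂ] X} {l : ℂ} {R : X →L[ℂ] X}
    (h : IsResolventAt T l R) : resolventAt T l = R :=
  (hasBoundedInverse_affine_iff.2 h).boundedInverse_eq

theorem isResolventAt_of_notMem_spectrumOf {T : X →ₗ.[ℂ] X} {l : ℂ} (h : l ∉ spectrumOf T) :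
    IsResolventAt T l (resolventAt T l) := by
  have h : ∃ R, HasBoundedInverse (affine (-l) 1 T) R := by simpa [spectrumOf] using h
  obtain ⟨R, hR⟩ := h
  rw [hasBoundedInverse_affine_iff] at hR
  rwa [hR.resolventAt_eq]

theorem IsBisectorial.isResolventAt {T : X →ₗ.[ℂ] X} {ω : ℝ} (hT : IsBisectorial T ω) {l : ℂ}
    (h : l ∉ closedBisector ω) : IsResolventAt T l (resolventAt T l) :=
  isResolventAt_of_notMem_spectrumOf fun h' => h (hT.2.1 h')

/-- The resolvent identity: `R` is applied to the graph point `(S u, u + m S u)`. -/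
theorem IsResolventAt.sub_apply {T : X →ₗ.[ℂ] X} {l m : ℂ} {R S : X →L[ℂ] X}
    (hR : IsResolventAt T l R) (hS : IsResolventAt T m S) (u : X) :
    R u - S u = (l - m) • R (S u) := by
  have := hR.apply_graph _ _ (hS.mem_graph u)
  rw [map_add, map_smul] at this
  linear_combination (norm := module) this

theorem IsResolventAt.sub_eq {T : X →ₗ.[ℂ] X} {l m : ℂ} {R S : X →L[ℂ] X}
    (hR : IsResolventAt T l R) (hS : IsResolventAt T m S) : R - S = (l - m) • (R * S) := by
  ext u
  exact hR.sub_apply hS u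

theorem IsResolventAt.commute {T : X →ₗ.[ℂ] X} {l m : ℂ} {R S : X →L[ℂ] X}
    (hR : IsResolventAt T l R) (hS : IsResolventAt T m S) : Commute R S := by
  rcases eq_or_ne l m with rfl | h
  · rw [← hR.resolventAt_eq, ← hS.resolventAt_eq]
  · have h1 := hR.sub_eq hS
    have h2 := hS.sub_eq hR
    have h3 : (l - m) • (R * S) = (l - m) • (S * R) := by
      rw [← h1, ← neg_sub S R, h2, ← neg_smul, neg_sub]
    exact smul_right_injective _ (sub_ne_zero.2 h) h3

theorem hasBoundedInverse_affine_one {T : X →ₗ.[ℂ] X} {t : ℂ} (ht : t ≠ 0) {R : X →L[ℂ] X}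
    (hR : IsResolventAt T (-t⁻¹) R) : HasBoundedInverse (affine 1 t T) (t⁻¹ • R) := by
  simp only [hasBoundedInverse_iff, mem_affine_graph_iff, one_smul]
  refine ⟨fun u => ?_, ?_⟩
  · refine ⟨t⁻¹ • (u + -t⁻¹ • R u), T.graph.smul_mem t⁻¹ (hR.mem_graph u), ?_⟩
    rw [smul_smul, mul_inv_cancel₀ ht, smul_apply]
    module
  · rintro v _ ⟨w, h, rfl⟩
    rw [smul_apply, map_add, map_smul, hR.apply_graph v w h, inv_smul_eq_iff₀ ht, smul_add,
      smul_smul t, mul_neg, mul_inv_cancel₀ ht]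
    module

theorem resolventFamily_eq {T : X →ₗ.[ℂ] X} {t : ℂ} (ht : t ≠ 0)
    (h : IsResolventAt T (-t⁻¹) (resolventAt T (-t⁻¹))) :
    resolventFamily T t = t⁻¹ • resolventAt T (-t⁻¹) := by
  rw [resolventFamily, if_neg ht]
  exact (hasBoundedInverse_affine_one ht h).boundedInverse_eq

theorem mem_precomp_graph_iff {T : X →ₗ.[ℂ] X} {B : X →L[ℂ] X} {u v : X} :
    (u, v) ∈ (precomp T B).graph ↔ (B u, v) ∈ T.graph := by
  constructor
  · intro h
    obtain ⟨y, rfl, h2⟩ := (LinearPMap.mem_graph_iff _).1 h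
    exact (LinearPMap.mem_graph_iff _).2 ⟨⟨B y, y.2⟩, rfl, h2⟩
  · intro h
    obtain ⟨y, hy, hy'⟩ := (LinearPMap.mem_graph_iff _).1 h
    simp only at hy hy'
    have hu : u ∈ (precomp T B).domain := (hy ▸ y.2 : B u ∈ T.domain)
    refine (LinearPMap.mem_graph_iff _).2 ⟨⟨u, hu⟩, rfl, ?_⟩
    rw [← hy']
    exact congrArg T (Subtype.ext hy.symm)

theorem isClosed_precomp {T : X →ₗ.[ℂ] X} (hT : T.IsClosed) (B : X →L[ℂ] X) :
    (precomp T B).IsClosed := by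
  have : ((precomp T B).graph : Set (X × X)) = (fun p : X × X => (B p.1, p.2)) ⁻¹' T.graph := by
    ext ⟨u, v⟩
    exact mem_precomp_graph_iff
  rw [LinearPMap.IsClosed, this]
  exact IsClosed.preimage (by fun_prop) hT

theorem mem_part_graph_iff {T : X →ₗ.[ℂ] X} {K : Submodule ℂ X} {u v : K} :
    (u, v) ∈ (part T K).graph ↔ ((u : X), (v : X)) ∈ T.graph := by
  constructor
  · intro h
    obtain ⟨y, rfl, rfl⟩ := (LinearPMap.mem_graph_iff _).1 h
    exact T.mem_graph ⟨((y : K) : X), y.2.choose⟩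
  · intro h
    obtain ⟨y, hy, hy'⟩ := (LinearPMap.mem_graph_iff _).1 h
    simp only at hy hy'
    have hu : (u : X) ∈ T.domain := hy ▸ y.2
    have hu' : T ⟨u, hu⟩ = v := by
      rw [← hy']
      exact congrArg T (Subtype.ext hy.symm)
    have hd : u ∈ (part T K).domain := ⟨hu, hu' ▸ v.2⟩
    exact (LinearPMap.mem_graph_iff _).2 ⟨⟨u, hd⟩, rfl, Subtype.ext hu'⟩

theorem mem_nullSpace_iff {T : X →ₗ.[ℂ] X} {u : X} : u ∈ nullSpace T ↔ (u, 0) ∈ T.graph := by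
  simp only [nullSpace, Submodule.mem_map, LinearMap.mem_ker, LinearPMap.mem_graph_iff]
  constructor
  · rintro ⟨y, h1, h2⟩; exact ⟨y, h2, h1⟩
  · rintro ⟨y, h1, h2⟩; exact ⟨y, h2, h1⟩

theorem mem_range_iff {T : X →ₗ.[ℂ] X} {v : X} :
    v ∈ LinearMap.range T.toFun ↔ ∃ u, (u, v) ∈ T.graph := by
  constructor
  · rintro ⟨y, rfl⟩
    exact ⟨y, T.mem_graph y⟩
  · rintro ⟨u, h⟩
    obtain ⟨y, -, h2⟩ := (LinearPMap.mem_graph_iff _).1 h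
    exact ⟨y, h2⟩

theorem mem_rangeClosure_of_mem_graph {T : X →ₗ.[ℂ] X} {u v : X} (h : (u, v) ∈ T.graph) :
    v ∈ rangeClosure T :=
  Submodule.le_topologicalClosure _ (mem_range_iff.2 ⟨u, h⟩)

end Resolvents

/-! ### Compression to a subspace. -/

section Compression

variable {X : Type*} [NormedAddCommGroup X] [InnerProductSpace ℂ X]

/-- The compression of a bounded operator to a subspace, as a bounded linear map. -/
def compression (K : Submodule ℂ X) [K.HasOrthogonalProjection] :
    (X →L[ℂ] X) →L[ℂ] (K →L[ℂ] K) :=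
  (ContinuousLinearMap.compL ℂ K X K K.orthogonalProjectionOnto).comp
    ((ContinuousLinearMap.compL ℂ K X X).flip K.subtypeL)

@[simp]
theorem compression_apply (K : Submodule ℂ X) [K.HasOrthogonalProjection] (A : X →L[ℂ] X) (u : K) :
    compression K A u = K.orthogonalProjectionOnto (A u) := rfl

/-- For `u ∈ K` the vector `u + l R u` lies in the range of `T`, hence in `K`; as `l ≠ 0`, so does
`R u`. Thus `R` leaves `K` invariant and the compression is its restriction. Being linear and
bounded in `R`, compression transports holomorphy and integrals to the part of `T` in `K`. -/
theorem IsResolventAt.compression {K : Submodule ℂ X} [K.HasOrthogonalProjection]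
    {T : X →ₗ.[ℂ] X} (hT : ∀ u v, (u, v) ∈ T.graph → v ∈ K) {l : ℂ} (hl : l ≠ 0) {R : X →L[ℂ] X}
    (hR : IsResolventAt T l R) : IsResolventAt (part T K) l (compression K R) := by
  have hK : ∀ u : K, R u ∈ K := fun u => by
    have h := hT _ _ (hR.mem_graph u)
    have h' := K.smul_mem l⁻¹ (K.sub_mem h u.2)
    rwa [add_sub_cancel_left, smul_smul, inv_mul_cancel₀ hl, one_smul] at h'
  have hc : ∀ u : K, ((AnalyticDependence.compression K R u : K) : X) = R u := fun u => by
    rw [compression_apply]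
    exact K.starProjection_eq_self_iff.2 (hK u)
  refine ⟨fun u => ?_, fun v w h => ?_⟩
  · rw [mem_part_graph_iff]
    simpa only [Submodule.coe_add, Submodule.coe_smul, hc] using hR.mem_graph u
  · apply Subtype.ext
    simpa only [Submodule.coe_add, Submodule.coe_smul, hc] using hR.apply_graph _ _ (mem_part_graph_iff.1 h)

end Compression

/-! ### Holomorphic families: integrals and strong limits. -/

section HolomorphicFamilies

open Filter Topology Metric

variable {E : Type*} [NormedAddCommGroup E] [NormedSpace ℂ E]

theorem norm_deriv_le_of_norm_le_ball {f : ℂ → E} {c : ℂ} {R M : ℝ} (hR : 0 < R)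
    (hf : DifferentiableOn ℂ f (ball c R)) (hM : ∀ z ∈ ball c R, ‖f z‖ ≤ M) {w : ℂ}
    (hw : w ∈ ball c (R / 2)) : ‖deriv f w‖ ≤ M / (R / 2) := by
  have hsub : closedBall w (R / 2) ⊆ ball c R := fun z hz => by
    rw [mem_ball] at hw ⊢
    rw [mem_closedBall] at hz
    linarith [dist_triangle z w c]
  refine Complex.norm_deriv_le_of_forall_mem_sphere_norm_le (half_pos hR) ?_ fun z hz =>
    hM z (hsub (sphere_subset_closedBall hz))
  exact (hf.mono (closure_ball_subset_closedBall.trans hsub)).diffContOnCl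

theorem norm_sub_le_of_norm_le_ball {f : ℂ → E} {c : ℂ} {R M : ℝ} (hR : 0 < R)
    (hf : DifferentiableOn ℂ f (ball c R)) (hM : ∀ z ∈ ball c R, ‖f z‖ ≤ M) {w w' : ℂ}
    (hw : w ∈ ball c (R / 2)) (hw' : w' ∈ ball c (R / 2)) :
    ‖f w' - f w‖ ≤ M / (R / 2) * ‖w' - w‖ :=
  (convex_ball c (R / 2)).norm_image_sub_le_of_norm_deriv_le
    (fun z hz => (hf.differentiableAt (isOpen_ball.mem_nhds (ball_subset_ball (by linarith) hz))))
    (fun _ hz => norm_deriv_le_of_norm_le_ball hR hf hM hz) hw hw'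

/-- No bound on the derivative is assumed: Cauchy's estimate on the ball of half the radius turns a
majorant of `F` into one of the derivative. -/
theorem integrable_and_differentiableOn_integral [CompleteSpace E] {α : Type*} [MeasurableSpace α]
    {m : Measure α} {U : Set ℂ} {F : ℂ → α → E}
    (hmeas : ∀ z ∈ U, AEStronglyMeasurable (F z) m)
    (hdiff : ∀ᵐ a ∂m, DifferentiableOn ℂ (fun z => F z a) U)
    (hbound : ∀ c ∈ U, ∃ R > 0, ball c R ⊆ U ∧ ∃ g : α → ℝ, Integrable g m ∧
      ∀ᵐ a ∂m, ∀ z ∈ ball c R, ‖F z a‖ ≤ g a) :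
    (∀ z ∈ U, Integrable (F z) m) ∧ DifferentiableOn ℂ (fun z => ∫ a, F z a ∂m) U := by
  have hint : ∀ z ∈ U, Integrable (F z) m := fun z hz => by
    obtain ⟨R, hR, -, g, hg, hb⟩ := hbound z hz
    exact hg.mono' (hmeas z hz) (hb.mono fun a ha => ha z (mem_ball_self hR))
  refine ⟨hint, fun c hc => ?_⟩
  obtain ⟨R, hR, hRU, g, hg, hb⟩ := hbound c hc
  have hUn : U ∈ 𝓝 c := mem_of_superset (ball_mem_nhds c hR) hRU
  have hda : ∀ᵐ a ∂m, ∀ z ∈ ball c R, HasDerivAt (fun z => F z a) (deriv (fun z => F z a) z) z :=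
    hdiff.mono fun a ha z hz =>
      (ha.differentiableAt (mem_of_superset (isOpen_ball.mem_nhds hz) hRU)).hasDerivAt
  refine (hasDerivAt_integral_of_dominated_loc_of_deriv_le (ball_mem_nhds c (half_pos hR))
    (F' := fun z a => deriv (fun z => F z a) z) (bound := fun a => g a / (R / 2))
    (mem_of_superset hUn hmeas) (hint c hc) ?_ ?_ (hg.div_const _) ?_).2.differentiableAt
    |>.differentiableWithinAt
  -- The derivative is measurable as an almost everywhere limit of difference quotients; the
  -- increments `(R / 2) / (n + 1)` stay inside the ball.
  · have hx : Tendsto (fun n : ℕ => (((R / 2) * ((n : ℝ) + 1)⁻¹ : ℝ) : ℂ)) atTop (𝓝[≠] 0) := by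
      refine tendsto_nhdsWithin_iff.2 ⟨?_, Eventually.of_forall fun n => ?_⟩
      · have h1 := (tendsto_one_div_add_atTop_nhds_zero_nat (𝕜 := ℝ)).const_mul (R / 2)
        rw [mul_zero] at h1
        simpa [Function.comp_def] using (Complex.continuous_ofReal.tendsto 0).comp h1
      · have : (R / 2) * ((n : ℝ) + 1)⁻¹ ≠ 0 := by positivity
        exact Complex.ofReal_ne_zero.2 this
    refine aestronglyMeasurable_of_tendsto_ae atTop
      (f := fun (n : ℕ) a => (((R / 2) * ((n : ℝ) + 1)⁻¹ : ℝ) : ℂ)⁻¹ •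
        (F (c + (((R / 2) * ((n : ℝ) + 1)⁻¹ : ℝ) : ℂ)) a - F c a)) (fun n => ?_) ?_
    · refine AEStronglyMeasurable.const_smul ((hmeas _ (hRU ?_)).sub (hmeas c hc)) _
      rw [mem_ball, dist_self_add_left, Complex.norm_real, Real.norm_of_nonneg (by positivity)]
      have h1 : ((n : ℝ) + 1)⁻¹ ≤ 1 := inv_le_one_of_one_le₀ (by linarith [n.cast_nonneg (α := ℝ)])
      nlinarith
    · filter_upwards [hda] with a ha
      exact (ha c (mem_ball_self hR)).tendsto_slope_zero.comp hx
  · filter_upwards [hdiff, hb] with a h1 h2 z hz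
    exact norm_deriv_le_of_norm_le_ball hR (h1.mono hRU) h2 hz
  · filter_upwards [hda] with a ha z hz
    exact ha z (ball_subset_ball (by linarith) hz)

theorem cauchyIntegral_apply {F : ℂ → E →L[ℂ] E} [CompleteSpace E] {c w : ℂ} {R : ℝ}
    (hF : CircleIntegrable (fun ζ => (ζ - w)⁻¹ • F ζ) c R) (u : E) :
    (∮ ζ in C(c, R), (ζ - w)⁻¹ • F ζ) u = ∮ ζ in C(c, R), (ζ - w)⁻¹ • F ζ u := by
  have := ((ContinuousLinearMap.apply ℂ E u)).intervalIntegral_comp_comm hF.out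
  exact this.symm

/-- A pointwise strong limit of locally bounded holomorphic operator-valued functions is holomorphic
in operator norm. -/
theorem differentiableOn_of_tendsto_strong [CompleteSpace E] {U : Set ℂ} (hU : IsOpen U)
    {F : ℂ → E →L[ℂ] E} {Fk : ℕ → ℂ → E →L[ℂ] E} (hd : ∀ k, DifferentiableOn ℂ (Fk k) U)
    (hb : ∀ c ∈ U, ∃ M : ℝ, ∀ᶠ z in 𝓝 c, ∀ k, ‖Fk k z‖ ≤ M)
    (hlim : ∀ z ∈ U, ∀ u, Tendsto (fun k => Fk k z u) atTop (𝓝 (F z u))) :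
    DifferentiableOn ℂ F U := by
  intro c hc
  obtain ⟨M, hM⟩ := hb c hc
  obtain ⟨R, hR, hRs⟩ := Metric.mem_nhds_iff.1 (inter_mem (hU.mem_nhds hc) hM)
  have hRU : ball c R ⊆ U := hRs.trans inter_subset_left
  have hRM : ∀ k, ∀ z ∈ ball c R, ‖Fk k z‖ ≤ M := fun k z hz => (hRs hz).2 k
  have hM0 : 0 ≤ M := (norm_nonneg _).trans (hRM 0 c (mem_ball_self hR))
  -- The Lipschitz constant given by Cauchy's estimate is the same for all `k`, so it survives the
  -- strong limit and makes `F` continuous in norm.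
  have hcont : ContinuousOn F (ball c (R / 2)) := by
    refine (LipschitzOnWith.of_dist_le_mul (K := Real.toNNReal (M / (R / 2)))
      fun w hw w' hw' => ?_).continuousOn
    rw [Real.coe_toNNReal _ (by positivity), dist_eq_norm, dist_eq_norm]
    refine ContinuousLinearMap.opNorm_le_bound _ (by positivity) fun u => ?_
    have hwU := hRU (ball_subset_ball (by linarith) hw)
    have hwU' := hRU (ball_subset_ball (by linarith) hw')
    refine le_of_tendsto ((hlim w hwU u).sub (hlim w' hwU' u)).norm (Eventually.of_forall fun k => ?_)
    rw [← sub_apply]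
    exact (ContinuousLinearMap.le_opNorm _ _).trans (mul_le_mul_of_nonneg_right
      (norm_sub_le_of_norm_le_ball hR ((hd k).mono hRU) (hRM k) hw' hw) (norm_nonneg u))
  have hr : 0 < R / 4 := by positivity
  have hsph : sphere c (R / 4) ⊆ ball c (R / 2) :=
    sphere_subset_closedBall.trans (closedBall_subset_ball (by linarith))
  have hFc : ContinuousOn F (sphere c (R / 4)) := hcont.mono hsph
  have hker : ∀ w ∈ ball c (R / 4), ContinuousOn (fun ζ => (ζ - w)⁻¹) (sphere c (R / 4)) :=
    fun w hw => ContinuousOn.inv₀ (by fun_prop) fun ζ hζ h0 => by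
      rw [sub_eq_zero.1 h0] at hζ
      exact (mem_ball.1 hw).ne (mem_sphere.1 hζ)
  -- Norm continuity makes the operator-valued Cauchy integral exist; the formula itself is checked
  -- on each vector, by dominated convergence.
  have hformula : ∀ w ∈ ball c (R / 4),
      F w = (2 * Real.pi * Complex.I : ℂ)⁻¹ • ∮ ζ in C(c, R / 4), (ζ - w)⁻¹ • F ζ := by
    intro w hw
    ext u
    rw [smul_apply, cauchyIntegral_apply (((hker w hw).smul hFc).circleIntegrable hr.le)]
    refine tendsto_nhds_unique (hlim w (hRU (ball_subset_ball (by linarith) hw)) u) ?_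
    have hk : ∀ k, Fk k w u =
        (2 * Real.pi * Complex.I : ℂ)⁻¹ • ∮ ζ in C(c, R / 4), (ζ - w)⁻¹ • Fk k ζ u := fun k => by
      have hdk : DifferentiableOn ℂ (fun ζ => Fk k ζ u) (closedBall c (R / 4)) :=
        fun ζ hζ => ((((hd k) ζ (hRU (closedBall_subset_ball (by linarith) hζ))).mono
          ((closedBall_subset_ball (by linarith)).trans hRU)).clm_apply
            (differentiableWithinAt_const u))
      have := (hdk.mono closure_ball_subset_closedBall).diffContOnCl
        |>.two_pi_i_inv_smul_circleIntegral_sub_inv_smul hw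
      exact this.symm
    simp_rw [hk]
    refine Tendsto.const_smul ?_ _
    simp only [circleIntegral]
    set d := R / 4 - dist w c
    have hd0 : 0 < d := sub_pos.2 hw
    refine intervalIntegral.tendsto_integral_filter_of_dominated_convergence
      (fun _ => R / 4 * (d⁻¹ * (M * ‖u‖))) (Eventually.of_forall fun k => ?_)
      (Eventually.of_forall fun k => Eventually.of_forall fun t _ => ?_) (by simp)
      (Eventually.of_forall fun t _ => ?_)
    · have hck : ContinuousOn (fun ζ => (ζ - w)⁻¹ • Fk k ζ u) (sphere c (R / 4)) :=
        (hker w hw).smul ((((hd k).continuousOn.mono hRU).mono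
          (hsph.trans (ball_subset_ball (by linarith)))).clm_apply continuousOn_const)
      exact (hck.circleIntegrable hr.le).out.def'.aestronglyMeasurable
    · have hmem := circleMap_mem_sphere c hr.le t
      have hdist : d ≤ ‖circleMap c (R / 4) t - w‖ := by
        rw [← dist_eq_norm]
        have := dist_triangle_left (circleMap c (R / 4) t) c w
        rw [mem_sphere] at hmem
        have h3 := dist_triangle (circleMap c (R / 4) t) w c
        simp only [d]
        linarith
      rw [norm_smul, norm_smul, norm_inv, deriv_circleMap, norm_mul, Complex.norm_I, mul_one,
        norm_circleMap_zero, abs_of_pos hr]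
      gcongr
      refine (ContinuousLinearMap.le_opNorm _ _).trans ?_
      gcongr
      exact hRM k _ (ball_subset_ball (by linarith) (hsph hmem))
    · exact ((hlim _ (hRU (ball_subset_ball (by linarith)
        (hsph (circleMap_mem_sphere c hr.le t)))) u).const_smul _).const_smul _
  have hps := hasFPowerSeriesOn_cauchy_integral (f := F) (c := c) (R := ⟨R / 4, hr.le⟩)
    (hFc.circleIntegrable hr.le) hr
  have han := hps.analyticAt.differentiableAt
  refine (han.congr_of_eventuallyEq ?_).differentiableWithinAt
  filter_upwards [ball_mem_nhds c hr] with w hw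
  exact hformula w hw

end HolomorphicFamilies

/-! ### Rotation of rays in contour integrals. -/

section RayRotation

open Filter Topology

variable {E : Type*} [NormedAddCommGroup E] [NormedSpace ℂ E]

/-- Cauchy's theorem on the rectangle between `-R + i a` and `R + i b`, whose vertical sides
contribute `O((1 + R²)⁻¹)`. -/
theorem integral_horizontal_eq [CompleteSpace E] {h : ℂ → E} {a b C : ℝ} (hab : a ≤ b)
    (hd : ∀ w : ℂ, w.im ∈ Icc a b → DifferentiableAt ℂ h w)
    (hb : ∀ w : ℂ, w.im ∈ Icc a b → ‖h w‖ ≤ C * (1 + w.re ^ 2)⁻¹) :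
    ∫ x : ℝ, h (x + a * Complex.I) = ∫ x : ℝ, h (x + b * Complex.I) := by
  have hC : 0 ≤ C := by
    have := (norm_nonneg _).trans (hb (a * Complex.I) (by simp [hab]))
    simpa using this
  have hint : ∀ y ∈ Icc a b, Integrable (fun x : ℝ => h (x + y * Complex.I)) := fun y hy => by
    refine (integrable_inv_one_add_sq.const_mul C).mono' ?_ (Eventually.of_forall fun x => ?_)
    · refine (continuous_iff_continuousAt.2 fun x => ?_).aestronglyMeasurable
      exact ContinuousAt.comp (f := fun x : ℝ => (x + y * Complex.I : ℂ))
        (hd (x + y * Complex.I) (by simpa using hy)).continuousAt (by fun_prop)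
    · simpa using hb (x + y * Complex.I) (by simpa using hy)
  have hrect : ∀ R : ℝ, (∫ x : ℝ in -R..R, h (x + a * Complex.I)) -
      (∫ x : ℝ in -R..R, h (x + b * Complex.I)) +
      Complex.I • (∫ y : ℝ in a..b, h (R + y * Complex.I)) -
      Complex.I • (∫ y : ℝ in a..b, h ((-R : ℝ) + y * Complex.I)) = 0 := fun R => by
    have := Complex.integral_boundary_rect_eq_zero_of_differentiableOn h ⟨-R, a⟩ ⟨R, b⟩
      fun w hw => (hd w (by
        have := (Complex.mem_reProdIm.1 hw).2
        rwa [uIcc_of_le hab] at this)).differentiableWithinAt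
    exact this
  -- Both vertical sides at once: `f` will be `id` and `Neg.neg`.
  have hvert : ∀ f : ℝ → ℝ, (∀ R, f R ^ 2 = R ^ 2) →
      Tendsto (fun R : ℝ => ∫ y : ℝ in a..b, h (f R + y * Complex.I)) atTop (𝓝 0) := fun f hf => by
    refine squeeze_zero_norm (a := fun R => C * (1 + R ^ 2)⁻¹ * |b - a|) (fun R => ?_) ?_
    · refine intervalIntegral.norm_integral_le_of_norm_le_const fun y hy => ?_
      have hy' : y ∈ Icc a b := by
        rw [uIoc_of_le hab] at hy
        exact ⟨hy.1.le, hy.2⟩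
      simpa [hf] using hb (f R + y * Complex.I) (by simpa using hy')
    · have h1 : Tendsto (fun R : ℝ => (1 + R ^ 2)⁻¹) atTop (𝓝 0) :=
        tendsto_inv_atTop_zero.comp
          (tendsto_atTop_add_const_left _ _ (tendsto_pow_atTop two_ne_zero))
      simpa using (h1.const_mul C).mul_const |b - a|
  have h1 := (((intervalIntegral_tendsto_integral (hint a ⟨le_rfl, hab⟩) tendsto_neg_atTop_atBot
    tendsto_id).sub (intervalIntegral_tendsto_integral (hint b ⟨hab, le_rfl⟩)
      tendsto_neg_atTop_atBot tendsto_id)).add ((hvert id fun _ => rfl).const_smul Complex.I)).sub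
      ((hvert Neg.neg fun R => neg_sq R).const_smul Complex.I)
  have h2 := tendsto_nhds_unique (h1.congr fun R => hrect R) tendsto_const_nhds
  simpa [sub_eq_zero] using h2

theorem integral_Ioi_eq_integral_exp (g : ℝ → E) :
    ∫ r in Ioi (0 : ℝ), g r = ∫ x : ℝ, Real.exp x • g (Real.exp x) := by
  have := integral_image_eq_integral_abs_deriv_smul MeasurableSet.univ
    (fun x _ => (Real.hasDerivAt_exp x).hasDerivWithinAt) Real.exp_injective.injOn g
  rw [image_univ, Real.range_exp, setIntegral_univ] at this
  simpa using this

/-- In the coordinate `r = exp x`, quadratic decay of the integrand together with the factor from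
`dr` is dominated as `integral_horizontal_eq` requires. -/
theorem exp_mul_inv_one_add_exp_sq_le (x : ℝ) :
    Real.exp x * (1 + Real.exp x ^ 2)⁻¹ ≤ 2 * (1 + x ^ 2)⁻¹ := by
  have h1 : 1 + x ^ 2 ≤ 2 * (Real.exp x + Real.exp (-x)) := by
    have h := Real.quadratic_le_exp_of_nonneg (abs_nonneg x)
    rw [sq_abs] at h
    have h' : Real.exp |x| ≤ Real.exp x + Real.exp (-x) := by
      rcases abs_cases x with ⟨h, -⟩ | ⟨h, -⟩ <;> rw [h] <;> linarith [Real.exp_pos x, Real.exp_pos (-x)]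
    linarith [abs_nonneg x]
  have h2 : Real.exp x * Real.exp (-x) = 1 := by rw [← Real.exp_add]; simp
  rw [← div_eq_mul_inv, ← div_eq_mul_inv, div_le_div_iff₀ (by positivity) (by positivity)]
  nlinarith [Real.exp_pos x]

/-- The integrals along two rays agree if the integrand is holomorphic between them and decays
quadratically. -/
theorem integral_ray_eq [CompleteSpace E] {g : ℂ → E} {ε : ℂ} (hε : ‖ε‖ = 1) {a b C : ℝ}
    (hab : a ≤ b)
    (hd : ∀ r : ℝ, 0 < r → ∀ φ ∈ Icc a b, DifferentiableAt ℂ g (ε * (r * Complex.exp (φ * Complex.I))))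
    (hb : ∀ r : ℝ, 0 < r → ∀ φ ∈ Icc a b,
      ‖g (ε * (r * Complex.exp (φ * Complex.I)))‖ ≤ C * (1 + r ^ 2)⁻¹) :
    ∫ r in Ioi (0 : ℝ), (ε * Complex.exp (a * Complex.I)) • g (r * (ε * Complex.exp (a * Complex.I)))
      = ∫ r in Ioi (0 : ℝ),
        (ε * Complex.exp (b * Complex.I)) • g (r * (ε * Complex.exp (b * Complex.I))) := by
  have hexp : ∀ w : ℂ, Complex.exp w = Real.exp w.re * Complex.exp (w.im * Complex.I) := fun w => by
    rw [Complex.ofReal_exp, ← Complex.exp_add, Complex.re_add_im]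
  -- The substitution `ζ = ε exp w` turns rays into horizontal lines and the sector between them
  -- into a strip.
  have key : ∀ y : ℝ, ∫ r in Ioi (0 : ℝ),
      (ε * Complex.exp (y * Complex.I)) • g (r * (ε * Complex.exp (y * Complex.I))) =
      ∫ x : ℝ, (ε * Complex.exp (x + y * Complex.I)) • g (ε * Complex.exp (x + y * Complex.I)) :=
    fun y => by
      rw [integral_Ioi_eq_integral_exp]
      refine integral_congr_ae (Eventually.of_forall fun x => ?_)
      simp only
      rw [← Complex.coe_smul, smul_smul, Complex.exp_add, Complex.ofReal_exp]
      congr 1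
      · ring
      · congr 1; ring
  rw [key, key]
  refine integral_horizontal_eq (h := fun w => (ε * Complex.exp w) • g (ε * Complex.exp w))
    (C := 2 * C) hab (fun w hw => ?_) fun w hw => ?_
  · have h1 := hd _ (Real.exp_pos w.re) _ hw
    rw [← hexp] at h1
    exact DifferentiableAt.smul (by fun_prop)
      (DifferentiableAt.comp (f := fun w => ε * Complex.exp w) w h1 (by fun_prop))
  · have h1 := hb _ (Real.exp_pos w.re) _ hw
    have hC : 0 ≤ C := by
      have := (norm_nonneg _).trans h1
      exact nonneg_of_mul_nonneg_left this (by positivity)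
    rw [← hexp] at h1
    rw [norm_smul, norm_mul, hε, one_mul, Complex.norm_exp]
    calc _ ≤ Real.exp w.re * (C * (1 + Real.exp w.re ^ 2)⁻¹) := by gcongr
      _ = C * (Real.exp w.re * (1 + Real.exp w.re ^ 2)⁻¹) := by ring
      _ ≤ C * (2 * (1 + w.re ^ 2)⁻¹) :=
        mul_le_mul_of_nonneg_left (exp_mul_inv_one_add_exp_sq_le _) hC
      _ = _ := by ring

/-- On the unit circle the squares of the two sides differ by `(1 - e.re ^ 2) * (1 - r ^ 2) ^ 2`. -/
theorem cos_mul_one_add_sq_le {e : ℂ} (he : ‖e‖ = 1) (r : ℝ) :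
    |e.re| * (1 + r ^ 2) ≤ ‖1 + (r * e : ℂ) ^ 2‖ := by
  have h1 : e.re ^ 2 + e.im ^ 2 = 1 := by
    have := Complex.sq_norm e
    rw [he, Complex.normSq_apply] at this
    linarith
  refine abs_le_of_sq_le_sq' ?_ (norm_nonneg _) |>.2
  rw [Complex.sq_norm, Complex.normSq_apply, mul_pow, sq_abs]
  simp only [Complex.add_re, Complex.one_re, Complex.add_im, Complex.one_im, sq, Complex.mul_re,
    Complex.mul_im, Complex.ofReal_re, Complex.ofReal_im]
  have h2 : 0 ≤ (1 - e.re ^ 2) * (1 - r ^ 2) ^ 2 :=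
    mul_nonneg (by nlinarith [sq_nonneg e.im]) (sq_nonneg _)
  have h3 : (-2 * r ^ 2 + r ^ 4 * (e.re ^ 2 + e.im ^ 2 + 1)) * (e.re ^ 2 + e.im ^ 2 - 1) = 0 := by
    rw [h1, sub_self, mul_zero]
  linarith

/-- The poles `± i` are not crossed on rotating the ray onto the real axis, where the integral is an
arctangent. -/
theorem integral_ray_inv_one_add_sq {ε : ℂ} (hε : ε ^ 2 = 1) {θ : ℝ} (hθ : |θ| < Real.pi / 2) :
    ∫ r in Ioi (0 : ℝ), (ε * Complex.exp (θ * Complex.I)) •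
      (1 + (r * (ε * Complex.exp (θ * Complex.I)) : ℂ) ^ 2)⁻¹ = ε * (Real.pi / 2) := by
  have hε1 : ‖ε‖ = 1 := by
    have := congrArg norm hε
    rw [norm_pow, norm_one] at this
    nlinarith [norm_nonneg ε]
  have hcos : 0 < Real.cos θ := Real.cos_pos_of_mem_Ioo (abs_lt.1 hθ)
  have hsq : ∀ (r φ : ℝ), (ε * (r * Complex.exp (φ * Complex.I))) ^ 2 =
      (r * Complex.exp (φ * Complex.I)) ^ 2 := fun r φ => by rw [mul_pow, hε, one_mul]
  have hlow : ∀ r > (0 : ℝ), ∀ φ : ℝ, |φ| ≤ |θ| →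
      Real.cos θ * (1 + r ^ 2) ≤ ‖1 + (ε * (r * Complex.exp (φ * Complex.I))) ^ 2‖ := by
    intro r hr φ hφ
    rw [hsq]
    refine le_trans ?_ (cos_mul_one_add_sq_le (Complex.norm_exp_ofReal_mul_I φ) r)
    rw [Complex.exp_ofReal_mul_I_re]
    gcongr
    refine le_trans ?_ (le_abs_self _)
    rw [← Real.cos_abs θ, ← Real.cos_abs φ]
    exact Real.cos_le_cos_of_nonneg_of_le_pi (abs_nonneg _) (by linarith [Real.pi_pos]) hφ
  have hrot : ∀ a b : ℝ, a ≤ b → |a| ≤ |θ| → |b| ≤ |θ| →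
      ∫ r in Ioi (0 : ℝ), (ε * Complex.exp (a * Complex.I)) •
        (1 + (r * (ε * Complex.exp (a * Complex.I)) : ℂ) ^ 2)⁻¹ =
      ∫ r in Ioi (0 : ℝ), (ε * Complex.exp (b * Complex.I)) •
        (1 + (r * (ε * Complex.exp (b * Complex.I)) : ℂ) ^ 2)⁻¹ := by
    intro a b hab ha hb
    have hφ : ∀ φ ∈ Icc a b, |φ| ≤ |θ| := fun φ h =>
      (abs_le_max_abs_abs h.1 h.2).trans (max_le ha hb)
    refine integral_ray_eq (g := fun ζ : ℂ => (1 + ζ ^ 2)⁻¹) (C := (Real.cos θ)⁻¹) hε1 hab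
      (fun r hr φ h => ?_) fun r hr φ h => ?_
    · refine DifferentiableAt.inv (by fun_prop) (norm_ne_zero_iff.1 ?_)
      exact ((by positivity : 0 < Real.cos θ * (1 + r ^ 2)).trans_le (hlow r hr φ (hφ φ h))).ne'
    · rw [norm_inv, ← mul_inv]
      exact inv_anti₀ (by positivity) (hlow r hr φ (hφ φ h))
  have h0 : ∫ r in Ioi (0 : ℝ), (ε * Complex.exp ((0 : ℝ) * Complex.I)) •
        (1 + (r * (ε * Complex.exp ((0 : ℝ) * Complex.I)) : ℂ) ^ 2)⁻¹ = ε * (Real.pi / 2) := by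
    have : ∀ r : ℝ, (ε * Complex.exp ((0 : ℝ) * Complex.I)) •
        (1 + (r * (ε * Complex.exp ((0 : ℝ) * Complex.I)) : ℂ) ^ 2)⁻¹ =
        ε * (((1 + r ^ 2)⁻¹ : ℝ) : ℂ) := fun r => by
      have h2 : (r * ε : ℂ) ^ 2 = r ^ 2 := by rw [mul_pow, hε, mul_one]
      simp [h2]
    simp_rw [this]
    rw [integral_const_mul, integral_complex_ofReal, integral_Ioi_inv_one_add_sq]
    simp
  rcases le_total θ 0 with h | h
  · rw [hrot θ 0 h le_rfl (by simp), h0]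
  · rw [← hrot 0 θ h (by simp) le_rfl, h0]

end RayRotation

/-! ### Differentiability under bounded maps and inversion. -/

section Differentiability

theorem differentiableOn_clm_apply {E F : Type*} [NormedAddCommGroup E] [NormedSpace ℂ E]
    [NormedAddCommGroup F] [NormedSpace ℂ F] (L : E →L[ℂ] F) {f : ℂ → E} {U : Set ℂ}
    (h : DifferentiableOn ℂ f U) : DifferentiableOn ℂ (fun z => L (f z)) U :=
  L.differentiable.comp_differentiableOn h

theorem differentiableOn_ringInverse {A : Type*} [NormedRing A] [NormedAlgebra ℂ A]
    [HasSummableGeomSeries A] {U : Set ℂ} {B : ℂ → A} (hd : DifferentiableOn ℂ B U)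
    (hB : ∀ z ∈ U, IsUnit (B z)) : DifferentiableOn ℂ (fun z => Ring.inverse (B z)) U :=
  hd.inverse hB

end Differentiability

/-! ### Inverting an accretive operator on a subspace. -/

section AccretiveInverse

variable {X : Type*} [NormedAddCommGroup X] [InnerProductSpace ℂ X]

local notation "⟪" x ", " y "⟫" => inner ℂ x y

instance instCompleteSpaceRangeClosure [CompleteSpace X] (T : X →ₗ.[ℂ] X) :
    CompleteSpace (rangeClosure T) :=
  (Submodule.isClosed_topologicalClosure _).completeSpace_coe

/-- Lax–Milgram: the form of the compression on `K` is that of `B`, hence coercive. -/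
theorem isUnit_compression {K : Submodule ℂ X} [CompleteSpace K] {B : X →L[ℂ] X} {κ : ℝ}
    (hκ : 0 < κ) (hB : ∀ u ∈ K, κ * ‖u‖ ^ 2 ≤ (⟪B u, u⟫).re) : IsUnit (compression K B) := by
  refine ContinuousLinearMap.isUnit_of_forall_le_norm_inner_map _ (c := ⟨κ, hκ.le⟩) hκ fun u => ?_
  have h1 : ⟪compression K B u, u⟫ = ⟪B u, (u : X)⟫ := by
    rw [compression_apply, Submodule.inner_orthogonalProjectionOnto_eq_of_mem_right]
  rw [h1]
  have := (hB u u.2).trans ((le_abs_self _).trans (Complex.abs_re_le_norm _))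
  rw [mul_comm]
  exact this

/-- The operator `(P B|_K)⁻¹ P` with `P` the orthogonal projection onto `K`. -/
def accInv (K : Submodule ℂ X) [CompleteSpace K] (B : X →L[ℂ] X) : X →L[ℂ] K :=
  Ring.inverse (compression K B) ∘L K.orthogonalProjectionOnto

variable {K : Submodule ℂ X} [CompleteSpace K] {B : X →L[ℂ] X}

theorem accInv_eq_zero_of_mem {w : X} (hw : w ∈ Kᗮ) : accInv K B w = 0 := by
  simp [accInv, Submodule.orthogonalProjectionOnto_eq_zero_iff.2 hw]

/-- When `K` is the closure of the range of `D`, the error is in the null space of `D`, so `D` does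
not see it. -/
theorem map_accInv_sub_mem (hB : IsUnit (compression K B)) (w : X) :
    B (accInv K B w) - w ∈ Kᗮ := by
  rw [← Submodule.orthogonalProjectionOnto_eq_zero_iff, map_sub, sub_eq_zero]
  have := DFunLike.congr_fun (Ring.mul_inverse_cancel _ hB) (K.orthogonalProjectionOnto w)
  exact this

theorem accInv_map (hB : IsUnit (compression K B)) (u : K) : accInv K B (B u) = u :=
  DFunLike.congr_fun (Ring.inverse_mul_cancel _ hB) u

theorem mem_orthogonal_of_accInv_eq_zero (hB : IsUnit (compression K B)) {w : X}
    (hw : accInv K B w = 0) : w ∈ Kᗮ := by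
  have := map_accInv_sub_mem hB w
  rw [hw] at this
  simpa using this

theorem accInv_surjective (hB : IsUnit (compression K B)) : Function.Surjective (accInv K B) :=
  fun u => ⟨B u, accInv_map hB u⟩

theorem map_sub_accInv_map_mem (hB : IsUnit (compression K B)) (u : X) :
    B (u - accInv K B (B u)) ∈ Kᗮ := by
  have := Kᗮ.neg_mem (map_accInv_sub_mem hB (B u))
  rwa [neg_sub, ← map_sub] at this

theorem differentiableOn_compression {U : Set ℂ} {B : ℂ → X →L[ℂ] X}
    (hd : DifferentiableOn ℂ B U) : DifferentiableOn ℂ (fun z => compression K (B z)) U :=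
  differentiableOn_clm_apply (E := X →L[ℂ] X) (F := K →L[ℂ] K) (compression K) hd

theorem differentiableOn_accInv {U : Set ℂ} {B : ℂ → X →L[ℂ] X} (hd : DifferentiableOn ℂ B U)
    (hB : ∀ z ∈ U, IsUnit (compression K (B z))) :
    DifferentiableOn ℂ (fun z => accInv K (B z)) U :=
  DifferentiableOn.clm_comp (differentiableOn_ringInverse (A := K →L[ℂ] K)
    (B := fun z => compression K (B z)) (differentiableOn_compression hd) hB)
    (differentiableOn_const _)

end AccretiveInverse

/-! ### Range and null space of `D B`. -/

section SelfAdjoint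

variable {X : Type*} [NormedAddCommGroup X] [InnerProductSpace ℂ X] [CompleteSpace X]

local notation "⟪" x ", " y "⟫" => inner ℂ x y

variable {D : X →ₗ.[ℂ] X} (hD : IsSelfAdjoint D)

include hD

theorem inner_graph_symm {x x' y y' : X} (hx : (x, x') ∈ D.graph) (hy : (y, y') ∈ D.graph) :
    ⟪x', y⟫ = ⟪x, y'⟫ := by
  obtain ⟨a, rfl, rfl⟩ := (LinearPMap.mem_graph_iff _).1 hx
  obtain ⟨b, rfl, rfl⟩ := (LinearPMap.mem_graph_iff _).1 hy
  have := LinearPMap.adjoint_isFormalAdjoint hD.dense_domain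
  rw [LinearPMap.isSelfAdjoint_def.1 hD] at this
  exact this a b

/-- The maximality half of self-adjointness: the hypothesis puts `(y, w)` in the graph of the
adjoint. -/
theorem mem_graph_of_forall_inner {y w : X} (h : ∀ x x', (x, x') ∈ D.graph → ⟪w, x⟫ = ⟪y, x'⟫) :
    (y, w) ∈ D.graph := by
  have h' : ∀ x : D.domain, ⟪w, (x : X)⟫ = ⟪y, D x⟫ := fun x => h _ _ (D.mem_graph x)
  have hy := LinearPMap.mem_adjoint_domain_of_exists (T := D) y ⟨w, h'⟩
  have := LinearPMap.adjoint_apply_eq hD.dense_domain ⟨y, hy⟩ h'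
  rw [← LinearPMap.isSelfAdjoint_def.1 hD]
  exact (LinearPMap.mem_graph_iff _).2 ⟨⟨y, hy⟩, rfl, this⟩

theorem mem_orthogonal_iff_mem_graph {y : X} : y ∈ (rangeClosure D)ᗮ ↔ (y, 0) ∈ D.graph := by
  rw [rangeClosure, Submodule.orthogonal_closure]
  constructor
  · intro h
    refine mem_graph_of_forall_inner hD fun x x' hx => ?_
    rw [inner_zero_left]
    exact ((Submodule.mem_orthogonal' _ _).1 h _ (mem_range_iff.2 ⟨x, hx⟩)).symm
  · intro h
    refine (Submodule.mem_orthogonal' _ _).2 fun v hv => ?_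
    obtain ⟨x, hx⟩ := mem_range_iff.1 hv
    rw [← inner_graph_symm hD h hx, inner_zero_left]

theorem mem_precomp_graph_of_sub_mem {B : X →L[ℂ] X} {u x x' : X} (hx : (x, x') ∈ D.graph)
    (h : B u - x ∈ (rangeClosure D)ᗮ) : (u, x') ∈ (precomp D B).graph := by
  rw [mem_precomp_graph_iff]
  have := D.graph.add_mem hx ((mem_orthogonal_iff_mem_graph hD).1 h)
  simpa using this

theorem mem_nullSpace_precomp_iff {B : X →L[ℂ] X} {u : X} :
    u ∈ nullSpace (precomp D B) ↔ B u ∈ (rangeClosure D)ᗮ := by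
  rw [mem_nullSpace_iff, mem_precomp_graph_iff, mem_orthogonal_iff_mem_graph hD]

variable {B : X →L[ℂ] X} (hB : IsUnit (compression (rangeClosure D) B))

include hB

theorem accInv_mem_precomp_graph {x x' : X} (hx : (x, x') ∈ D.graph) :
    ((accInv (rangeClosure D) B x : X), x') ∈ (precomp D B).graph :=
  mem_precomp_graph_of_sub_mem hD hx (map_accInv_sub_mem hB x)

/-- The ranges coincide even before closure: `D x = D B (A x)` with `A` the `accInv`. -/
theorem rangeClosure_precomp : rangeClosure (precomp D B) = rangeClosure D := by
  have : LinearMap.range (precomp D B).toFun = LinearMap.range D.toFun := by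
    ext v
    rw [mem_range_iff, mem_range_iff]
    exact ⟨fun ⟨u, hu⟩ => ⟨_, mem_precomp_graph_iff.1 hu⟩,
      fun ⟨x, hx⟩ => ⟨_, accInv_mem_precomp_graph hD hB hx⟩⟩
  rw [rangeClosure, rangeClosure, this]

/-- The projection onto the null space of `D B` along the closure of the range of `D`. -/
theorem isNullProjection_precomp :
    IsNullProjection (precomp D B)
      (1 - (rangeClosure D).subtypeL ∘L accInv (rangeClosure D) B ∘L B) := by
  refine ⟨?_, ?_, ?_⟩
  · ext u
    simp [accInv_map hB]
  · ext u
    rw [mem_nullSpace_precomp_iff hD]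
    constructor
    · rintro ⟨v, rfl⟩
      exact map_sub_accInv_map_mem hB v
    · intro h
      exact ⟨u, by simp [accInv_eq_zero_of_mem h]⟩
  · ext u
    rw [rangeClosure_precomp hD hB, LinearMap.mem_ker]
    constructor
    · intro h
      have h : u - (accInv (rangeClosure D) B (B u) : X) = 0 := h
      rw [sub_eq_zero.1 h]
      exact (accInv (rangeClosure D) B (B u)).2
    · intro h
      have := congrArg Subtype.val (accInv_map hB ⟨u, h⟩)
      exact sub_eq_zero.2 this.symm

end SelfAdjoint

/-! ### Resolvent bounds for `D B`. -/

section Bisectorial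

variable {X : Type*} [NormedAddCommGroup X] [InnerProductSpace ℂ X] [CompleteSpace X]

local notation "⟪" x ", " y "⟫" => inner ℂ x y

/-- `T - l` is viewed as a bounded map on the complete space `T.graph`: the lower bound makes it
injective with closed range, and `hdense` says that nothing is orthogonal to the range. -/
theorem exists_isResolventAt {T : X →ₗ.[ℂ] X} (hT : T.IsClosed) {l : ℂ} {c : ℝ} (hc : 0 < c)
    (hlow : ∀ u v, (u, v) ∈ T.graph → c * ‖u‖ ≤ ‖v - l • u‖)
    (hdense : ∀ g, (∀ u v, (u, v) ∈ T.graph → ⟪g, v - l • u⟫ = 0) → g = 0) :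
    ∃ R, IsResolventAt T l R ∧ ‖R‖ ≤ c⁻¹ := by
  have : CompleteSpace T.graph := IsClosed.completeSpace_coe (hs := hT)
  let Φ : T.graph →L[ℂ] X := (ContinuousLinearMap.snd ℂ X X - l • ContinuousLinearMap.fst ℂ X X) ∘L
    T.graph.subtypeL
  have hΦ : ∀ p : T.graph, Φ p = (p : X × X).2 - l • (p : X × X).1 := fun p => rfl
  have hfst : ∀ p : T.graph, ‖(p : X × X).1‖ ≤ c⁻¹ * ‖Φ p‖ := fun p => by
    rw [inv_mul_eq_div, le_div_iff₀ hc, mul_comm]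
    exact hlow _ _ p.2
  have hanti : AntilipschitzWith (Real.toNNReal (1 + (1 + ‖l‖) * c⁻¹)) Φ := by
    refine AddMonoidHomClass.antilipschitz_of_bound Φ fun p => ?_
    rw [Real.coe_toNNReal _ (by positivity)]
    have h1 := hfst p
    have h2 : ‖(p : X × X).2‖ ≤ ‖Φ p‖ + ‖l‖ * ‖(p : X × X).1‖ := by
      rw [← norm_smul, hΦ]
      simpa using norm_add_le ((p : X × X).2 - l • (p : X × X).1) (l • (p : X × X).1)
    have h3 : 0 ≤ c⁻¹ * ‖Φ p‖ := by positivity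
    have h4 : ‖l‖ * ‖(p : X × X).1‖ ≤ ‖l‖ * (c⁻¹ * ‖Φ p‖) := by gcongr
    have h5 : 0 ≤ ‖l‖ * (c⁻¹ * ‖Φ p‖) := by positivity
    rw [Submodule.coe_norm, Prod.norm_def]
    exact max_le (by linarith [norm_nonneg (Φ p)]) (by linarith)
  have hsurj : Function.Surjective Φ := by
    have hcl : IsClosed (LinearMap.range (Φ : T.graph →ₗ[ℂ] X) : Set X) := by
      have := hanti.isClosed_range Φ.uniformContinuous
      rwa [LinearMap.coe_range]
    have : CompleteSpace (LinearMap.range (Φ : T.graph →ₗ[ℂ] X)) := hcl.completeSpace_coe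
    have htop : LinearMap.range (Φ : T.graph →ₗ[ℂ] X) = ⊤ := by
      rw [← Submodule.orthogonal_eq_bot_iff, Submodule.eq_bot_iff]
      intro g hg
      refine hdense g fun u v huv => ?_
      exact (Submodule.mem_orthogonal' _ _).1 hg _ ⟨⟨(u, v), huv⟩, rfl⟩
    exact LinearMap.range_eq_top.1 htop
  let e := ContinuousLinearEquiv.ofBijective Φ (LinearMap.ker_eq_bot.2 hanti.injective)
    (LinearMap.range_eq_top.2 hsurj)
  have he : ∀ u, Φ (e.symm u) = u := fun u => e.apply_symm_apply u
  have he' : ∀ p, e.symm (Φ p) = p := fun p => e.symm_apply_apply p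
  refine ⟨ContinuousLinearMap.fst ℂ X X ∘L T.graph.subtypeL ∘L (e.symm : X →L[ℂ] T.graph),
    ⟨fun u => ?_, fun v w h => ?_⟩, ?_⟩
  · have h1 := he u
    rw [hΦ] at h1
    have h2 : u + l • ((e.symm u : T.graph) : X × X).1 = ((e.symm u : T.graph) : X × X).2 := by
      rw [← sub_eq_iff_eq_add.1 h1]
    change (((e.symm u : T.graph) : X × X).1, u + l • ((e.symm u : T.graph) : X × X).1) ∈ T.graph
    rw [h2]
    exact (e.symm u).2
  · have h1 := he' ⟨(v, w), h⟩
    rw [hΦ, map_sub, map_smul] at h1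
    have := congrArg (fun p : T.graph => (p : X × X).1) h1
    simp only [Submodule.coe_sub, Submodule.coe_smul, Prod.fst_sub, Prod.smul_fst] at this
    exact sub_eq_iff_eq_add.1 this
  · refine ContinuousLinearMap.opNorm_le_bound _ (by positivity) fun u => ?_
    have := hfst (e.symm u)
    rwa [he] at this

theorem sector_im_lower {l w : ℂ} {τ : ℝ} (hw : |w.im| ≤ τ * w.re) :
    (|l.im| - τ * |l.re|) * w.re ≤ |(l * w).im| := by
  have h1 : |l.im| * w.re ≤ |l.im * w.re| := by
    rw [abs_mul]; gcongr; exact le_abs_self _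
  have h2 : |l.re * w.im| ≤ |l.re| * (τ * w.re) := by
    rw [abs_mul]; gcongr
  have h3 : |l.im * w.re| ≤ |(l * w).im| + |l.re * w.im| := by
    rw [Complex.mul_im]
    have := abs_sub (l.re * w.im + l.im * w.re) (l.re * w.im)
    rwa [add_sub_cancel_left] at this
  linarith

variable {D : X →ₗ.[ℂ] X} (hD : IsSelfAdjoint D) {B : X →L[ℂ] X} {κ τ : ℝ} (hκ : 0 < κ)
  (hell : ∀ u ∈ rangeClosure D, κ * ‖u‖ ^ 2 ≤ (⟪B u, u⟫).re)
  (hsec : ∀ u ∈ rangeClosure D, |(⟪B u, u⟫).im| ≤ τ * (⟪B u, u⟫).re)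

include hD hκ hell hsec in
-- `⟪B u, v⟫ = ⟪B u, D B u⟫` is real, so the imaginary part of `⟪B u, v - l u⟫` is that of `-l ⟪B u,
-- u⟫`, which the sector condition bounds below.
theorem norm_le_of_mem_precomp_graph {l : ℂ} {δ : ℝ} (hδ : 0 ≤ δ) (hl : δ ≤ |l.im| - τ * |l.re|)
    {u v : X} (hu : u ∈ rangeClosure D) (huv : (u, v) ∈ (precomp D B).graph) :
    δ * κ * ‖u‖ ≤ ‖B‖ * ‖v - l • u‖ := by
  have hg := mem_precomp_graph_iff.1 huv
  have hreal : (⟪B u, v⟫).im = 0 := by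
    rw [← Complex.conj_eq_iff_im, inner_conj_symm]
    exact inner_graph_symm hD hg hg
  have him : (l * ⟪B u, u⟫).im = -(⟪B u, v - l • u⟫).im := by
    rw [inner_sub_right, inner_smul_right, Complex.sub_im, hreal, zero_sub, neg_neg]
  have h1 : δ * (κ * ‖u‖ ^ 2) ≤ ‖B‖ * ‖u‖ * ‖v - l • u‖ := by
    have hre : 0 ≤ (⟪B u, u⟫).re := (by positivity : 0 ≤ κ * ‖u‖ ^ 2).trans (hell u hu)
    calc δ * (κ * ‖u‖ ^ 2) ≤ δ * (⟪B u, u⟫).re := by gcongr; exact hell u hu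
      _ ≤ (|l.im| - τ * |l.re|) * (⟪B u, u⟫).re := by gcongr
      _ ≤ |(l * ⟪B u, u⟫).im| := sector_im_lower (hsec u hu)
      _ = |(⟪B u, v - l • u⟫).im| := by rw [him, abs_neg]
      _ ≤ ‖⟪B u, v - l • u⟫‖ := Complex.abs_im_le_norm _
      _ ≤ ‖B u‖ * ‖v - l • u‖ := norm_inner_le_norm _ _
      _ ≤ _ := by gcongr; exact B.le_opNorm u
  rcases (norm_nonneg u).eq_or_lt with h0 | h0
  · rw [← h0, mul_zero]; positivity
  · refine le_of_mul_le_mul_right ?_ h0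
    linarith

include hD hκ hell hsec in
-- The projection `Q = A B` splits `u` into `Q u ∈ K`, controlled by `norm_le_of_mem_precomp_graph`,
-- and a null vector, on which `DB - l` is `-l`.
theorem exists_resolvent_bound {c : ℝ} (hc : 0 < c) :
    ∃ C : ℝ, 0 < C ∧ ∀ l : ℂ, l ≠ 0 → c * ‖l‖ ≤ |l.im| - τ * |l.re| →
      ∃ R, IsResolventAt (precomp D B) l R ∧ ‖R‖ ≤ C * ‖l‖⁻¹ := by
  have hB := isUnit_compression hκ hell
  set A := accInv (rangeClosure D) B with hA
  set Q : X →L[ℂ] X := (rangeClosure D).subtypeL ∘L A ∘L B with hQ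
  have hQmem : ∀ u, Q u ∈ rangeClosure D := fun u => (A (B u)).2
  have hQid : ∀ u ∈ rangeClosure D, Q u = u := fun u hu =>
    congrArg Subtype.val (accInv_map hB ⟨u, hu⟩)
  have hnull : ∀ u, (u - Q u, 0) ∈ (precomp D B).graph := fun u =>
    mem_nullSpace_iff.1 ((mem_nullSpace_precomp_iff hD).2 (map_sub_accInv_map_mem hB u))
  -- One term for each of the two pieces of `u`; the summand `1` only ensures positivity.
  set C : ℝ := ‖B‖ * ‖Q‖ / (c * κ) + ‖1 - Q‖ + 1 with hC
  have hC0 : 0 < C := by positivity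
  refine ⟨C, hC0, fun l hl hcl => ?_⟩
  have hl0 : 0 < ‖l‖ := norm_pos_iff.2 hl
  have hlow : ∀ u v, (u, v) ∈ (precomp D B).graph → C⁻¹ * ‖l‖ * ‖u‖ ≤ ‖v - l • u‖ := by
    intro u v huv
    have hv : Q v = v := hQid v (mem_rangeClosure_of_mem_graph (mem_precomp_graph_iff.1 huv))
    have hQu : (Q u, v) ∈ (precomp D B).graph := by
      have := (precomp D B).graph.sub_mem huv (hnull u)
      simpa using this
    have h1 := norm_le_of_mem_precomp_graph hD hκ hell hsec (by positivity) hcl (hQmem u) hQu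
    have h2 : v - l • Q u = Q (v - l • u) := by rw [map_sub, map_smul, hv]
    have h3 : ‖l‖ * ‖u - Q u‖ ≤ ‖1 - Q‖ * ‖v - l • u‖ := by
      have : (1 - Q) (v - l • u) = -(l • (u - Q u)) := by
        rw [sub_apply, ← h2, one_apply_eq_self]
        module
      rw [← norm_smul, ← norm_neg, ← this]
      exact (1 - Q).le_opNorm _
    have h4 : ‖l‖ * ‖Q u‖ ≤ ‖B‖ * ‖Q‖ / (c * κ) * ‖v - l • u‖ := by
      rw [div_mul_eq_mul_div, le_div_iff₀ (by positivity)]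
      rw [h2] at h1
      calc ‖l‖ * ‖Q u‖ * (c * κ) = c * ‖l‖ * κ * ‖Q u‖ := by ring
        _ ≤ ‖B‖ * ‖Q (v - l • u)‖ := h1
        _ ≤ ‖B‖ * (‖Q‖ * ‖v - l • u‖) := by gcongr; exact Q.le_opNorm _
        _ = _ := by ring
    have h5 : ‖u‖ ≤ ‖Q u‖ + ‖u - Q u‖ := by simpa using norm_add_le (Q u) (u - Q u)
    rw [mul_assoc, inv_mul_eq_div, div_le_iff₀ hC0]
    calc ‖l‖ * ‖u‖ ≤ ‖l‖ * (‖Q u‖ + ‖u - Q u‖) := by gcongr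
      _ ≤ ‖v - l • u‖ * C := by rw [hC]; nlinarith [norm_nonneg (v - l • u)]
  -- For `g` orthogonal to the range of `DB - l`, testing with `A x` shows that `g` is in the domain
  -- of `D` with `D g = (l A')* g`. Then `⟪g, l A' g⟫` is real, which the sector condition allows
  -- only if `A' g = 0`, so `g ∈ Kᗮ`; testing with null vectors finally gives `g = 0`.
  have hdense : ∀ g, (∀ u v, (u, v) ∈ (precomp D B).graph → ⟪g, v - l • u⟫ = 0) → g = 0 := by
    intro g hg
    set A' : X →L[ℂ] X := (rangeClosure D).subtypeL ∘L A with hA'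
    have hgg : (g, ContinuousLinearMap.adjoint (l • A') g) ∈ D.graph := by
      refine mem_graph_of_forall_inner hD fun x x' hx => ?_
      have := hg _ _ (accInv_mem_precomp_graph hD hB hx)
      rw [inner_sub_right, sub_eq_zero] at this
      rw [ContinuousLinearMap.adjoint_inner_left, this]
      rfl
    have hreal : (l * ⟪g, A' g⟫).im = 0 := by
      rw [← inner_smul_right, ← Complex.conj_eq_iff_im, inner_conj_symm]
      have := inner_graph_symm hD hgg hgg
      rw [ContinuousLinearMap.adjoint_inner_left, ContinuousLinearMap.adjoint_inner_right] at this
      exact this.symm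
    have hAg : (A' g : X) ∈ rangeClosure D := (A g).2
    have hw : ⟪g, A' g⟫ = ⟪B (A' g), A' g⟫ := by
      have h1 := (Submodule.mem_orthogonal' _ _).1 (map_accInv_sub_mem hB g) _ hAg
      rw [inner_sub_left, sub_eq_zero] at h1
      exact h1.symm
    have hzero : A' g = 0 := by
      have h1 := sector_im_lower (l := l) (hsec _ hAg)
      rw [← hw, hreal, abs_zero, hw] at h1
      have h2 := hell _ hAg
      have h3 : 0 < |l.im| - τ * |l.re| := lt_of_lt_of_le (by positivity) hcl
      have h4 : (⟪B (A' g), A' g⟫).re ≤ 0 := by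
        by_contra! h
        exact absurd (mul_pos h3 h) h1.not_gt
      have h5 : ‖A' g‖ ^ 2 ≤ 0 := by
        by_contra! h
        linarith [mul_pos hκ h]
      exact norm_eq_zero.1 (pow_eq_zero_iff two_ne_zero |>.1 (h5.antisymm (sq_nonneg _)))
    have hgo : g ∈ (rangeClosure D)ᗮ :=
      mem_orthogonal_of_accInv_eq_zero hB (Subtype.ext hzero)
    refine ext_inner_right ℂ fun u => ?_
    have h1 := hg _ _ (hnull u)
    rw [zero_sub, inner_neg_right, neg_eq_zero, inner_smul_right] at h1
    have h2 := (mul_eq_zero.1 h1).resolve_left hl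
    rw [inner_sub_right, (Submodule.mem_orthogonal' _ _).1 hgo _ (hQmem u), sub_zero] at h2
    rw [h2, inner_zero_left]
  obtain ⟨R, hR, hRn⟩ := exists_isResolventAt (isClosed_precomp hD.isClosed B)
    (c := C⁻¹ * ‖l‖) (by positivity) hlow hdense
  refine ⟨R, hR, hRn.trans_eq ?_⟩
  rw [mul_inv, inv_inv]

end Bisectorial

/-! ### Angle of bisectoriality. -/

section BisectorialType

variable {X : Type*} [NormedAddCommGroup X] [InnerProductSpace ℂ X] [CompleteSpace X]

local notation "⟪" x ", " y "⟫" => inner ℂ x y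

variable {D : X →ₗ.[ℂ] X} (hD : IsSelfAdjoint D) {B : X →L[ℂ] X} {κ : ℝ} (hκ : 0 < κ)
  (hell : ∀ u ∈ rangeClosure D, κ * ‖u‖ ^ 2 ≤ (⟪B u, u⟫).re)

include hD hκ hell

theorem isBisectorial_precomp {ω : ℝ} (hω : 0 ≤ ω) (hω' : ω < Real.pi / 2)
    (harg : ∀ u ∈ rangeClosure D, |(⟪B u, u⟫).arg| ≤ ω) : IsBisectorial (precomp D B) ω := by
  have hsec : ∀ u ∈ rangeClosure D, |(⟪B u, u⟫).im| ≤ Real.tan ω * (⟪B u, u⟫).re :=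
    fun u hu => ((abs_arg_le_iff hω hω' _).1 (harg u hu)).2
  refine ⟨isClosed_precomp hD.isClosed B, fun l hl => ?_, fun μ hωμ hμ => ?_⟩
  · by_contra hl'
    have hl0 := ne_zero_of_notMem_closedBisector hl'
    rw [mem_closedBisector_iff hω hω', not_le, ← sub_pos] at hl'
    have hln : 0 < ‖l‖ := norm_pos_iff.2 hl0
    -- Mere invertibility at one `l`: the constant is the best one for this `l`, with no uniformity.
    obtain ⟨C, -, hC⟩ := exists_resolvent_bound hD hκ hell hsec (div_pos hl' hln)
    obtain ⟨R, hR, -⟩ := hC l hl0 (by rw [div_mul_cancel₀ _ hln.ne'])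
    exact hl ⟨R, hasBoundedInverse_affine_iff.2 hR⟩
  · have hμ0 := hω.trans_lt hωμ
    set a := Real.tan ω
    set b := Real.tan μ
    have hab : a < b := tan_mono hω hωμ hμ
    have ha : 0 ≤ a := Real.tan_nonneg_of_nonneg_of_le_pi_div_two hω hω'.le
    have hb : 0 < b := ha.trans_lt hab
    -- If `|im l| > b |re l|`, then `(b - a)(|re l| + |im l|) ≤ (1 + b)(|im l| - a |re l|)`; this is
    -- where the constant comes from.
    obtain ⟨C, hC0, hC⟩ := exists_resolvent_bound hD hκ hell hsec
      (c := (b - a) / (1 + b)) (div_pos (sub_pos.2 hab) (by linarith))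
    refine ⟨C, hC0, fun l hl => ?_⟩
    have hl0 := ne_zero_of_notMem_closedBisector hl
    rw [mem_closedBisector_iff hμ0.le hμ, not_le] at hl
    obtain ⟨R, hR, hRn⟩ := hC l hl0 (by
      rw [div_mul_eq_mul_div, div_le_iff₀ (by linarith)]
      have h1 : ‖l‖ ≤ |l.re| + |l.im| := Complex.norm_le_abs_re_add_abs_im l
      nlinarith [abs_nonneg l.re, abs_nonneg l.im])
    rwa [hR.resolventAt_eq]

/-- `|Im ⟪B u, u⟫| ≤ M ‖u‖² ≤ (M / κ) Re ⟪B u, u⟫`, an angle depending only on the two constants. -/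
theorem isBisectorial_precomp_arctan {M : ℝ} (hM : 0 ≤ M) (hB : ‖B‖ ≤ M) :
    IsBisectorial (precomp D B) (Real.arctan (M / κ)) := by
  have h0 : 0 ≤ Real.arctan (M / κ) := Real.arctan_nonneg.2 (by positivity)
  refine isBisectorial_precomp hD hκ hell h0 (Real.arctan_lt_pi_div_two _) fun u hu => ?_
  rw [abs_arg_le_iff h0 (Real.arctan_lt_pi_div_two _), Real.tan_arctan]
  have h1 := hell u hu
  refine ⟨le_trans (by positivity) h1, ?_⟩
  calc |(⟪B u, u⟫).im| ≤ ‖⟪B u, u⟫‖ := Complex.abs_im_le_norm _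
    _ ≤ ‖B u‖ * ‖u‖ := norm_inner_le_norm _ _
    _ ≤ (M * ‖u‖) * ‖u‖ := by gcongr; exact B.le_of_opNorm_le hB u
    _ = M / κ * (κ * ‖u‖ ^ 2) := by field_simp
    _ ≤ _ := by gcongr

end BisectorialType

/-! ### Dependence of the resolvent on `B`. -/

section Perturbation

open Filter Topology

variable {X : Type*} [NormedAddCommGroup X] [InnerProductSpace ℂ X] [CompleteSpace X]
  {D : X →ₗ.[ℂ] X} (hD : IsSelfAdjoint D)

/-- The operator `S` with `(D B' - l)⁻¹ - (D B - l)⁻¹ = (1 + l (D B' - l)⁻¹) S`, where `R` is the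
resolvent of `D B`. -/
def perturbation (K : Submodule ℂ X) [CompleteSpace K] (B B' R : X →L[ℂ] X) : X →L[ℂ] X :=
  (K.subtypeL ∘L accInv K B') ∘L (B - B') ∘L R

include hD in
-- With `u = R f`, `R'` is applied to two pairs in the graph of `D B'`: `A' B u`, mapped to `D B u =
-- f + l u`, and the null vector `u - A' B' u`. The sum of the two equations is the claim, with no
-- comparison of the domains of `D B` and `D B'`.
theorem resolvent_sub_eq {B B' R R' : X →L[ℂ] X} {l : ℂ}
    (hB' : IsUnit (compression (rangeClosure D) B'))
    (hR : IsResolventAt (precomp D B) l R) (hR' : IsResolventAt (precomp D B') l R') :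
    R' - R = (1 + l • R') * perturbation (rangeClosure D) B B' R := by
  ext f
  set A := accInv (rangeClosure D) B' with hA
  set u := R f with hu
  have h1 := hR'.apply_graph _ _
    (accInv_mem_precomp_graph hD hB' (mem_precomp_graph_iff.1 (hR.mem_graph f)))
  have h2 := hR'.apply_graph _ _
    (mem_nullSpace_iff.1 ((mem_nullSpace_precomp_iff hD).2 (map_sub_accInv_map_mem hB' u)))
  rw [← hu, ← hA, map_add, map_smul] at h1
  rw [← hA, map_zero, map_sub] at h2
  have h3 : perturbation (rangeClosure D) B B' R f = (A (B u) : X) - A (B' u) := by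
    change ((A ((B - B') (R f)) : rangeClosure D) : X) = _
    rw [sub_apply, map_sub]
    rfl
  change R' f - R f = perturbation (rangeClosure D) B B' R f +
    l • R' (perturbation (rangeClosure D) B B' R f)
  rw [h3, ← hu, map_sub]
  linear_combination (norm := module) h1 + h2

omit [CompleteSpace X] in
theorem norm_perturbation_le {K : Submodule ℂ X} [CompleteSpace K] (B B' R : X →L[ℂ] X) :
    ‖perturbation K B B' R‖ ≤ ‖accInv K B'‖ * ‖B - B'‖ * ‖R‖ := by
  have h1 : ‖K.subtypeL ∘L accInv K B'‖ ≤ ‖accInv K B'‖ := by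
    refine (ContinuousLinearMap.opNorm_comp_le _ _).trans ?_
    exact mul_le_of_le_one_left (norm_nonneg _) (Submodule.norm_subtypeL_le K)
  calc _ ≤ ‖K.subtypeL ∘L accInv K B'‖ * ‖(B - B') ∘L R‖ := ContinuousLinearMap.opNorm_comp_le _ _
    _ ≤ ‖accInv K B'‖ * (‖B - B'‖ * ‖R‖) := by
      gcongr
      exact ContinuousLinearMap.opNorm_comp_le _ _
    _ = _ := by ring

variable {U : Set ℂ} (hU : IsOpen U) {B : ℂ → X →L[ℂ] X} (hd : DifferentiableOn ℂ B U)
  (hB : ∀ z ∈ U, IsUnit (compression (rangeClosure D) (B z)))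

include hD hU hd hB

/-- The neighbourhood is independent of `l`: `‖S‖` is a small multiple of `‖l‖⁻¹`, which exactly
offsets the factor `l` in `resolvent_sub_eq`. -/
theorem eventually_norm_resolventAt_le {z : ℂ} (hz : z ∈ U) (C : ℝ) :
    ∀ᶠ w in 𝓝 z, w ∈ U ∧ ∀ (l : ℂ) (R R' : X →L[ℂ] X), l ≠ 0 → IsResolventAt (precomp D (B z)) l R →
      IsResolventAt (precomp D (B w)) l R' → ‖R‖ ≤ C * ‖l‖⁻¹ → ‖R'‖ ≤ (2 * C + 1) * ‖l‖⁻¹ := by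
  have hUz := hU.mem_nhds hz
  have hA := ((differentiableOn_accInv hd hB).differentiableAt hUz).continuousAt
  have hBc := (hd.differentiableAt hUz).continuousAt
  have hAn : Tendsto (fun w => ‖accInv (rangeClosure D) (B w)‖) (𝓝 z)
      (𝓝 ‖accInv (rangeClosure D) (B z)‖) := ContinuousAt.norm (E := X →L[ℂ] rangeClosure D) hA
  have hBn : Tendsto (fun w => ‖B z - B w‖) (𝓝 z) (𝓝 ‖B z - B z‖) :=
    (tendsto_const_nhds.sub hBc).norm
  have hlim : Tendsto (fun w => ‖accInv (rangeClosure D) (B w)‖ * ‖B z - B w‖ * C) (𝓝 z)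
      (𝓝 (‖accInv (rangeClosure D) (B z)‖ * ‖B z - B z‖ * C)) :=
    (Tendsto.mul hAn hBn).mul_const C
  rw [sub_self, norm_zero, mul_zero, zero_mul] at hlim
  -- Smallness `1 / 2` allows `l R' S` to be absorbed into `R'` on the left.
  filter_upwards [hUz, hlim.eventually (gt_mem_nhds (by norm_num : (0 : ℝ) < 1 / 2))] with w hwU hw
  refine ⟨hwU, fun l R R' hl hR hR' hRn => ?_⟩
  have hl0 : 0 < ‖l‖ := norm_pos_iff.2 hl
  set S := perturbation (rangeClosure D) (B z) (B w) R
  have hS : ‖S‖ ≤ 1 / 2 * ‖l‖⁻¹ := by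
    refine (norm_perturbation_le _ _ _).trans ?_
    calc _ ≤ ‖accInv (rangeClosure D) (B w)‖ * ‖B z - B w‖ * (C * ‖l‖⁻¹) := by gcongr
      _ = ‖accInv (rangeClosure D) (B w)‖ * ‖B z - B w‖ * C * ‖l‖⁻¹ := by ring
      _ ≤ _ := by gcongr
  have heq : R' = R + S + l • (R' * S) := by
    have := resolvent_sub_eq hD (hB w hwU) hR hR'
    rw [sub_eq_iff_eq_add] at this
    rw [add_mul, one_mul, smul_mul_assoc] at this
    rw [add_assoc, add_comm R]
    exact this
  have h1 : ‖l • (R' * S)‖ ≤ 1 / 2 * ‖R'‖ := by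
    rw [norm_smul]
    calc ‖l‖ * ‖R' * S‖ ≤ ‖l‖ * (‖R'‖ * (1 / 2 * ‖l‖⁻¹)) := by
          gcongr
          exact (norm_mul_le _ _).trans (by gcongr)
      _ = _ := by field_simp
  have h2 : ‖R'‖ ≤ ‖R‖ + ‖S‖ + ‖l • (R' * S)‖ := by
    conv_lhs => rw [heq]
    exact norm_add₃_le
  have h3 : (2 * C + 1) * ‖l‖⁻¹ = 2 * (C * ‖l‖⁻¹ + 1 / 2 * ‖l‖⁻¹) := by ring
  linarith

/-- `resolvent_sub_eq` reads `R' (1 - l S) = R + S`. As `S` vanishes at the base point `z`, the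
factor on the left is invertible nearby, and `R' = (R + S)(1 - l S)⁻¹`. -/
theorem differentiableOn_resolventAt {l : ℂ}
    (hR : ∀ z ∈ U, IsResolventAt (precomp D (B z)) l (resolventAt (precomp D (B z)) l)) :
    DifferentiableOn ℂ (fun z => resolventAt (precomp D (B z)) l) U := by
  intro z hz
  have hUz := hU.mem_nhds hz
  set R := resolventAt (precomp D (B z)) l with hRdef
  set S : ℂ → X →L[ℂ] X := fun w => perturbation (rangeClosure D) (B z) (B w) R with hS
  have hSd : DifferentiableOn ℂ S U :=
    ((differentiableOn_const (rangeClosure D).subtypeL).clm_comp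
      (differentiableOn_accInv hd hB)).clm_comp
      (((differentiableOn_const (B z)).sub hd).clm_comp (differentiableOn_const R))
  have hSz : S z = 0 := by
    simp only [hS, perturbation, sub_self, ContinuousLinearMap.zero_comp,
      ContinuousLinearMap.comp_zero]
  have hunit : IsUnit (1 - l • S z) := by rw [hSz]; simp
  have hSd' : DifferentiableAt ℂ (fun w => 1 - l • S w) z :=
    ((hSd.differentiableAt hUz).const_smul l).const_sub 1
  have hev : ∀ᶠ w in 𝓝 z, IsUnit (1 - l • S w) :=
    hSd'.continuousAt.eventually (Units.isOpen.mem_nhds hunit)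
  have hinv : DifferentiableAt ℂ (fun w => Ring.inverse (1 - l • S w)) z := hSd'.inverse hunit
  have hmain : DifferentiableAt ℂ (fun w => (R + S w) * Ring.inverse (1 - l • S w)) z :=
    ((hSd.differentiableAt hUz).const_add R).mul hinv
  refine (hmain.congr_of_eventuallyEq ?_).differentiableWithinAt
  filter_upwards [hUz, hev] with w hwU hw
  have h1 := resolvent_sub_eq hD (hB w hwU) (hR z hz) (hR w hwU)
  set R' := resolventAt (precomp D (B w)) l
  have h2 : R' * (1 - l • S w) = R + S w := by
    rw [sub_eq_iff_eq_add, add_mul, one_mul, smul_mul_assoc] at h1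
    rw [mul_sub, mul_one, mul_smul_comm, sub_eq_iff_eq_add]
    change R' = R + S w + l • (R' * S w)
    rw [add_assoc, add_comm R]
    exact h1
  rw [← h2, Ring.mul_inverse_cancel_right _ _ hw]

end Perturbation

/-! ### The resolvent as a function of the spectral parameter. -/

section Resolvent

open Filter Topology

variable {X : Type*} [NormedAddCommGroup X] [NormedSpace ℂ X] [CompleteSpace X]

theorem isOpen_compl_closedBisector {ω : ℝ} (hω : 0 ≤ ω) (hω' : ω < Real.pi / 2) :
    IsOpen (closedBisector ω)ᶜ := by
  have : (closedBisector ω)ᶜ = {z : ℂ | Real.tan ω * |z.re| < |z.im|} := by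
    ext z
    rw [mem_compl_iff, mem_closedBisector_iff hω hω', not_le]
    rfl
  rw [this]
  exact isOpen_lt (by fun_prop) (by fun_prop)

theorem IsBisectorial.differentiableAt_resolventAt {T : X →ₗ.[ℂ] X} {ω : ℝ}
    (hT : IsBisectorial T ω) (hω : 0 ≤ ω) (hω' : ω < Real.pi / 2) {l : ℂ}
    (hl : l ∉ closedBisector ω) : DifferentiableAt ℂ (resolventAt T) l := by
  set R := resolventAt T l with hRdef
  have hR := hT.isResolventAt hl
  have hd : DifferentiableAt ℂ (fun m => 1 - (m - l) • R) l :=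
    ((differentiableAt_id.sub_const l).smul_const R).const_sub 1
  have hunit : IsUnit (1 - (l - l) • R) := by simp
  have hev : ∀ᶠ m in 𝓝 l, IsUnit (1 - (m - l) • R) :=
    hd.continuousAt.eventually (Units.isOpen.mem_nhds hunit)
  have hinv : DifferentiableAt ℂ (fun m => Ring.inverse (1 - (m - l) • R)) l := hd.inverse hunit
  refine (hinv.const_mul R).congr_of_eventuallyEq ?_
  filter_upwards [hev, (isOpen_compl_closedBisector hω hω').mem_nhds hl] with m hm hm'
  have h1 := (hT.isResolventAt hm').sub_eq hR
  have h2 : resolventAt T m * (1 - (m - l) • R) = R := by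
    rw [mul_sub, mul_one, mul_smul_comm, ← h1, sub_sub_cancel]
  rw [← Ring.mul_inverse_cancel_right _ (resolventAt T m) hm, h2]

end Resolvent

/-! ### Convergence of the contour integrals. -/

section PsiCalculus

open Filter Topology

/-- Dominated by `r ^ (s - 1)` near `0` and by `r ^ (-s - 1)` near `∞`; the factor `r⁻¹` comes from
the resolvent bound. -/
theorem integrableOn_rpow_mul_inv {s : ℝ} (hs : 0 < s) :
    IntegrableOn (fun r : ℝ => r ^ s * (1 + r ^ (2 * s))⁻¹ * r⁻¹) (Ioi 0) := by
  have hmeas : ∀ S : Set ℝ, AEStronglyMeasurable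
      (fun r : ℝ => r ^ s * (1 + r ^ (2 * s))⁻¹ * r⁻¹) (volume.restrict S) := fun S =>
    (Measurable.aestronglyMeasurable (by fun_prop))
  have hnn : ∀ r : ℝ, 0 < r → 0 ≤ r ^ s * (1 + r ^ (2 * s))⁻¹ * r⁻¹ := fun r hr => by positivity
  rw [← Ioc_union_Ioi_eq_Ioi zero_le_one]
  refine IntegrableOn.union ?_ ?_
  · have h1 : IntegrableOn (fun r : ℝ => r ^ (s - 1)) (Ioc 0 1) :=
      (intervalIntegrable_iff_integrableOn_Ioc_of_le zero_le_one).1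
        (intervalIntegral.intervalIntegrable_rpow' (by linarith))
    refine h1.mono' (hmeas _) ((ae_restrict_iff' measurableSet_Ioc).2 (Eventually.of_forall ?_))
    intro r hr
    rw [Real.norm_of_nonneg (hnn r hr.1), Real.rpow_sub_one hr.1.ne', div_eq_mul_inv]
    have h2 := Real.rpow_pos_of_pos hr.1 (2 * s)
    refine mul_le_mul_of_nonneg_right (mul_le_of_le_one_right (Real.rpow_nonneg hr.1.le _) ?_)
      (inv_nonneg.2 hr.1.le)
    exact inv_le_one_of_one_le₀ (by linarith)
  · have h1 : IntegrableOn (fun r : ℝ => r ^ (-s - 1)) (Ioi 1) :=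
      integrableOn_Ioi_rpow_of_lt (by linarith) one_pos
    refine h1.mono' (hmeas _) ((ae_restrict_iff' measurableSet_Ioi).2 (Eventually.of_forall ?_))
    intro r hr
    have hr0 : 0 < r := one_pos.trans hr
    rw [Real.norm_of_nonneg (hnn r hr0), Real.rpow_sub_one hr0.ne', div_eq_mul_inv]
    refine mul_le_mul_of_nonneg_right ?_ (inv_nonneg.2 hr0.le)
    have h2 := Real.rpow_pos_of_pos hr0 s
    rw [Real.rpow_neg hr0.le, two_mul, Real.rpow_add hr0, ← div_eq_mul_inv,
      div_le_iff₀ (by positivity), inv_mul_eq_div, le_div_iff₀ h2]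
    linarith

theorem integrable_and_integral_clm_apply {E F : Type*} [NormedAddCommGroup E] [NormedSpace ℂ E]
    [NormedAddCommGroup F] [NormedSpace ℂ F] [CompleteSpace E] [CompleteSpace F] (L : E →L[ℂ] F)
    {f : ℝ → E} {m : Measure ℝ} (hf : Integrable f m) :
    Integrable (fun r => L (f r)) m ∧ ∫ r, L (f r) ∂m = L (∫ r, f r ∂m) :=
  ⟨L.integrable_comp hf, L.integral_comp_comm hf⟩

variable {X : Type*} [NormedAddCommGroup X] [NormedSpace ℂ X]

theorem continuousOn_rayIntegrand [CompleteSpace X] {T : X →ₗ.[ℂ] X} {ω θ μ : ℝ} (hω : 0 ≤ ω)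
    (hωθ : ω < θ) (hθμ : θ < μ) (hμ : μ < Real.pi / 2) (hT : IsBisectorial T ω) {ψ : ℂ → ℂ}
    (hψ : DifferentiableOn ℂ ψ (openBisector μ)) {e : ℂ} (he : e ∈ boundaryDirections θ) :
    ContinuousOn (rayIntegrand T ψ e) (Ioi 0) := by
  have hray : ContinuousOn (fun r : ℝ => (r * e : ℂ)) (Ioi 0) := by fun_prop
  have h1 : ContinuousOn (fun r : ℝ => ψ (r * e)) (Ioi 0) :=
    hψ.continuousOn.comp hray fun r hr => ray_mem_openBisector (hω.trans_lt hωθ) hθμ hμ he hr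
  have h2 : ContinuousOn (fun r : ℝ => resolventAt T (r * e)) (Ioi 0) := fun r hr =>
    ((hT.differentiableAt_resolventAt hω (hωθ.trans (hθμ.trans hμ))
      (ray_notMem_closedBisector hω hωθ (hθμ.trans hμ) he hr)).continuousAt.comp_continuousWithinAt
        (f := fun r : ℝ => (r * e : ℂ)) (hray r hr))
  exact (h1.mul continuousOn_const).smul h2

theorem norm_rayIntegrand_le {T : X →ₗ.[ℂ] X} {θ μ s C M : ℝ} (h0 : 0 < θ)
    (hθμ : θ < μ) (hμ : μ < Real.pi / 2) {ψ : ℂ → ℂ}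
    (hψ : ∀ z ∈ openBisector μ, ‖ψ z‖ ≤ C * ‖z‖ ^ s * (1 + ‖z‖ ^ (2 * s))⁻¹)
    {e : ℂ} (he : e ∈ boundaryDirections θ) {r : ℝ} (hr : 0 < r)
    (hT : ‖resolventAt T (r * e)‖ ≤ M * ‖(r * e : ℂ)‖⁻¹) :
    ‖rayIntegrand T ψ e r‖ ≤ C * M * (r ^ s * (1 + r ^ (2 * s))⁻¹ * r⁻¹) := by
  have hn : ‖(r * e : ℂ)‖ = r := by
    rw [norm_mul, norm_boundaryDirection he, mul_one, Complex.norm_real, Real.norm_of_nonneg hr.le]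
  have h1 := hψ _ (ray_mem_openBisector h0 hθμ hμ he hr)
  rw [hn] at h1 hT
  rw [rayIntegrand, norm_smul, norm_mul, norm_boundaryDirection he, mul_one]
  calc _ ≤ C * r ^ s * (1 + r ^ (2 * s))⁻¹ * (M * r⁻¹) :=
        mul_le_mul h1 hT (norm_nonneg _) ((norm_nonneg _).trans h1)
    _ = _ := by ring

end PsiCalculus

/-! ### Holomorphy of `ψ(DB_z)`. -/

section PsiCalculusFamily

open Filter Topology

variable {X : Type*} [NormedAddCommGroup X] [InnerProductSpace ℂ X] [CompleteSpace X]
  {D : X →ₗ.[ℂ] X} (hD : IsSelfAdjoint D) {U : Set ℂ} (hU : IsOpen U) {B : ℂ → X →L[ℂ] X}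
  (hd : DifferentiableOn ℂ B U) (hB : ∀ z ∈ U, IsUnit (compression (rangeClosure D) (B z)))
  {ω : ℝ} (hω : 0 ≤ ω) (hbis : ∀ z ∈ U, IsBisectorial (precomp D (B z)) ω)

include hD hU hd hB hω hbis

theorem exists_locally_uniform_resolvent_bound {α : ℝ} (hωα : ω < α)
    (hα : α < Real.pi / 2) {c : ℂ} (hc : c ∈ U) :
    ∃ R > 0, Metric.ball c R ⊆ U ∧ ∃ M : ℝ, 0 < M ∧ ∀ z ∈ Metric.ball c R,
      ∀ l ∉ closedBisector α, ‖resolventAt (precomp D (B z)) l‖ ≤ M * ‖l‖⁻¹ := by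
  obtain ⟨C, hC, hCb⟩ := (hbis c hc).2.2 α hωα hα
  obtain ⟨R, hR, hRs⟩ := Metric.mem_nhds_iff.1 (eventually_norm_resolventAt_le hD hU hd hB hc C)
  refine ⟨R, hR, fun z hz => (hRs hz).1, 2 * C + 1, by positivity, fun z hz l hl => ?_⟩
  have hl' : l ∉ closedBisector ω := fun h => hl (closedBisector_subset hω hωα hα h)
  exact (hRs hz).2 l _ _ (ne_zero_of_notMem_closedBisector hl') ((hbis c hc).isResolventAt hl')
    ((hbis z (hRs hz).1).isResolventAt hl') (hCb l hl)

theorem integrable_and_differentiableOn_psiCalculus {θ μ : ℝ} (hωθ : ω < θ) (hθμ : θ < μ)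
    (hμ : μ < Real.pi / 2) {ψ : ℂ → ℂ} (hψ : ψ ∈ Psi μ) :
    (∀ z ∈ U, IntegrableOn (contourIntegrand (precomp D (B z)) θ ψ) (Ioi 0)) ∧
      DifferentiableOn ℂ (fun z => psiCalculus (precomp D (B z)) θ ψ) U := by
  obtain ⟨⟨hψd, -⟩, s, C, hs, hC, hψb⟩ := hψ
  have hθ0 := hω.trans_lt hωθ
  have hθ := hθμ.trans hμ
  have he1 := exp_mem_boundaryDirections hθ0.le hθ
  have he2 := exp_neg_mem_boundaryDirections hθ0.le hθ
  have hcont : ∀ z ∈ U, ContinuousOn (contourIntegrand (precomp D (B z)) θ ψ) (Ioi 0) :=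
    fun z hz => by
      have h := fun e he =>
        continuousOn_rayIntegrand hω hωθ hθμ hμ (hbis z hz) hψd (e := e) he
      exact (((h _ he1).sub (h _ he2)).add (h _ (boundaryDirections_neg he1))).sub
        (h _ (boundaryDirections_neg he2))
  have hdiff : ∀ r ∈ Ioi (0 : ℝ), DifferentiableOn ℂ
      (fun z => contourIntegrand (precomp D (B z)) θ ψ r) U := fun r hr => by
    have h : ∀ e ∈ boundaryDirections θ,
        DifferentiableOn ℂ (fun z => rayIntegrand (precomp D (B z)) ψ e r) U := fun e he =>
      (differentiableOn_resolventAt hD hU hd hB fun z hz => (hbis z hz).isResolventAt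
        (ray_notMem_closedBisector hω hωθ hθ he hr)).const_smul (ψ (r * e) * e)
    exact (((h _ he1).sub (h _ he2)).add (h _ (boundaryDirections_neg he1))).sub
      (h _ (boundaryDirections_neg he2))
  -- The resolvent bound holds only off bisectors larger than that of `ω`; the contour at angle `θ`
  -- stays outside that of `α`.
  obtain ⟨α, hωα, hαθ⟩ := exists_between hωθ
  have hdom : ∀ c ∈ U, ∃ R > 0, Metric.ball c R ⊆ U ∧ ∃ g : ℝ → ℝ,
      Integrable g (volume.restrict (Ioi 0)) ∧ ∀ᵐ r ∂(volume.restrict (Ioi 0)),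
        ∀ z ∈ Metric.ball c R, ‖contourIntegrand (precomp D (B z)) θ ψ r‖ ≤ g r := by
    intro c hc
    obtain ⟨R, hR, hRU, M, hM, hMb⟩ :=
      exists_locally_uniform_resolvent_bound hD hU hd hB hω hbis hωα (hαθ.trans hθ) hc
    refine ⟨R, hR, hRU, _, (integrableOn_rpow_mul_inv hs).const_mul (4 * (C * M)),
      (ae_restrict_iff' measurableSet_Ioi).2 (Eventually.of_forall fun r hr z hz => ?_)⟩
    have h : ∀ e ∈ boundaryDirections θ, ‖rayIntegrand (precomp D (B z)) ψ e r‖ ≤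
        C * M * (r ^ s * (1 + r ^ (2 * s))⁻¹ * r⁻¹) := fun e he =>
      norm_rayIntegrand_le hθ0 hθμ hμ hψb he hr
        (hMb z hz _ (ray_notMem_closedBisector (hω.trans hωα.le) hαθ hθ he hr))
    have g1 := h _ he1
    have g2 := h _ he2
    have g3 := h _ (boundaryDirections_neg he1)
    have g4 := h _ (boundaryDirections_neg he2)
    refine (norm_sub_le _ _).trans ?_
    have k1 := norm_add_le
      (rayIntegrand (precomp D (B z)) ψ (Complex.exp (θ * Complex.I)) r -
        rayIntegrand (precomp D (B z)) ψ (Complex.exp (-(θ * Complex.I))) r)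
      (rayIntegrand (precomp D (B z)) ψ (-Complex.exp (θ * Complex.I)) r)
    have k2 := norm_sub_le (rayIntegrand (precomp D (B z)) ψ (Complex.exp (θ * Complex.I)) r)
      (rayIntegrand (precomp D (B z)) ψ (Complex.exp (-(θ * Complex.I))) r)
    linarith
  obtain ⟨h1, h2⟩ := integrable_and_differentiableOn_integral (m := volume.restrict (Ioi 0))
    (U := U) (F := fun z => contourIntegrand (precomp D (B z)) θ ψ)
    (fun z hz => (hcont z hz).aestronglyMeasurable measurableSet_Ioi)
    ((ae_restrict_iff' measurableSet_Ioi).2 (Eventually.of_forall hdiff)) hdom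
  exact ⟨h1, h2.const_smul (2 * (Real.pi : ℂ) * Complex.I)⁻¹⟩

end PsiCalculusFamily

/-! ### Passage to the part in a subspace containing the range. -/

section PsiCalculusPart

open Filter Topology

variable {X : Type*} [NormedAddCommGroup X] [InnerProductSpace ℂ X] [CompleteSpace X]
  {T : X →ₗ.[ℂ] X} {K : Submodule ℂ X} [CompleteSpace K]
  (hTK : ∀ u v, (u, v) ∈ T.graph → v ∈ K) {ω : ℝ} (hT : IsBisectorial T ω)

include hTK hT

omit [CompleteSpace X] in
theorem resolventAt_part {l : ℂ} (hl : l ∉ closedBisector ω) :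
    resolventAt (part T K) l = compression K (resolventAt T l) :=
  ((hT.isResolventAt hl).compression hTK (ne_zero_of_notMem_closedBisector hl)).resolventAt_eq

omit [CompleteSpace X] in
theorem contourIntegrand_part (hω : 0 ≤ ω) {θ : ℝ} (hωθ : ω < θ) (hθ : θ < Real.pi / 2)
    (ψ : ℂ → ℂ) {r : ℝ} (hr : 0 < r) :
    contourIntegrand (part T K) θ ψ r = compression K (contourIntegrand T θ ψ r) := by
  have hθ0 := hω.trans_lt hωθ
  have he1 := exp_mem_boundaryDirections hθ0.le hθ
  have he2 := exp_neg_mem_boundaryDirections hθ0.le hθ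
  have h : ∀ e ∈ boundaryDirections θ,
      rayIntegrand (part T K) ψ e r = compression K (rayIntegrand T ψ e r) := fun e he => by
    rw [rayIntegrand, rayIntegrand, map_smul,
      resolventAt_part hTK hT (ray_notMem_closedBisector hω hωθ hθ he hr)]
  rw [contourIntegrand, contourIntegrand, h _ he1, h _ he2, h _ (boundaryDirections_neg he1),
    h _ (boundaryDirections_neg he2), map_sub, map_add, map_sub]

theorem integrableOn_contourIntegrand_part (hω : 0 ≤ ω) {θ : ℝ} (hωθ : ω < θ)
    (hθ : θ < Real.pi / 2) {ψ : ℂ → ℂ} (hint : IntegrableOn (contourIntegrand T θ ψ) (Ioi 0)) :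
    IntegrableOn (contourIntegrand (part T K) θ ψ) (Ioi 0) ∧
      psiCalculus (part T K) θ ψ = compression K (psiCalculus T θ ψ) := by
  have heq : ∀ᵐ r ∂(volume.restrict (Ioi (0 : ℝ))),
      contourIntegrand (part T K) θ ψ r = compression K (contourIntegrand T θ ψ r) :=
    (ae_restrict_iff' measurableSet_Ioi).2
      (Eventually.of_forall fun r hr => contourIntegrand_part hTK hT hω hωθ hθ ψ hr)
  constructor
  · exact (integrable_and_integral_clm_apply (E := X →L[ℂ] X) (F := K →L[ℂ] K)
      (compression K) hint).1.congr (heq.mono fun r hr => hr.symm)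
  · rw [psiCalculus, psiCalculus, map_smul, integral_congr_ae heq]
    congr 1
    exact (integrable_and_integral_clm_apply (E := X →L[ℂ] X) (F := K →L[ℂ] K)
      (compression K) hint).2

end PsiCalculusPart

/-! ### The regulariser and its functional calculus. -/

section Regulariser

open Filter Topology

theorem cos_mul_one_add_norm_sq_le {μ : ℝ} (hμ : 0 < μ) (hμ' : μ < Real.pi / 2) {z : ℂ}
    (hz : z ∈ openBisector μ) : Real.cos μ * (1 + ‖z‖ ^ 2) ≤ ‖1 + z ^ 2‖ := by
  have hc : 0 < Real.cos μ := Real.cos_pos_of_mem_Ioo ⟨by linarith [Real.pi_pos], hμ'⟩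
  rw [mem_openBisector_iff hμ hμ', Real.tan_eq_sin_div_cos, div_mul_eq_mul_div,
    lt_div_iff₀ hc] at hz
  have hz0 : z ≠ 0 := by rintro rfl; simp at hz
  have hn : 0 < ‖z‖ := norm_pos_iff.2 hz0
  have hre : Real.cos μ * ‖z‖ ≤ |z.re| := by
    refine abs_le_of_sq_le_sq' ?_ (abs_nonneg _) |>.2
    rw [mul_pow, Complex.sq_norm, Complex.normSq_apply, sq_abs]
    have h1 : (|z.im| * Real.cos μ) ^ 2 ≤ (Real.sin μ * |z.re|) ^ 2 :=
      pow_le_pow_left₀ (by positivity) hz.le 2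
    rw [mul_pow, mul_pow, sq_abs, sq_abs] at h1
    nlinarith [Real.sin_sq_add_cos_sq μ]
  set e : ℂ := (‖z‖⁻¹ : ℝ) * z with he
  have hze : (‖z‖ * e : ℂ) = z := by
    rw [he, ← mul_assoc, ← Complex.ofReal_mul, mul_inv_cancel₀ hn.ne', Complex.ofReal_one, one_mul]
  have he1 : ‖e‖ = 1 := by
    rw [he, norm_mul, Complex.norm_real, Real.norm_of_nonneg (inv_nonneg.2 hn.le),
      inv_mul_cancel₀ hn.ne']
  have h := cos_mul_one_add_sq_le he1 ‖z‖
  rw [hze] at h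
  refine le_trans ?_ h
  gcongr
  rw [he, Complex.re_ofReal_mul, abs_mul, abs_of_pos (inv_pos.2 hn), inv_mul_eq_div, le_div_iff₀ hn]
  exact hre

theorem mul_regulariser_mem_Psi {μ : ℝ} (hμ : 0 < μ) (hμ' : μ < Real.pi / 2) {f : ℂ → ℂ}
    (hf : f ∈ HInfty μ) : (fun z => f z * regulariser z) ∈ Psi μ := by
  obtain ⟨hfd, M, hM⟩ := hf
  have hc : 0 < Real.cos μ := Real.cos_pos_of_mem_Ioo ⟨by linarith [Real.pi_pos], hμ'⟩
  have hlow : ∀ z ∈ openBisector μ, 0 < ‖1 + z ^ 2‖ := fun z hz =>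
    (by positivity : 0 < Real.cos μ * (1 + ‖z‖ ^ 2)).trans_le (cos_mul_one_add_norm_sq_le hμ hμ' hz)
  have hb : ∀ z ∈ openBisector μ,
      ‖f z * regulariser z‖ ≤ (|M| + 1) * (Real.cos μ)⁻¹ * ‖z‖ * (1 + ‖z‖ ^ 2)⁻¹ := fun z hz => by
    rw [regulariser, norm_mul, norm_div, div_eq_mul_inv]
    have h1 : ‖1 + z ^ 2‖⁻¹ ≤ (Real.cos μ)⁻¹ * (1 + ‖z‖ ^ 2)⁻¹ := by
      rw [← mul_inv]
      exact inv_anti₀ (by positivity) (cos_mul_one_add_norm_sq_le hμ hμ' hz)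
    have h2 : ‖f z‖ ≤ |M| + 1 := (hM z hz).trans ((le_abs_self M).trans (by linarith))
    calc _ ≤ (|M| + 1) * (‖z‖ * ((Real.cos μ)⁻¹ * (1 + ‖z‖ ^ 2)⁻¹)) := by gcongr
      _ = _ := by ring
  refine ⟨⟨hfd.mul ?_, (|M| + 1) * (Real.cos μ)⁻¹, fun z hz => (hb z hz).trans ?_⟩, 1,
    (|M| + 1) * (Real.cos μ)⁻¹, one_pos, by positivity, fun z hz => ?_⟩
  · exact differentiableOn_id.div (by fun_prop) fun z hz => norm_pos_iff.1 (hlow z hz)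
  · rw [mul_assoc]
    refine mul_le_of_le_one_right (by positivity) ?_
    rw [← div_eq_mul_inv, div_le_one (by positivity)]
    nlinarith [sq_nonneg (‖z‖ - 1), norm_nonneg z]
  · have := hb z hz
    rw [Real.rpow_one, mul_one, Real.rpow_two]
    exact this

theorem regulariser_mem_Psi {μ : ℝ} (hμ : 0 < μ) (hμ' : μ < Real.pi / 2) : regulariser ∈ Psi μ := by
  have h : (fun _ : ℂ => (1 : ℂ)) ∈ HInfty μ := ⟨differentiableOn_const _, 1, fun z _ => by simp⟩
  simpa using mul_regulariser_mem_Psi hμ hμ' h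

variable {X : Type*} [NormedAddCommGroup X] [NormedSpace ℂ X] [CompleteSpace X]

theorem integrableOn_rayIntegrand {T : X →ₗ.[ℂ] X} {ω θ μ : ℝ} (hω : 0 ≤ ω)
    (hωθ : ω < θ) (hθμ : θ < μ) (hμ : μ < Real.pi / 2) (hT : IsBisectorial T ω) {ψ : ℂ → ℂ}
    (hψ : ψ ∈ Psi μ) {e : ℂ} (he : e ∈ boundaryDirections θ) :
    IntegrableOn (rayIntegrand T ψ e) (Ioi 0) := by
  obtain ⟨⟨hψd, -⟩, s, C, hs, hC, hψb⟩ := hψ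
  obtain ⟨α, hωα, hαθ⟩ := exists_between hωθ
  obtain ⟨M, hM, hMb⟩ := hT.2.2 α hωα (hαθ.trans (hθμ.trans hμ))
  refine ((integrableOn_rpow_mul_inv hs).const_mul (C * M)).mono'
    ((continuousOn_rayIntegrand hω hωθ hθμ hμ hT hψd he).aestronglyMeasurable measurableSet_Ioi)
    ((ae_restrict_iff' measurableSet_Ioi).2 (Eventually.of_forall fun r hr => ?_))
  exact norm_rayIntegrand_le (hω.trans_lt hωθ) hθμ hμ hψb he hr
    (hMb _ (ray_notMem_closedBisector (hω.trans hωα.le) hαθ (hθμ.trans hμ) he hr))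

theorem I_mul_notMem_closedBisector {ω : ℝ} (hω : 0 ≤ ω) (hω' : ω < Real.pi / 2) {a : ℝ}
    (ha : a ≠ 0) : (a * Complex.I : ℂ) ∉ closedBisector ω := by
  rw [mem_closedBisector_iff hω hω']
  simpa using ha

theorem between_rays_notMem_closedBisector {ω θ : ℝ} (hω : 0 ≤ ω) (hωθ : ω < θ)
    (hθ : θ < Real.pi / 2) {ε : ℝ} (hε : |ε| = 1) {φ : ℝ} (hφ : φ ∈ Icc θ (Real.pi - θ)) {r : ℝ}
    (hr : 0 < r) : (ε * (r * Complex.exp (φ * Complex.I)) : ℂ) ∉ closedBisector ω := by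
  have hθ0 := hω.trans_lt hωθ
  have hsin : Real.sin θ ≤ Real.sin φ := by
    rcases le_total φ (Real.pi / 2) with h | h
    · exact Real.sin_le_sin_of_le_of_le_pi_div_two (by linarith) h hφ.1
    · rw [← Real.sin_pi_sub φ]
      exact Real.sin_le_sin_of_le_of_le_pi_div_two (by linarith) (by linarith) (by linarith [hφ.2])
  have hcos : |Real.cos φ| ≤ Real.cos θ := by
    rw [abs_le]
    refine ⟨?_, Real.cos_le_cos_of_nonneg_of_le_pi hθ0.le (by linarith [hφ.2]) hφ.1⟩
    rw [← Real.cos_pi_sub]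
    exact Real.cos_le_cos_of_nonneg_of_le_pi (by linarith [hφ.1]) (by linarith) hφ.2
  have hs0 : 0 < Real.sin θ := Real.sin_pos_of_pos_of_lt_pi hθ0 (by linarith)
  have hε0 : ε ≠ 0 := by rintro rfl; simp at hε
  refine notMem_closedBisector_of_sin_cos hω hωθ hθ ?_ ?_
  · simp [hε0, hr.ne']
  · rw [Complex.re_ofReal_mul, Complex.re_ofReal_mul, Complex.im_ofReal_mul, Complex.im_ofReal_mul,
      Complex.exp_ofReal_mul_I_re, Complex.exp_ofReal_mul_I_im, abs_mul, abs_mul, abs_mul, abs_mul,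
      hε, one_mul, one_mul, abs_of_pos hr, abs_of_nonneg (hs0.le.trans hsin)]
    calc _ ≤ Real.sin φ * (r * Real.cos θ) := by gcongr; exact hs0.le.trans hsin
      _ = _ := by ring

/-- The square on the right is `1 + r² + 2 r sin φ`: in the half-plane of the pole `ε i`, the
opposite pole is far away. -/
theorem one_add_sq_le_norm_add_I_sq {φ r : ℝ} (hr : 0 < r) (hφ : 0 ≤ Real.sin φ) {ε : ℝ}
    (hε : |ε| = 1) :
    1 + r ^ 2 ≤ ‖(ε * (r * Complex.exp (φ * Complex.I)) + ε * Complex.I : ℂ)‖ ^ 2 := by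
  rw [← mul_add, norm_mul, Complex.norm_real, Real.norm_eq_abs, hε, one_mul, Complex.sq_norm,
    Complex.normSq_apply, Complex.add_re, Complex.add_im, Complex.re_ofReal_mul,
    Complex.im_ofReal_mul, Complex.exp_ofReal_mul_I_re, Complex.exp_ofReal_mul_I_im, Complex.I_re,
    Complex.I_im]
  nlinarith [Real.sin_sq_add_cos_sq φ, mul_nonneg hr.le hφ]

/-- The remainder of `regulariser ζ • (T - ζ)⁻¹` after its pole at `p` has been removed. -/
def poleRemainder (T : X →ₗ.[ℂ] X) (p ζ : ℂ) : X →L[ℂ] X :=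
  (ζ + p)⁻¹ • (resolventAt T p + ζ • (resolventAt T p * resolventAt T ζ))

omit [CompleteSpace X] in
-- Since `(R(ζ) - R(p)) / (ζ - p) = R(p) R(ζ)`, subtracting the multiple `p / (1 + ζ²)` of `R(p)`
-- removes the singularity at `p`. What is subtracted has a scalar coefficient, whose ray integrals
-- are explicit.
theorem regulariser_smul_resolventAt {T : X →ₗ.[ℂ] X} {p ζ : ℂ} (hp2 : p ^ 2 = -1)
    (hζ2 : 1 + ζ ^ 2 ≠ 0) (hp : IsResolventAt T p (resolventAt T p))
    (hζ : IsResolventAt T ζ (resolventAt T ζ)) :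
    regulariser ζ • resolventAt T ζ =
      (p * (1 + ζ ^ 2)⁻¹) • resolventAt T p + poleRemainder T p ζ := by
  have hfac : 1 + ζ ^ 2 = (ζ - p) * (ζ + p) := by linear_combination hp2
  have hm : ζ - p ≠ 0 := fun h => hζ2 (by rw [hfac, h, zero_mul])
  have hq : ζ + p ≠ 0 := fun h => hζ2 (by rw [hfac, h, mul_zero])
  have h1 : resolventAt T p * resolventAt T ζ =
      (ζ - p)⁻¹ • (resolventAt T ζ - resolventAt T p) := by
    rw [hζ.sub_eq hp, smul_smul, inv_mul_cancel₀ hm, one_smul, (hp.commute hζ).eq]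
  rw [poleRemainder, h1, regulariser, hfac]
  match_scalars <;> field_simp
  ring

/-- The two rays bound the sector around the half-axis through `ε i`. There the remainder is
holomorphic and decays quadratically, so its two integrals cancel, and the scalar parts leave `2 π
i` times the residue `1 / 2` of the regulariser. -/
theorem integral_ray_sub_eq {T : X →ₗ.[ℂ] X} {ω θ : ℝ} (hω : 0 ≤ ω) (hωθ : ω < θ)
    (hθ : θ < Real.pi / 2) (hT : IsBisectorial T ω) {ε : ℝ} (hε : ε ^ 2 = 1) :
    (∫ r in Ioi (0 : ℝ), rayIntegrand T regulariser (ε * Complex.exp (θ * Complex.I)) r) -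
      ∫ r in Ioi (0 : ℝ), rayIntegrand T regulariser (-(ε * Complex.exp (-(θ * Complex.I)))) r =
      (Complex.I * Real.pi) • resolventAt T (ε * Complex.I) := by
  have hθ0 := hω.trans_lt hωθ
  have hε1 : |ε| = 1 := by
    rw [← sq_abs] at hε
    nlinarith [abs_nonneg ε]
  have hεc : (ε : ℂ) ^ 2 = 1 := by exact_mod_cast hε
  have hε0 : ε ≠ 0 := by rintro rfl; simp at hε1
  have hcos : 0 < Real.cos θ := Real.cos_pos_of_mem_Ioo ⟨by linarith, hθ⟩
  set p : ℂ := ε * Complex.I with hp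
  have hp2 : p ^ 2 = -1 := by rw [hp, mul_pow, hεc, Complex.I_sq, one_mul]
  have hpn : ‖p‖ = 1 := by simp [hp, hε1]
  have hpres := hT.isResolventAt (I_mul_notMem_closedBisector hω (hωθ.trans hθ) hε0)
  rw [← hp] at hpres
  obtain ⟨α, hωα, hαθ⟩ := exists_between hωθ
  obtain ⟨M, hM, hMb⟩ := hT.2.2 α hωα (hαθ.trans hθ)
  obtain ⟨μ, hθμ, hμ⟩ := exists_between hθ
  set N := ‖resolventAt T p‖
  -- the remainder has the same integral over both rays
  have hrot : ∫ r in Ioi (0 : ℝ), (ε * Complex.exp (θ * Complex.I)) •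
        poleRemainder T p (r * (ε * Complex.exp (θ * Complex.I))) =
      ∫ r in Ioi (0 : ℝ), (ε * Complex.exp ((Real.pi - θ : ℝ) * Complex.I)) •
        poleRemainder T p (r * (ε * Complex.exp ((Real.pi - θ : ℝ) * Complex.I))) := by
    have hsin : ∀ φ ∈ Icc θ (Real.pi - θ), 0 ≤ Real.sin φ := fun φ hφ =>
      Real.sin_nonneg_of_nonneg_of_le_pi (hθ0.le.trans hφ.1) (by linarith [hφ.2])
    refine integral_ray_eq (g := poleRemainder T p) (C := 2 * (N + N * M + (1 + N) * M))
      (by simp [hε1]) (by linarith) (fun r hr φ hφ => ?_) fun r hr φ hφ => ?_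
    · have hζ := between_rays_notMem_closedBisector hω hωθ hθ hε1 hφ hr
      have hlow := one_add_sq_le_norm_add_I_sq hr (hsin φ hφ) hε1
      have h0 : (ε * (r * Complex.exp (φ * Complex.I)) + p : ℂ) ≠ 0 := fun h => by
        rw [← hp, h, norm_zero] at hlow
        nlinarith
      have hd := hT.differentiableAt_resolventAt hω (hωθ.trans hθ) hζ
      have h1 : DifferentiableAt ℂ (fun ζ : ℂ => (ζ + p)⁻¹) (ε * (r * Complex.exp (φ * Complex.I))) :=
        DifferentiableAt.inv (by fun_prop) h0
      exact h1.smul ((differentiableAt_id.smul (hd.const_mul (resolventAt T p))).const_add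
        (resolventAt T p))
    · have hζ := between_rays_notMem_closedBisector (hω.trans hωα.le) hαθ hθ hε1 hφ hr
      have hζω := between_rays_notMem_closedBisector hω hωθ hθ hε1 hφ hr
      have hlow := one_add_sq_le_norm_add_I_sq hr (hsin φ hφ) hε1
      have hζres := hT.isResolventAt hζω
      have hRn := hMb _ hζ
      have hζn : ‖(ε * (r * Complex.exp (φ * Complex.I)) : ℂ)‖ = r := by
        simp [hε1, Complex.norm_exp_ofReal_mul_I, abs_of_pos hr]
      rw [← hp] at hlow
      set ζ : ℂ := ε * (r * Complex.exp (φ * Complex.I))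
      rw [hζn] at hRn
      set S := resolventAt T ζ
      rw [poleRemainder, norm_smul, norm_inv]
      have hinv : ∀ x : ℝ, 0 < x → x ^ 2 ≤ 1 + r ^ 2 → ‖ζ + p‖⁻¹ ≤ x⁻¹ := fun x hx h =>
        inv_anti₀ hx (abs_le_of_sq_le_sq' (h.trans hlow) (norm_nonneg _) |>.2)
      have hN : 0 ≤ N := norm_nonneg _
      have hRS : ‖resolventAt T p * S‖ ≤ N * (M * r⁻¹) := (norm_mul_le _ _).trans (by gcongr)
      -- Near `0` the remainder is merely bounded; for `r ≥ 1` each of its two factors must supply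
      -- one power of `r⁻¹`.
      rcases le_total r 1 with h1 | h1
      · have hA : ‖resolventAt T p + ζ • (resolventAt T p * S)‖ ≤ N + N * M := by
          refine (norm_add_le _ _).trans ?_
          rw [norm_smul, hζn]
          have : r * ‖resolventAt T p * S‖ ≤ r * (N * (M * r⁻¹)) := by gcongr
          have h2 : r * (N * (M * r⁻¹)) = N * M := by field_simp
          linarith
        have hB := hinv 1 one_pos (by nlinarith)
        calc _ ≤ (1 : ℝ)⁻¹ * (N + N * M) := by gcongr
          _ ≤ 2 * (N + N * M + (1 + N) * M) * (1 + r ^ 2)⁻¹ := by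
            rw [inv_one, one_mul, ← div_eq_mul_inv, le_div_iff₀ (by positivity)]
            have hr2 : r ^ 2 ≤ 1 := by nlinarith
            have : 0 ≤ N + N * M := by positivity
            have : 0 ≤ (1 + N) * M := by positivity
            nlinarith
      · have hA : ‖resolventAt T p + ζ • (resolventAt T p * S)‖ ≤ (1 + N) * M * r⁻¹ := by
          -- The resolvent identity uncovers decay that the separate terms on the left do not have.
          have heq : resolventAt T p + ζ • (resolventAt T p * S) =
              S + p • (resolventAt T p * S) := by
            have := hζres.sub_eq hpres
            rw [(hζres.commute hpres).eq] at this
            linear_combination (norm := module) -this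
          rw [heq]
          refine (norm_add_le _ _).trans ?_
          rw [norm_smul, hpn, one_mul]
          calc _ ≤ M * r⁻¹ + N * (M * r⁻¹) := add_le_add hRn hRS
            _ = _ := by ring
        have hB := hinv r hr (by nlinarith)
        calc _ ≤ r⁻¹ * ((1 + N) * M * r⁻¹) := by gcongr
          _ = (1 + N) * M / r ^ 2 := by field_simp
          _ ≤ 2 * (N + N * M + (1 + N) * M) * (1 + r ^ 2)⁻¹ := by
            rw [← div_eq_mul_inv, div_le_div_iff₀ (by positivity) (by positivity)]
            have hr2 : 1 ≤ r ^ 2 := by nlinarith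
            have h3 : 0 ≤ N + N * M := by positivity
            have h4 : 0 ≤ (1 + N) * M := by positivity
            nlinarith [mul_nonneg h3 (by positivity : 0 ≤ r ^ 2)]
  -- decomposition of the integrand on each ray
  have hsplit : ∀ e ∈ boundaryDirections θ, ∫ r in Ioi (0 : ℝ), rayIntegrand T regulariser e r =
      (p * ∫ r in Ioi (0 : ℝ), e • (1 + (r * e : ℂ) ^ 2)⁻¹) • resolventAt T p +
        ∫ r in Ioi (0 : ℝ), e • poleRemainder T p (r * e) := by
    intro e he
    have hray := integrableOn_rayIntegrand hω hωθ hθμ hμ hT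
      (regulariser_mem_Psi (hθ0.trans hθμ) hμ) he
    have hlow : ∀ r : ℝ, Real.cos θ * (1 + r ^ 2) ≤ ‖1 + (r * e : ℂ) ^ 2‖ := fun r => by
      rw [← he.1]
      exact cos_mul_one_add_sq_le (norm_boundaryDirection he) r
    have hne : ∀ r : ℝ, 1 + (r * e : ℂ) ^ 2 ≠ 0 := fun r => norm_pos_iff.1
      ((by positivity : 0 < Real.cos θ * (1 + r ^ 2)).trans_le (hlow r))
    have hsc : Integrable (fun r : ℝ => e • (1 + (r * e : ℂ) ^ 2)⁻¹) := by
      refine (integrable_inv_one_add_sq.const_mul (Real.cos θ)⁻¹).mono' ?_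
        (Eventually.of_forall fun r => ?_)
      · exact Continuous.aestronglyMeasurable (Continuous.const_smul
          (Continuous.inv₀ (by fun_prop) hne) e)
      · rw [norm_smul, norm_boundaryDirection he, one_mul, norm_inv, ← mul_inv]
        exact inv_anti₀ (by positivity) (hlow r)
    have hsc' : IntegrableOn (fun r : ℝ => (p * (e • (1 + (r * e : ℂ) ^ 2)⁻¹)) • resolventAt T p)
        (Ioi 0) := ((hsc.const_mul p).smul_const _).integrableOn
    have heq : ∀ r ∈ Ioi (0 : ℝ), rayIntegrand T regulariser e r =
        (p * (e • (1 + (r * e : ℂ) ^ 2)⁻¹)) • resolventAt T p + e • poleRemainder T p (r * e) :=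
      fun r hr => by
        rw [rayIntegrand, mul_comm, mul_smul, regulariser_smul_resolventAt hp2 (hne r) hpres
          (hT.isResolventAt (ray_notMem_closedBisector hω hωθ hθ he hr)), smul_add, smul_smul,
          smul_eq_mul]
        ring_nf
    have hrem : IntegrableOn (fun r : ℝ => e • poleRemainder T p (r * e)) (Ioi 0) :=
      (hray.sub hsc').congr ((ae_restrict_iff' measurableSet_Ioi).2 (Eventually.of_forall
        fun r hr => by rw [Pi.sub_apply, heq r hr, add_sub_cancel_left]))
    rw [setIntegral_congr_fun measurableSet_Ioi heq, integral_add hsc' hrem, integral_smul_const,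
      integral_const_mul]
  have he1 : (ε * Complex.exp (θ * Complex.I) : ℂ) ∈ boundaryDirections θ := by
    have := exp_mem_boundaryDirections hθ0.le hθ
    simpa [boundaryDirections, abs_mul, hε1] using this
  have he2 : (-(ε * Complex.exp (-(θ * Complex.I))) : ℂ) ∈ boundaryDirections θ := by
    have := exp_neg_mem_boundaryDirections hθ0.le hθ
    refine boundaryDirections_neg ?_
    simpa [boundaryDirections, abs_mul, hε1] using this
  have hexp : (ε * Complex.exp ((Real.pi - θ : ℝ) * Complex.I) : ℂ) =
      -(ε * Complex.exp (-(θ * Complex.I))) := by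
    rw [Complex.ofReal_sub, sub_mul, sub_eq_add_neg, Complex.exp_add, Complex.exp_pi_mul_I]
    ring
  have hS1 := integral_ray_inv_one_add_sq hεc (θ := θ) (by rwa [abs_of_pos hθ0])
  have hS2 := integral_ray_inv_one_add_sq (ε := -ε) (by rw [neg_sq, hεc]) (θ := -θ)
    (by rwa [abs_neg, abs_of_pos hθ0])
  simp only [Complex.ofReal_neg, neg_mul] at hS2
  rw [hsplit _ he1, hsplit _ he2, hS1, hS2, hrot, hexp, add_sub_add_right_eq_sub, ← sub_smul]
  congr 1
  rw [hp]
  linear_combination (Complex.I * Real.pi) * hεc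

/-- The four rays are paired across the imaginary axis, not within each sector, so that each pair
encloses one pole. -/
theorem psiCalculus_regulariser {T : X →ₗ.[ℂ] X} {ω θ : ℝ} (hω : 0 ≤ ω) (hωθ : ω < θ)
    (hθ : θ < Real.pi / 2) (hT : IsBisectorial T ω) :
    psiCalculus T θ regulariser =
      (2⁻¹ : ℂ) • (resolventAt T Complex.I + resolventAt T (-Complex.I)) := by
  have hθ0 := hω.trans_lt hωθ
  obtain ⟨μ, hθμ, hμ⟩ := exists_between hθ
  have hray := fun e he => integrableOn_rayIntegrand hω hωθ hθμ hμ hT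
      (regulariser_mem_Psi (hθ0.trans hθμ) hμ) (e := e) he
  have he1 := exp_mem_boundaryDirections hθ0.le hθ
  have he2 := exp_neg_mem_boundaryDirections hθ0.le hθ
  have h1 := integral_ray_sub_eq hω hωθ hθ hT (ε := 1) (by norm_num)
  have h2 := integral_ray_sub_eq hω hωθ hθ hT (ε := -1) (by norm_num)
  simp only [Complex.ofReal_one, Complex.ofReal_neg, one_mul, neg_mul, neg_neg] at h1 h2
  have h3 : ∫ r in Ioi (0 : ℝ), contourIntegrand T θ regulariser r =
      (Complex.I * Real.pi) • resolventAt T Complex.I +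
        (Complex.I * Real.pi) • resolventAt T (-Complex.I) := by
    rw [← h1, ← h2]
    simp only [contourIntegrand]
    rw [integral_sub, integral_add, integral_sub]
    · abel
    · exact hray _ he1
    · exact hray _ he2
    · exact (hray _ he1).sub (hray _ he2)
    · exact hray _ (boundaryDirections_neg he1)
    · exact ((hray _ he1).sub (hray _ he2)).add (hray _ (boundaryDirections_neg he1))
    · exact hray _ (boundaryDirections_neg he2)
  rw [psiCalculus, h3, ← smul_add, smul_smul]
  congr 1
  have hpi : (Real.pi : ℂ) ≠ 0 := Complex.ofReal_ne_zero.2 Real.pi_ne_zero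
  have hI := Complex.I_ne_zero
  field_simp

end Regulariser

/-! ### Reducing `f(T)` to `ψ`-calculus and resolvents. -/

section HInftyCalculus

open Filter Topology

variable {Y : Type*} [NormedAddCommGroup Y] [NormedSpace ℂ Y]

theorem tendsto_zero_of_dense {A : ℕ → Y →L[ℂ] Y} {M : ℝ} (hM : ∀ k, ‖A k‖ ≤ M) {S : Set Y}
    (hS : Dense S) (hA : ∀ x ∈ S, Tendsto (fun k => A k x) atTop (𝓝 0)) (x : Y) :
    Tendsto (fun k => A k x) atTop (𝓝 0) := by
  have hM0 : 0 ≤ M := (norm_nonneg _).trans (hM 0)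
  rw [Metric.tendsto_nhds]
  intro ε hε
  obtain ⟨y, hyS, hy⟩ := Metric.dense_iff.1 hS x (ε / (2 * (M + 1))) (by positivity)
  filter_upwards [Metric.tendsto_nhds.1 (hA y hy) (ε / 2) (half_pos hε)] with k hk
  rw [dist_zero_right] at hk ⊢
  rw [Metric.mem_ball, dist_comm, dist_eq_norm, lt_div_iff₀ (by positivity)] at hyS
  have h1 : ‖A k (x - y)‖ ≤ M * ‖x - y‖ := (A k).le_of_opNorm_le (hM k) _
  have h2 : ‖A k x‖ ≤ ‖A k (x - y)‖ + ‖A k y‖ := by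
    simpa using norm_add_le (A k (x - y)) (A k y)
  nlinarith [norm_nonneg (x - y)]

/-- `(1 + b T)⁻¹`. -/
def yosida (T : Y →ₗ.[ℂ] Y) (b : ℂ) : Y →L[ℂ] Y := b⁻¹ • resolventAt T (-b⁻¹)

/-- `T (T + b)⁻¹ (1 + b T)⁻¹`. -/
def approxId (T : Y →ₗ.[ℂ] Y) (b : ℂ) : Y →L[ℂ] Y :=
  yosida T b - b • (resolventAt T (-b) * yosida T b)

/-- `(T ^ 2 + 1) (T + b)⁻¹ (1 + b T)⁻¹`. -/
def approxQuotient (T : Y →ₗ.[ℂ] Y) (b : ℂ) : Y →L[ℂ] Y :=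
  b⁻¹ • (1 - yosida T b) - b • approxId T b + resolventAt T (-b) * yosida T b

/-- With `x = T v` and `w = T² v` this is `T (1 + T²)⁻¹ (T² + 1) v = T v`, through partial
fractions. -/
theorem half_resolvent_sum_apply {T : Y →ₗ.[ℂ] Y} {R S : Y →L[ℂ] Y}
    (hR : IsResolventAt T Complex.I R) (hS : IsResolventAt T (-Complex.I) S) {v x w : Y}
    (hv : (v, x) ∈ T.graph) (hx : (x, w) ∈ T.graph) :
    (2⁻¹ : ℂ) • (R + S) (w + v) = x := by
  have h1 := hR.apply_graph _ _ (T.graph.add_mem hx (T.graph.smul_mem Complex.I hv))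
  have h2 := hS.apply_graph _ _ (T.graph.add_mem hx (T.graph.smul_mem (-Complex.I) hv))
  simp only [Prod.smul_mk, map_add, map_smul, smul_add, smul_smul, neg_mul, mul_neg, neg_neg,
    Complex.I_mul_I] at h1 h2
  rw [add_apply, map_add, map_add]
  linear_combination (norm := module) (2⁻¹ : ℂ) • h1 + (2⁻¹ : ℂ) • h2

/-- For `v = (T + b)⁻¹ (1 + b T)⁻¹ u`, `approxId` gives `T v` and `approxQuotient` gives `T² v + v`.
-/
theorem half_resolvent_sum_mul_approxQuotient {T : Y →ₗ.[ℂ] Y} {R S : Y →L[ℂ] Y}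
    (hR : IsResolventAt T Complex.I R) (hS : IsResolventAt T (-Complex.I) S) {b : ℂ}
    (h1 : IsResolventAt T (-b) (resolventAt T (-b)))
    (h2 : IsResolventAt T (-b⁻¹) (resolventAt T (-b⁻¹))) :
    ((2⁻¹ : ℂ) • (R + S)) * approxQuotient T b = approxId T b := by
  ext u
  have hy : (yosida T b u, b⁻¹ • (u - yosida T b u)) ∈ T.graph := by
    have := T.graph.smul_mem b⁻¹ (h2.mem_graph u)
    have h3 : b⁻¹ • (u + -b⁻¹ • resolventAt T (-b⁻¹) u) = b⁻¹ • (u - yosida T b u) := by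
      rw [yosida, smul_apply]
      module
    rw [Prod.smul_mk, h3] at this
    exact this
  have hv := h1.mem_graph (yosida T b u)
  have hx : (approxId T b u, b⁻¹ • (u - yosida T b u) - b • approxId T b u) ∈ T.graph := by
    have h4 : yosida T b u + -b • resolventAt T (-b) (yosida T b u) = approxId T b u := by
      change _ = yosida T b u - b • resolventAt T (-b) (yosida T b u)
      module
    have := T.graph.sub_mem hy (T.graph.smul_mem b hv)
    rw [h4] at this
    exact this
  have hv' : (resolventAt T (-b) (yosida T b u), approxId T b u) ∈ T.graph := by
    convert hv using 2
    change yosida T b u - b • resolventAt T (-b) (yosida T b u) = _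
    module
  exact half_resolvent_sum_apply hR hS hv' hx

/-- If `R u = -S u`, adding the two graph points gives `u + i R u = 0`, that is `T R u = 0`. -/
theorem half_resolvent_sum_injective {T : Y →ₗ.[ℂ] Y} {R S : Y →L[ℂ] Y}
    (hR : IsResolventAt T Complex.I R) (hS : IsResolventAt T (-Complex.I) S)
    (hT : ∀ u, (u, 0) ∈ T.graph → u = 0) : Function.Injective ((2⁻¹ : ℂ) • (R + S)) := by
  refine (injective_iff_map_eq_zero _).2 fun u hu => ?_
  have h0 : R u + S u = 0 := by
    have : (2⁻¹ : ℂ) • (R u + S u) = 0 := hu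
    exact (smul_eq_zero.1 this).resolve_left (by norm_num)
  have hRS : S u = -R u := (neg_eq_of_add_eq_zero_right h0).symm
  have h1 := T.graph.add_mem (hR.mem_graph u) (hS.mem_graph u)
  rw [hRS] at h1
  have h2 := LinearPMap.graph_fst_eq_zero_snd (f := T) h1 (by simp)
  have h3 : u + Complex.I • R u = 0 := by
    have : (2 : ℂ) • (u + Complex.I • R u) = 0 := by
      rw [← h2]
      module
    exact (smul_eq_zero.1 this).resolve_left (by norm_num)
  have h4 := hR.mem_graph u
  rw [h3] at h4
  rw [hT _ h4] at h3
  simpa using h3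

theorem psi_comp_eq_of_eqBounded {T : Y →ₗ.[ℂ] Y} {θ : ℝ} {f : ℂ → ℂ} {F : Y →L[ℂ] Y}
    (hinj : Function.Injective (psiCalculus T θ regulariser))
    (hF : EqBounded (hInftyCalculus T θ f) F) :
    psiCalculus T θ regulariser * F = psiCalculus T θ (fun z => f z * regulariser z) := by
  ext u
  have hker : LinearMap.ker
      ((psiCalculus T θ regulariser : Y →ₗ[ℂ] Y).toPMap ⊤).toFun = ⊥ := by
    refine LinearMap.ker_eq_bot'.2 fun x hx => Subtype.ext ?_
    exact (injective_iff_map_eq_zero _).1 hinj _ hx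
  have h1 : (u, F u) ∈ (hInftyCalculus T θ f).graph := by
    rw [hF]
    exact ((F : Y →ₗ[ℂ] Y).toPMap ⊤).mem_graph ⟨u, Submodule.mem_top⟩
  rw [hInftyCalculus, mem_precomp_graph_iff, LinearPMap.inverse_graph hker] at h1
  obtain ⟨⟨a, c⟩, hac, h2⟩ := h1
  obtain ⟨y, rfl, rfl⟩ := (LinearPMap.mem_graph_iff _).1 hac
  have h3 : psiCalculus T θ regulariser y =
      psiCalculus T θ (fun z => f z * regulariser z) u := congrArg Prod.fst h2
  have h4 : (y : Y) = F u := congrArg Prod.snd h2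
  rw [← h3, h4]
  rfl

theorem commute_psiCalculus [CompleteSpace Y] {T : Y →ₗ.[ℂ] Y} {ω θ μ : ℝ} (hω : 0 ≤ ω)
    (hωθ : ω < θ) (hθμ : θ < μ) (hμ : μ < Real.pi / 2) (hT : IsBisectorial T ω) {ψ : ℂ → ℂ}
    (hψ : ψ ∈ Psi μ) {A : Y →L[ℂ] Y}
    (hA : ∀ l ∉ closedBisector ω, Commute A (resolventAt T l)) :
    Commute A (psiCalculus T θ ψ) := by
  have hθ0 := hω.trans_lt hωθ
  have hθ := hθμ.trans hμ
  have hray := fun e he => integrableOn_rayIntegrand hω hωθ hθμ hμ hT hψ (e := e) he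
  have he1 := exp_mem_boundaryDirections hθ0.le hθ
  have he2 := exp_neg_mem_boundaryDirections hθ0.le hθ
  have hint : IntegrableOn (contourIntegrand T θ ψ) (Ioi 0) :=
    (((hray _ he1).sub (hray _ he2)).add (hray _ (boundaryDirections_neg he1))).sub
      (hray _ (boundaryDirections_neg he2))
  have hc : ∀ r ∈ Ioi (0 : ℝ), A * contourIntegrand T θ ψ r = contourIntegrand T θ ψ r * A :=
    fun r hr => by
      have h : ∀ e ∈ boundaryDirections θ, Commute A (rayIntegrand T ψ e r) := fun e he =>
        (hA _ (ray_notMem_closedBisector hω hωθ hθ he hr)).smul_right _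
      exact (((h _ he1).sub_right (h _ he2)).add_right (h _ (boundaryDirections_neg he1))).sub_right
        (h _ (boundaryDirections_neg he2))
  refine Commute.smul_right ?_ _
  change A * _ = _ * A
  rw [← integral_const_mul_of_integrable hint, ← integral_mul_const_of_integrable hint]
  exact setIntegral_congr_fun measurableSet_Ioi hc

/-- The definition only yields `ψ₀(T) F = (f ψ₀)(T)`. Commutation and injectivity of `ψ₀(T)` move
`F` to the other side, and `approxId` factors through `ψ₀(T)`. -/
theorem mul_approxId_eq [CompleteSpace Y] {T : Y →ₗ.[ℂ] Y} {ω θ μ : ℝ} (hω : 0 ≤ ω)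
    (hωθ : ω < θ) (hθμ : θ < μ) (hμ : μ < Real.pi / 2) (hT : IsBisectorial T ω)
    (hinj : ∀ u, (u, 0) ∈ T.graph → u = 0) {f : ℂ → ℂ} (hf : f ∈ HInfty μ) {F : Y →L[ℂ] Y}
    (hF : EqBounded (hInftyCalculus T θ f) F) {b : ℂ} (hb : -b ∉ closedBisector ω)
    (hb' : -b⁻¹ ∉ closedBisector ω) :
    F * approxId T b = psiCalculus T θ (fun z => f z * regulariser z) * approxQuotient T b := by
  have hθ := hθμ.trans hμ
  have hI := I_mul_notMem_closedBisector hω (hωθ.trans hθ) one_ne_zero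
  have hI' := I_mul_notMem_closedBisector hω (hωθ.trans hθ) (neg_ne_zero.2 one_ne_zero)
  rw [Complex.ofReal_one, one_mul] at hI
  rw [Complex.ofReal_neg, Complex.ofReal_one, neg_one_mul] at hI'
  have hR := hT.isResolventAt hI
  have hS := hT.isResolventAt hI'
  have hG := psiCalculus_regulariser hω hωθ hθ hT
  have hGinj := half_resolvent_sum_injective hR hS hinj
  rw [← hG] at hGinj
  have hGF := psi_comp_eq_of_eqBounded hGinj hF
  have hcomm : Commute (psiCalculus T θ regulariser)
      (psiCalculus T θ (fun z => f z * regulariser z)) := by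
    refine commute_psiCalculus hω hωθ hθμ hμ hT
      (mul_regulariser_mem_Psi (hω.trans_lt (hωθ.trans hθμ)) hμ hf) fun l hl => ?_
    rw [hG]
    exact ((hR.commute (hT.isResolventAt hl)).add_left
      (hS.commute (hT.isResolventAt hl))).smul_left _
  have hFG : F * psiCalculus T θ regulariser =
      psiCalculus T θ (fun z => f z * regulariser z) := by
    ext u
    apply hGinj
    have h1 := DFunLike.congr_fun hGF (psiCalculus T θ regulariser u)
    have h2 := DFunLike.congr_fun hcomm.eq u
    exact h1.trans h2.symm
  rw [← half_resolvent_sum_mul_approxQuotient hR hS (hT.isResolventAt hb)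
    (hT.isResolventAt hb'), ← hG, ← mul_assoc, hFG]

theorem norm_yosida_le {T : Y →ₗ.[ℂ] Y} {b : ℂ} (hb : b ≠ 0) {M : ℝ}
    (h : ‖resolventAt T (-b⁻¹)‖ ≤ M * ‖-b⁻¹‖⁻¹) : ‖yosida T b‖ ≤ M := by
  have hb0 : 0 < ‖b‖ := norm_pos_iff.2 hb
  rw [norm_neg, norm_inv, inv_inv] at h
  rw [yosida, norm_smul, norm_inv, inv_mul_le_iff₀ hb0, mul_comm]
  exact h

theorem norm_smul_resolventAt_neg_le {T : Y →ₗ.[ℂ] Y} {b : ℂ} (hb : b ≠ 0) {M : ℝ}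
    (h : ‖resolventAt T (-b)‖ ≤ M * ‖-b‖⁻¹) : ‖b • resolventAt T (-b)‖ ≤ M := by
  have hb0 : 0 < ‖b‖ := norm_pos_iff.2 hb
  rw [norm_neg, ← div_eq_mul_inv, le_div_iff₀ hb0, mul_comm] at h
  rwa [norm_smul]

theorem norm_approxId_le {T : Y →ₗ.[ℂ] Y} {b : ℂ} (hb : b ≠ 0) {M : ℝ}
    (h : ‖resolventAt T (-b)‖ ≤ M * ‖-b‖⁻¹) (h' : ‖resolventAt T (-b⁻¹)‖ ≤ M * ‖-b⁻¹‖⁻¹) :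
    ‖approxId T b‖ ≤ M + M * M := by
  have h1 := norm_yosida_le hb h'
  have h2 := norm_smul_resolventAt_neg_le hb h
  rw [approxId, ← smul_mul_assoc]
  refine (norm_sub_le _ _).trans (add_le_add h1 ((norm_mul_le _ _).trans ?_))
  exact mul_le_mul h2 h1 (norm_nonneg _) ((norm_nonneg _).trans h2)

/-- By density and uniform bounds it suffices that `(1 + b T)⁻¹ → 1` on the domain and `b (T + b)⁻¹
→ 0` on the range. -/
theorem tendsto_approxId {T : Y →ₗ.[ℂ] Y} {b : ℕ → ℂ} (hb0 : ∀ k, b k ≠ 0)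
    (hb : Tendsto b atTop (𝓝 0)) {M : ℝ}
    (hr : ∀ k, IsResolventAt T (-b k) (resolventAt T (-b k)))
    (hr' : ∀ k, IsResolventAt T (-(b k)⁻¹) (resolventAt T (-(b k)⁻¹)))
    (h : ∀ k, ‖resolventAt T (-b k)‖ ≤ M * ‖-b k‖⁻¹)
    (h' : ∀ k, ‖resolventAt T (-(b k)⁻¹)‖ ≤ M * ‖-(b k)⁻¹‖⁻¹)
    (hdom : Dense {u | ∃ v, (u, v) ∈ T.graph}) (hran : Dense {v | ∃ u, (u, v) ∈ T.graph}) (u : Y) :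
    Tendsto (fun k => approxId T (b k) u) atTop (𝓝 u) := by
  have hJ := fun k => norm_yosida_le (hb0 k) (h' k)
  have hS := fun k => norm_smul_resolventAt_neg_le (hb0 k) (h k)
  have hM0 : 0 ≤ M := (norm_nonneg _).trans (hJ 0)
  have hbn : Tendsto (fun k => ‖b k‖) atTop (𝓝 0) := by simpa using hb.norm
  have hJ1 : ∀ k, ‖yosida T (b k) - 1‖ ≤ M + 1 := fun k =>
    (norm_sub_le _ _).trans (add_le_add (hJ k) ContinuousLinearMap.norm_id_le)
  have hJlim : ∀ u, Tendsto (fun k => (yosida T (b k) - 1) u) atTop (𝓝 0) := by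
    refine tendsto_zero_of_dense hJ1 hdom fun x ⟨y, hxy⟩ => ?_
    refine squeeze_zero_norm (a := fun k => ‖b k‖ * (M * ‖y‖)) (fun k => ?_) (by
      simpa using hbn.mul_const (M * ‖y‖))
    have h1 := (hr' k).apply_graph _ _ hxy
    have h2 : (yosida T (b k) - 1) x = -(b k • yosida T (b k) y) := by
      have h3 : b k • yosida T (b k) y = resolventAt T (-(b k)⁻¹) y := by
        rw [yosida, smul_apply, smul_smul, mul_inv_cancel₀ (hb0 k), one_smul]
      rw [h3, h1, sub_apply, one_apply_eq_self, yosida, smul_apply]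
      module
    rw [h2, norm_neg, norm_smul]
    gcongr
    exact (yosida T (b k)).le_of_opNorm_le (hJ k) y
  have hSlim : ∀ u, Tendsto (fun k => (b k • resolventAt T (-b k)) u) atTop (𝓝 0) := by
    refine tendsto_zero_of_dense hS hran fun y ⟨x, hxy⟩ => ?_
    refine squeeze_zero_norm (a := fun k => ‖b k‖ * (‖x‖ + M * ‖x‖)) (fun k => ?_) (by
      simpa using hbn.mul_const (‖x‖ + M * ‖x‖))
    have h2 : (b k • resolventAt T (-b k)) y = b k • (x - (b k • resolventAt T (-b k)) x) := by
      rw [smul_apply, (hr k).apply_graph _ _ hxy, smul_apply]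
      module
    rw [h2, norm_smul]
    gcongr
    exact (norm_sub_le _ _).trans (add_le_add_right ((b k • resolventAt T (-b k)).le_of_opNorm_le
      (hS k) x) _)
  -- With `J = (1 + b T)⁻¹` and `S = b (T + b)⁻¹`, `J - S J = (J - 1) - S (J - 1) - S + 1`.
  have hlim : Tendsto (fun k => (yosida T (b k) - 1) u -
      (b k • resolventAt T (-b k)) ((yosida T (b k) - 1) u) -
        (b k • resolventAt T (-b k)) u + u) atTop (𝓝 (0 - 0 - 0 + u)) := by
    refine (((hJlim u).sub ?_).sub (hSlim u)).add_const u
    refine squeeze_zero_norm (fun k => (b k • resolventAt T (-b k)).le_of_opNorm_le (hS k) _) ?_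
    simpa using ((hJlim u).norm.const_mul M)
  rw [sub_zero, sub_zero, zero_add] at hlim
  refine hlim.congr fun k => ?_
  simp only [approxId, sub_apply, smul_apply, one_apply_eq_self, mul_apply_eq_comp,
    map_sub]
  module

end HInftyCalculus

/-! ### Bisectoriality of the part. -/

section Part

variable {X : Type*} [NormedAddCommGroup X] [InnerProductSpace ℂ X]

theorem norm_compression_le (K : Submodule ℂ X) [CompleteSpace K] (A : X →L[ℂ] X) :
    ‖compression K A‖ ≤ ‖A‖ := by
  refine ContinuousLinearMap.opNorm_le_bound _ (norm_nonneg A) fun u => ?_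
  rw [compression_apply]
  exact (K.norm_orthogonalProjectionOnto_apply_le _).trans (A.le_opNorm _)

theorem isBisectorial_part {T : X →ₗ.[ℂ] X} {K : Submodule ℂ X} [CompleteSpace K]
    (hTK : ∀ u v, (u, v) ∈ T.graph → v ∈ K) {ω : ℝ} (hω : 0 ≤ ω) (hT : IsBisectorial T ω) :
    IsBisectorial (part T K) ω := by
  refine ⟨?_, fun l hl => ?_, fun μ hωμ hμ => ?_⟩
  · have : ((part T K).graph : Set (K × K)) =
        (fun p : K × K => ((p.1 : X), (p.2 : X))) ⁻¹' T.graph := by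
      ext ⟨u, v⟩
      exact mem_part_graph_iff
    rw [LinearPMap.IsClosed, this]
    exact IsClosed.preimage (by fun_prop) hT.1
  · by_contra hl'
    exact hl ⟨_, hasBoundedInverse_affine_iff.2 ((hT.isResolventAt hl').compression hTK
      (ne_zero_of_notMem_closedBisector hl'))⟩
  · obtain ⟨C, hC, hCb⟩ := hT.2.2 μ hωμ hμ
    refine ⟨C, hC, fun l hl => ?_⟩
    rw [resolventAt_part hTK hT fun h => hl (closedBisector_subset hω hωμ hμ h)]
    exact (norm_compression_le K _).trans (hCb l hl)

end Part

/-! ### Holomorphy of the families. -/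

section Main

open Filter Topology

variable {X : Type*} [NormedAddCommGroup X] [InnerProductSpace ℂ X] [CompleteSpace X]
  {D : X →ₗ.[ℂ] X}

omit [CompleteSpace X] in
theorem mem_rangeClosure_of_mem_precomp_graph (D : X →ₗ.[ℂ] X) (B : X →L[ℂ] X) (u v : X)
    (h : (u, v) ∈ (precomp D B).graph) : v ∈ rangeClosure D :=
  mem_rangeClosure_of_mem_graph (mem_precomp_graph_iff.1 h)

section SingleOperator

variable (hD : IsSelfAdjoint D) {B : X →L[ℂ] X} (hB : IsUnit (compression (rangeClosure D) B))

include hD hB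

theorem part_precomp_injective (u : rangeClosure D)
    (h : (u, 0) ∈ (part (precomp D B) (rangeClosure D)).graph) : u = 0 := by
  have h1 := (mem_nullSpace_precomp_iff hD).1 (mem_nullSpace_iff.2 (mem_part_graph_iff.1 h))
  rw [← accInv_map hB u, accInv_eq_zero_of_mem h1]

/-- The domain contains the image of the dense domain of `D` under the continuous surjection
`accInv`. -/
theorem dense_domain_part_precomp :
    Dense {u | ∃ v, (u, v) ∈ (part (precomp D B) (rangeClosure D)).graph} := by
  refine ((accInv_surjective hB).denseRange.dense_image (accInv (rangeClosure D) B).continuous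
    hD.dense_domain).mono ?_
  rintro _ ⟨x, hx, rfl⟩
  have h := mem_graph_of_mem hx
  exact ⟨⟨_, mem_rangeClosure_of_mem_graph h⟩,
    mem_part_graph_iff.2 (accInv_mem_precomp_graph hD hB h)⟩

theorem dense_range_part_precomp :
    Dense {v | ∃ u, (u, v) ∈ (part (precomp D B) (rangeClosure D)).graph} := by
  intro v
  rw [closure_subtype]
  refine closure_mono ?_ v.2
  intro w hw
  obtain ⟨x, hx⟩ := mem_range_iff.1 hw
  exact ⟨⟨w, mem_rangeClosure_of_mem_graph hx⟩,
    ⟨_, mem_part_graph_iff.2 (accInv_mem_precomp_graph hD hB hx)⟩, rfl⟩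

end SingleOperator

variable (hD : IsSelfAdjoint D) {U : Set ℂ} (hU : IsOpen U) {B : ℂ → X →L[ℂ] X}
  (hd : DifferentiableOn ℂ B U) (hB : ∀ z ∈ U, IsUnit (compression (rangeClosure D) (B z)))
  {ω : ℝ} (hω : 0 ≤ ω) (hbis : ∀ z ∈ U, IsBisectorial (precomp D (B z)) ω)

include hD hU hd hB hω hbis

theorem differentiableOn_resolventFamily {μ : ℝ} (hωμ : ω < μ) (hμ : μ < Real.pi / 2) {t : ℂ}
    (ht : t ∉ openBisector μ) :
    (t ≠ 0 → ∀ z ∈ U, ∃ R, HasBoundedInverse (affine 1 t (precomp D (B z))) R) ∧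
      DifferentiableOn ℂ (fun z => resolventFamily (precomp D (B z)) t) U := by
  rcases eq_or_ne t 0 with rfl | ht0
  · refine ⟨fun h => absurd rfl h, ?_⟩
    simp only [resolventFamily, if_true]
    exact differentiableOn_const _
  have hl := neg_inv_notMem_closedBisector hω hωμ hμ ht0 ht
  have hR := fun z hz => (hbis z hz).isResolventAt hl
  refine ⟨fun _ z hz => ⟨_, hasBoundedInverse_affine_one ht0 (hR z hz)⟩, ?_⟩
  exact ((differentiableOn_resolventAt hD hU hd hB hR).const_smul t⁻¹).congr fun z hz =>
    resolventFamily_eq ht0 (hR z hz)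

theorem differentiableOn_psiCalculus_part {θ μ : ℝ} (hωθ : ω < θ) (hθμ : θ < μ)
    (hμ : μ < Real.pi / 2) {ψ : ℂ → ℂ} (hψ : ψ ∈ Psi μ) :
    (∀ z ∈ U, IntegrableOn
      (contourIntegrand (part (precomp D (B z)) (rangeClosure D)) θ ψ) (Ioi 0)) ∧
      DifferentiableOn ℂ
        (fun z => psiCalculus (part (precomp D (B z)) (rangeClosure D)) θ ψ) U := by
  obtain ⟨h1, h2⟩ :=
    integrable_and_differentiableOn_psiCalculus hD hU hd hB hω hbis hωθ hθμ hμ hψ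
  have h3 := fun z hz => integrableOn_contourIntegrand_part (K := rangeClosure D)
    (mem_rangeClosure_of_mem_precomp_graph D (B z)) (hbis z hz) hω hωθ (hθμ.trans hμ) (h1 z hz)
  exact ⟨fun z hz => (h3 z hz).1,
    (differentiableOn_compression h2).congr fun z hz => (h3 z hz).2⟩

omit hω in
theorem differentiableOn_resolventAt_part {l : ℂ} (hl : l ∉ closedBisector ω) :
    DifferentiableOn ℂ
      (fun z => resolventAt (part (precomp D (B z)) (rangeClosure D)) l) U :=
  (differentiableOn_compression (differentiableOn_resolventAt hD hU hd hB
    fun z hz => (hbis z hz).isResolventAt hl)).congr fun z hz =>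
      resolventAt_part (mem_rangeClosure_of_mem_precomp_graph D (B z)) (hbis z hz) hl

omit hω in
theorem differentiableOn_approxQuotient_part {b : ℂ} (hb : -b ∉ closedBisector ω)
    (hb' : -b⁻¹ ∉ closedBisector ω) :
    DifferentiableOn ℂ
      (fun z => approxQuotient (part (precomp D (B z)) (rangeClosure D)) b) U := by
  have h1 := differentiableOn_resolventAt_part hD hU hd hB hbis hb
  have h2 : DifferentiableOn ℂ (fun z => yosida (part (precomp D (B z)) (rangeClosure D)) b) U :=
    (differentiableOn_resolventAt_part hD hU hd hB hbis hb').const_smul b⁻¹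
  have h3 : DifferentiableOn ℂ (fun z => approxId (part (precomp D (B z)) (rangeClosure D)) b) U :=
    h2.sub ((DifferentiableOn.clm_comp h1 h2).const_smul b)
  exact (((h2.const_sub 1).const_smul b⁻¹).sub (h3.const_smul b)).add
    (DifferentiableOn.clm_comp h1 h2)

/-- `F z` is the strong limit of `F z * approxId`, which `mul_approxId_eq` rewrites as a product of
holomorphic families. -/
theorem differentiableOn_hInftyCalculus {θ μ : ℝ} (hωθ : ω < θ) (hθμ : θ < μ)
    (hμ : μ < Real.pi / 2) {f : ℂ → ℂ} (hf : f ∈ HInfty μ)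
    {F : ℂ → (rangeClosure D →L[ℂ] rangeClosure D)} {N : ℝ} (hFN : ∀ z ∈ U, ‖F z‖ ≤ N)
    (hF : ∀ z ∈ U, EqBounded (hInftyCalculus (part (precomp D (B z)) (rangeClosure D)) θ f) (F z)) :
    DifferentiableOn ℂ F U := by
  have hpart := fun z hz => isBisectorial_part (K := rangeClosure D)
    (mem_rangeClosure_of_mem_precomp_graph D (B z)) hω (hbis z hz)
  obtain ⟨α, hωα, hαθ⟩ := exists_between hωθ
  have hα := hαθ.trans (hθμ.trans hμ)
  -- On the imaginary axis, both `-b` and `-b⁻¹` avoid every bisector.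
  set b : ℕ → ℂ := fun k => ((((k : ℝ) + 1)⁻¹ : ℝ) : ℂ) * Complex.I with hbdef
  have hb0 : ∀ k, b k ≠ 0 := fun k =>
    mul_ne_zero (Complex.ofReal_ne_zero.2 (by positivity)) Complex.I_ne_zero
  have hblim : Tendsto b atTop (𝓝 0) := by
    have h1 := (Complex.continuous_ofReal.tendsto 0).comp
      (tendsto_one_div_add_atTop_nhds_zero_nat (𝕜 := ℝ))
    have h2 := h1.mul_const Complex.I
    simpa [Function.comp_def, hbdef] using h2
  have hneg : ∀ k, -b k = ((-((k : ℝ) + 1)⁻¹ : ℝ) : ℂ) * Complex.I := fun k => by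
    rw [Complex.ofReal_neg, neg_mul]
  have hneginv : ∀ k, -(b k)⁻¹ = (((k : ℝ) + 1 : ℝ) : ℂ) * Complex.I := fun k => by
    rw [hbdef, mul_inv, Complex.inv_I, Complex.ofReal_inv, inv_inv, mul_neg, neg_neg]
  have hbα : ∀ k, -b k ∉ closedBisector α := fun k => by
    rw [hneg]
    exact I_mul_notMem_closedBisector (hω.trans hωα.le) hα (neg_ne_zero.2 (by positivity))
  have hbα' : ∀ k, -(b k)⁻¹ ∉ closedBisector α := fun k => by
    rw [hneginv]
    exact I_mul_notMem_closedBisector (hω.trans hωα.le) hα (by positivity)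
  have hbω : ∀ k, -b k ∉ closedBisector ω := fun k h => hbα k (closedBisector_subset hω hωα hα h)
  have hbω' : ∀ k, -(b k)⁻¹ ∉ closedBisector ω := fun k h =>
    hbα' k (closedBisector_subset hω hωα hα h)
  have hprod : ∀ z ∈ U, ∀ k,
      F z * approxId (part (precomp D (B z)) (rangeClosure D)) (b k) =
        psiCalculus (part (precomp D (B z)) (rangeClosure D)) θ (fun z => f z * regulariser z) *
          approxQuotient (part (precomp D (B z)) (rangeClosure D)) (b k) := fun z hz k =>
    mul_approxId_eq hω hωθ hθμ hμ (hpart z hz) (part_precomp_injective hD (hB z hz)) hf (hF z hz)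
      (hbω k) (hbω' k)
  refine differentiableOn_of_tendsto_strong hU
    (Fk := fun k z => psiCalculus (part (precomp D (B z)) (rangeClosure D)) θ
      (fun z => f z * regulariser z) *
        approxQuotient (part (precomp D (B z)) (rangeClosure D)) (b k)) (fun k => ?_)
    (fun c hc => ?_) fun z hz u => ?_
  · exact DifferentiableOn.clm_comp
      (differentiableOn_psiCalculus_part hD hU hd hB hω hbis hωθ hθμ hμ
        (mul_regulariser_mem_Psi (hω.trans_lt (hωθ.trans hθμ)) hμ hf)).2
      (differentiableOn_approxQuotient_part hD hU hd hB hbis (hbω k) (hbω' k))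
  · obtain ⟨R, hR, hRU, M, hM, hMb⟩ :=
      exists_locally_uniform_resolvent_bound hD hU hd hB hω hbis hωα hα hc
    refine ⟨N * (M + M * M), ?_⟩
    filter_upwards [Metric.ball_mem_nhds c hR] with z hz k
    have hres : ∀ l ∉ closedBisector α,
        ‖resolventAt (part (precomp D (B z)) (rangeClosure D)) l‖ ≤ M * ‖l‖⁻¹ := fun l hl => by
      rw [resolventAt_part (mem_rangeClosure_of_mem_precomp_graph D (B z)) (hbis z (hRU hz))
        fun h => hl (closedBisector_subset hω hωα hα h)]
      exact (norm_compression_le _ _).trans (hMb z hz l hl)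
    rw [← hprod z (hRU hz) k]
    refine (norm_mul_le _ _).trans (mul_le_mul (hFN z (hRU hz)) ?_ (norm_nonneg _)
      ((norm_nonneg (F z)).trans (hFN z (hRU hz))))
    exact norm_approxId_le (hb0 k) (hres _ (hbα k)) (hres _ (hbα' k))
  · obtain ⟨M, hM, hMb⟩ := (hpart z hz).2.2 α hωα hα
    have hlim := tendsto_approxId hb0 hblim (fun k => (hpart z hz).isResolventAt (hbω k))
      (fun k => (hpart z hz).isResolventAt (hbω' k)) (fun k => hMb _ (hbα k))
      (fun k => hMb _ (hbα' k)) (dense_domain_part_precomp hD (hB z hz))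
      (dense_range_part_precomp hD (hB z hz)) u
    refine (((F z).continuous.tendsto u).comp hlim).congr fun k => ?_
    exact DFunLike.congr_fun (hprod z hz k) u

omit hU hω hbis in
theorem exists_extension {F : ℂ → (rangeClosure D →L[ℂ] rangeClosure D)}
    (hF : DifferentiableOn ℂ F U) (c : ℂ) :
    ∃ G : ℂ → (X →L[ℂ] X), (∀ z ∈ U, (∀ u : rangeClosure D, G z u = F z u) ∧
      ∀ u ∈ nullSpace (precomp D (B z)), G z u = c • u) ∧ DifferentiableOn ℂ G U := by
  -- `F Q + c (1 - Q)` with `Q = A B` the projection onto `K` along the null space.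
  refine ⟨fun z => (rangeClosure D).subtypeL ∘L (F z ∘L (accInv (rangeClosure D) (B z) ∘L B z)) +
    c • (1 - (rangeClosure D).subtypeL ∘L (accInv (rangeClosure D) (B z) ∘L B z)),
    fun z hz => ⟨fun u => ?_, fun u hu => ?_⟩, ?_⟩
  · simp [accInv_map (hB z hz)]
  · have := accInv_eq_zero_of_mem (B := B z) ((mem_nullSpace_precomp_iff hD).1 hu)
    simp [this]
  · have hQ : DifferentiableOn ℂ (fun z => accInv (rangeClosure D) (B z) ∘L B z) U :=
      (differentiableOn_accInv hd hB).clm_comp hd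
    exact ((differentiableOn_const _).clm_comp (hF.clm_comp hQ)).add
      ((((differentiableOn_const _).clm_comp hQ).const_sub 1).const_smul c)

end Main

/-- `mulOp` as a bounded linear map. -/
def mulOpL (n : ℕ) : LInf n →L[ℂ] L2 n →L[ℂ] L2 n :=
  (ContinuousLinearMap.id ℂ
    (EuclideanSpace ℂ (Fin (n + 2)) →L[ℂ] EuclideanSpace ℂ (Fin (n + 2)))).holderL
      (volume : Measure (EuclideanSpace ℝ (Fin n))) ∞ 2 2

end AnalyticDependence

end

theorem mainTheorem10 (n : ℕ)
    (D : AnalyticDependence.L2 n →ₗ.[ℂ] AnalyticDependence.L2 n) (hD : IsSelfAdjoint D)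
    (U : Set ℂ) (hU : IsOpen U)
    (B : ℂ → AnalyticDependence.LInf n) (hB : DifferentiableOn ℂ B U)
    (M : ℝ) (hM : ∀ z ∈ U, ‖B z‖ ≤ M)
    (κ : ℝ) (hκ : 0 < κ)
    (hell : ∀ z ∈ U, ∀ u ∈ AnalyticDependence.rangeClosure D,
      κ * ‖u‖ ^ 2 ≤ (inner ℂ (AnalyticDependence.mulOp (B z) u) u).re) :
    -- every common angle of accretivity of the `B z` is a type of bisectoriality of all `D B z`
    (∀ ω : ℝ, 0 ≤ ω → ω < Real.pi / 2 →
      (∀ z ∈ U, ∀ u ∈ AnalyticDependence.rangeClosure D,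
        |(inner ℂ (AnalyticDependence.mulOp (B z) u) u).arg| ≤ ω) →
      ∀ z ∈ U, AnalyticDependence.IsBisectorial (AnalyticDependence.opDB D (B z)) ω) ∧
    (∃ ω : ℝ, 0 ≤ ω ∧ ω < Real.pi / 2 ∧
      ∀ z ∈ U, AnalyticDependence.IsBisectorial (AnalyticDependence.opDB D (B z)) ω) ∧
    -- the projection onto the null space of `D B z` along the closure of its range
    (∃ P : ℂ → (AnalyticDependence.L2 n →L[ℂ] AnalyticDependence.L2 n),
      (∀ z ∈ U, AnalyticDependence.IsNullProjection (AnalyticDependence.opDB D (B z)) (P z)) ∧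
      DifferentiableOn ℂ P U) ∧
    ∀ ω μ : ℝ, 0 ≤ ω → ω < μ → μ < Real.pi / 2 →
      (∀ z ∈ U, AnalyticDependence.IsBisectorial (AnalyticDependence.opDB D (B z)) ω) →
      -- the resolvents
      (∀ t : ℂ, t ∉ AnalyticDependence.openBisector μ →
        (t ≠ 0 → ∀ z ∈ U, ∃ R, AnalyticDependence.HasBoundedInverse
          (AnalyticDependence.affine 1 t (AnalyticDependence.opDB D (B z))) R) ∧
        DifferentiableOn ℂ
          (fun z => AnalyticDependence.resolventFamily (AnalyticDependence.opDB D (B z)) t) U) ∧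
      -- the functional calculus, with the contour at any angle between `ω` and `μ`
      ∀ θ : ℝ, ω < θ → θ < μ →
        (∀ ψ ∈ AnalyticDependence.Psi μ,
          ((∀ z ∈ U, IntegrableOn
              (AnalyticDependence.contourIntegrand (AnalyticDependence.opDB D (B z)) θ ψ)
              (Ioi 0)) ∧
            DifferentiableOn ℂ
              (fun z =>
                AnalyticDependence.psiCalculus (AnalyticDependence.opDB D (B z)) θ ψ) U) ∧
          ((∀ z ∈ U, IntegrableOn
              (AnalyticDependence.contourIntegrand (AnalyticDependence.part
                (AnalyticDependence.opDB D (B z)) (AnalyticDependence.rangeClosure D)) θ ψ)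
              (Ioi 0)) ∧
            DifferentiableOn ℂ
              (fun z => AnalyticDependence.psiCalculus (AnalyticDependence.part
                (AnalyticDependence.opDB D (B z)) (AnalyticDependence.rangeClosure D)) θ ψ) U)) ∧
        ((∃ C : ℝ, ∀ z ∈ U, AnalyticDependence.HasBoundedCalculus
            (AnalyticDependence.part (AnalyticDependence.opDB D (B z))
              (AnalyticDependence.rangeClosure D)) θ μ C) →
          ∀ f ∈ AnalyticDependence.HInfty μ,
            ∃ F : ℂ → (AnalyticDependence.rangeClosure D →L[ℂ] AnalyticDependence.rangeClosure D),
              (∀ z ∈ U, AnalyticDependence.EqBounded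
                (AnalyticDependence.hInftyCalculus
                  (AnalyticDependence.part (AnalyticDependence.opDB D (B z))
                    (AnalyticDependence.rangeClosure D)) θ f) (F z)) ∧
              DifferentiableOn ℂ F U ∧
              -- the extension to the whole space by a value `c` on the null space
              ∀ c : ℂ, ∃ G : ℂ → (AnalyticDependence.L2 n →L[ℂ] AnalyticDependence.L2 n),
                (∀ z ∈ U,
                  (∀ u : AnalyticDependence.rangeClosure D, G z u = F z u) ∧
                  ∀ u ∈ AnalyticDependence.nullSpace (AnalyticDependence.opDB D (B z)),
                    G z u = c • u) ∧
                DifferentiableOn ℂ G U) := by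
  -- `mulOp` is the bounded linear map `mulOpL n`, so holomorphy in `L^∞` becomes holomorphy in
  -- operator norm.
  have hd : DifferentiableOn ℂ (fun z => AnalyticDependence.mulOp (B z)) U :=
    AnalyticDependence.differentiableOn_clm_apply (AnalyticDependence.mulOpL n) hB
  have hunit : ∀ z ∈ U, IsUnit (AnalyticDependence.compression (AnalyticDependence.rangeClosure D)
      (AnalyticDependence.mulOp (B z))) := fun z hz =>
    AnalyticDependence.isUnit_compression hκ (hell z hz)
  refine ⟨fun ω hω hω' harg z hz =>
    AnalyticDependence.isBisectorial_precomp hD hκ (hell z hz) hω hω' (harg z hz), ?_, ?_, ?_⟩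
  -- For empty `U` the bound `M` may be negative, so the arctangent is not a usable angle.
  · rcases U.eq_empty_or_nonempty with rfl | ⟨z₀, hz₀⟩
    · exact ⟨0, le_rfl, by positivity, fun z hz => absurd hz (notMem_empty z)⟩
    have hM0 : 0 ≤ M := (norm_nonneg _).trans (hM z₀ hz₀)
    set L := AnalyticDependence.mulOpL n
    refine ⟨Real.arctan (‖L‖ * M / κ), Real.arctan_nonneg.2 (by positivity),
      Real.arctan_lt_pi_div_two _, fun z hz => ?_⟩
    exact AnalyticDependence.isBisectorial_precomp_arctan hD hκ (hell z hz) (by positivity)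
      ((L.le_opNorm (B z)).trans (by gcongr; exact hM z hz))
  · exact ⟨_, fun z hz => AnalyticDependence.isNullProjection_precomp hD (hunit z hz),
      (((differentiableOn_const _).clm_comp
        ((AnalyticDependence.differentiableOn_accInv hd hunit).clm_comp hd)).const_sub 1)⟩
  · intro ω μ hω hωμ hμ hbis
    refine ⟨fun t ht => AnalyticDependence.differentiableOn_resolventFamily hD hU hd hunit hω hbis
      hωμ hμ ht, fun θ hωθ hθμ => ⟨fun ψ hψ =>
        ⟨AnalyticDependence.integrable_and_differentiableOn_psiCalculus hD hU hd hunit hω hbis hωθ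
          hθμ hμ hψ,
        AnalyticDependence.differentiableOn_psiCalculus_part hD hU hd hunit hω hbis hωθ hθμ hμ hψ⟩,
      ?_⟩⟩
    rintro ⟨C, hC⟩ f hf
    have hex : ∀ z, ∃ F : AnalyticDependence.rangeClosure D →L[ℂ] AnalyticDependence.rangeClosure D,
        z ∈ U → AnalyticDependence.EqBounded (AnalyticDependence.hInftyCalculus
          (AnalyticDependence.part (AnalyticDependence.opDB D (B z))
            (AnalyticDependence.rangeClosure D)) θ f) F ∧
          ∀ u, ‖F u‖ ≤ C * AnalyticDependence.supNorm μ f * ‖u‖ := fun z => by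
      by_cases hz : z ∈ U
      · obtain ⟨F, hF⟩ := hC z hz f hf
        exact ⟨F, fun _ => hF⟩
      · exact ⟨0, fun h => absurd h hz⟩
    choose F hF using hex
    have hFd : DifferentiableOn ℂ F U := by
      refine AnalyticDependence.differentiableOn_hInftyCalculus hD hU hd hunit hω hbis hωθ hθμ hμ hf
        -- The sign of `C` is not prescribed, hence the absolute value.
        (N := |C * AnalyticDependence.supNorm μ f|) (fun z hz => ?_) fun z hz => (hF z hz).1
      refine ContinuousLinearMap.opNorm_le_bound _ (abs_nonneg _) fun u => ?_
      exact ((hF z hz).2 u).trans (by gcongr; exact le_abs_self _)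
    exact ⟨F, fun z hz => (hF z hz).1, hFd,
      fun c => AnalyticDependence.exists_extension hD hd hunit hFd c⟩
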